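/- **Conventions.** All tensor products of C*-algebras are minimal (spatial) ones, $M(A)$ is the multiplier algebra of $A$, and $I$ is the unit of $M(A)$. A pair $(A,\Delta)$ is a *C\*-bialgebra* if $A$ is a C*-algebra and $\Delta:A\to M(A\otimes A)$ is a $*$-homomorphism such that the linear span of $\{\Delta(a)(b\otimes c):a,b,c\in A\}$ is norm dense in $A\otimes A$ and $(\Delta\otimes \mathrm{id})\circ\Delta=(\mathrm{id}\otimes\Delta)\circ\Delta$, where $\Delta\otimes\mathrm{id}$ and $\mathrm{id}\otimes\Delta$ are extended to unital $*$-homomorphisms from $M(A\otimes A)$ to $M(A\otimes A\otimes A)$. It is *cocommutative* if $\Delta$ is invariant under (the extension to $M(A\otimes A)$ of) the flip automorphism $a\otimes b\mapsto b\otimes a$. A *counit* is a $*$-homomorphism $\varepsilon:A\to\mathbb{C}$ with $(\varepsilon\otimes\mathrm{id})\circ\Delta=\mathrm{id}=(\mathrm{id}\otimes\varepsilon)\circ\Delta$. The pair is *proper* if $\Delta(a)(I\otimes b)\in A\otimes A$ and $(b\otimes I)\Delta(a)\in A\otimes A$ for all $a,b\in A$. A proper C*-bialgebra satisfies the *cancellation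 law* if the linear spans of $\{\Delta(a)(I\otimes b):a,b\in A\}$ and of $\{\Delta(a)(b\otimes I):a,b\in A\}$ are dense subspaces of $A\otimes A$. **The algebra.** Let $S$ be the set of all sequences $\mathbf a=(a_1,a_2,\ldots)$ of integers $a_i\ge 2$ together with the constant sequence $\mathbf 1=(1,1,\ldots)$; it is a commutative monoid under componentwise multiplication $\mathbf a\cdot\mathbf b=(a_1b_1,a_2b_2,\ldots)$. For $\mathbf a\in S$, $\mathbf a\neq\mathbf 1$, let $\mathcal A(\mathbf a)$ be the UHF algebra $\varinjlim_n \mathcal A_n(\mathbf a)$, where $\mathcal A_n(\mathbf a)=M_{a_1}(\mathbb{C})\otimes\cdots\otimes M_{a_n}(\mathbb{C})$ is embedded in $\mathcal A_{n+1}(\mathbf a)$ by $x\mapsto x\otimes I$, and let $\mathcal A(\mathbf 1)=\mathbb{C}$. Let $$\mathcal A(*)=\bigoplus_{\mathbf a\in S}\mathcal A(\mathbf a)$$ be the C*-algebra ($c_0$-)direct sum, i.e. all families $(x_{\mathbf a})_{\mathbf a\in S}$, $x_{\mathbf a}\in\mathcal A(\mathbf a)$, such that for every $\delta>0$ one has $\|x_{\mathbf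 a}\|\ge\delta$ for only finitely many $\mathbf a$. **The comultiplication.** For $\mathbf b,\mathbf c\in S\setminus\{\mathbf 1\}$ let $\varphi_{\mathbf b,\mathbf c}:\mathcal A(\mathbf b\cdot\mathbf c)\to\mathcal A(\mathbf b)\otimes\mathcal A(\mathbf c)$ be the $*$-isomorphism given on matrix units by $$\varphi_{\mathbf b,\mathbf c}\bigl(E^{(b_1c_1)}_{j_1,k_1}\otimes\cdots\otimes E^{(b_nc_n)}_{j_n,k_n}\bigr)=\bigl(E^{(b_1)}_{j_1',k_1'}\otimes\cdots\otimes E^{(b_n)}_{j_n',k_n'}\bigr)\otimes\bigl(E^{(c_1)}_{j_1'',k_1''}\otimes\cdots\otimes E^{(c_n)}_{j_n'',k_n''}\bigr),$$ where $j_i=c_i(j_i'-1)+j_i''$, $k_i=c_i(k_i'-1)+k_i''$ with $j_i',k_i'\in\{1,\ldots,b_i\}$ and $j_i'',k_i''\in\{1,\ldots,c_i\}$. For $\mathbf a\in S$ put $\varphi_{\mathbf 1,\mathbf a}(x)=1\otimes x$ and $\varphi_{\mathbf a,\mathbf 1}(x)=x\otimes 1$. Since $\mathcal A(*)\otimes\mathcal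 A(*)=\bigoplus_{(\mathbf b,\mathbf c)\in S\times S}\mathcal A(\mathbf b)\otimes\mathcal A(\mathbf c)$, every bounded family in $\prod_{(\mathbf b,\mathbf c)}\mathcal A(\mathbf b)\otimes\mathcal A(\mathbf c)$ is a multiplier of $\mathcal A(*)\otimes\mathcal A(*)$. Define $$\Delta_\varphi:\mathcal A(*)\to M(\mathcal A(*)\otimes\mathcal A(*)),\qquad \Delta_\varphi(x)=\bigl(\varphi_{\mathbf b,\mathbf c}(x_{\mathbf b\cdot\mathbf c})\bigr)_{(\mathbf b,\mathbf c)\in S\times S},$$ and let $\varepsilon:\mathcal A(*)\to\mathcal A(\mathbf 1)=\mathbb{C}$, $\varepsilon(x)=x_{\mathbf 1}$, be the projection. **Theorem.** 1. $(\mathcal A(*),\Delta_\varphi)$ is a non-cocommutative proper C*-bialgebra with counit $\varepsilon$. 2. $(\mathcal A(*),\Delta_\varphi)$ satisfies the cancellation law. -/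

import Mathlib

open scoped TensorProduct ENNReal ComplexOrder MultiplierAlgebra InnerProductSpace

noncomputable section HilbertTensor

variable {H K : Type*} [NormedAddCommGroup H] [InnerProductSpace ℂ H] [CompleteSpace H]
  [NormedAddCommGroup K] [InnerProductSpace ℂ K] [CompleteSpace K]

/-- The Hilbert space tensor product of `H` and `K`. -/
abbrev HilbertTensor (H K : Type*) [NormedAddCommGroup H] [InnerProductSpace ℂ H]
    [NormedAddCommGroup K] [InnerProductSpace ℂ K] : Type _ :=
  UniformSpace.Completion (H ⊗[ℂ] K)

theorem inner_map_tensor (T : H →L[ℂ] H) (S : K →L[ℂ] K) (x y : H ⊗[ℂ] K) :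
    ⟪TensorProduct.map (T : H →ₗ[ℂ] H) (S : K →ₗ[ℂ] K) x, y⟫_ℂ =
      ⟪x, TensorProduct.map ((star T : H →L[ℂ] H) : H →ₗ[ℂ] H)
        ((star S : K →L[ℂ] K) : K →ₗ[ℂ] K) y⟫_ℂ := by
  induction x with
  | zero => simp
  | add a b ha hb => simp only [map_add, inner_add_left, ha, hb]
  | tmul a b =>
    induction y with
    | zero => simp
    | add c d hc hd => simp only [map_add, inner_add_right, hc, hd]
    | tmul c d =>
      simp [TensorProduct.inner_tmul, ContinuousLinearMap.star_eq_adjoint,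
        ContinuousLinearMap.adjoint_inner_right]

theorem norm_rTensor_le (T : H →L[ℂ] H) (x : H ⊗[ℂ] K) :
    ‖TensorProduct.map (T : H →ₗ[ℂ] H) (LinearMap.id : K →ₗ[ℂ] K) x‖ ≤ ‖T‖ * ‖x‖ := by
  have h0 : (0 : H →L[ℂ] H) ≤ algebraMap ℝ _ (‖T‖ ^ 2) - star T * T := by
    have := CStarAlgebra.star_mul_le_algebraMap_norm_sq (a := T)
    exact sub_nonneg.2 this
  obtain ⟨R, hR⟩ := (CStarAlgebra.nonneg_iff_eq_star_mul_self).1 h0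
  have key : ∀ U : H →L[ℂ] H, (‖TensorProduct.map (U : H →ₗ[ℂ] H) (LinearMap.id : K →ₗ[ℂ] K) x‖ : ℂ) ^ 2
      = ⟪x, TensorProduct.map ((star U * U : H →L[ℂ] H) : H →ₗ[ℂ] H)
        (LinearMap.id : K →ₗ[ℂ] K) x⟫_ℂ := by
    intro U
    have h1 := inner_map_tensor (K := K) U 1 x (TensorProduct.map (U : H →ₗ[ℂ] H) (LinearMap.id : K →ₗ[ℂ] K) x)
    have h2 := inner_self_eq_norm_sq_to_K (𝕜 := ℂ) (TensorProduct.map (U : H →ₗ[ℂ] H) (LinearMap.id : K →ₗ[ℂ] K) x)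
    refine h2.symm.trans (h1.trans ?_)
    rw [← LinearMap.comp_apply, ← TensorProduct.map_comp]
    simp only [star_one]
    rfl
  have e1 := key R
  have e2 := key T
  rw [← hR] at e1
  have e3 : ((algebraMap ℝ (H →L[ℂ] H) (‖T‖ ^ 2) - star T * T : H →L[ℂ] H) : H →ₗ[ℂ] H)
      = ((‖T‖ ^ 2 : ℝ) : ℂ) • LinearMap.id - ((star T * T : H →L[ℂ] H) : H →ₗ[ℂ] H) := by
    ext v
    simp [Algebra.algebraMap_eq_smul_one, -Complex.ofReal_pow]
  rw [e3] at e1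
  have e5 : TensorProduct.map (((‖T‖ ^ 2 : ℝ) : ℂ) • (LinearMap.id : H →ₗ[ℂ] H)
      - ((star T * T : H →L[ℂ] H) : H →ₗ[ℂ] H)) (LinearMap.id : K →ₗ[ℂ] K)
      = ((‖T‖ ^ 2 : ℝ) : ℂ) • TensorProduct.map LinearMap.id LinearMap.id
        - TensorProduct.map ((star T * T : H →L[ℂ] H) : H →ₗ[ℂ] H) LinearMap.id := by
    ext a b
    simp [TensorProduct.sub_tmul, TensorProduct.smul_tmul']
  rw [e5, LinearMap.sub_apply, inner_sub_right, ← e2, TensorProduct.map_id, LinearMap.smul_apply, LinearMap.id_apply,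
    inner_smul_right, inner_self_eq_norm_sq_to_K] at e1
  have e4 : ‖TensorProduct.map (R : H →ₗ[ℂ] H) (LinearMap.id : K →ₗ[ℂ] K) x‖ ^ 2 =
      ‖T‖ ^ 2 * ‖x‖ ^ 2 - ‖TensorProduct.map (T : H →ₗ[ℂ] H) (LinearMap.id : K →ₗ[ℂ] K) x‖ ^ 2 := by
    have := e1
    simp only [RCLike.ofReal_eq_complex_ofReal] at this
    exact_mod_cast this
  refine le_of_sq_le_sq ?_ (by positivity)
  nlinarith [sq_nonneg ‖TensorProduct.map (R : H →ₗ[ℂ] H) (LinearMap.id : K →ₗ[ℂ] K) x‖]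

theorem norm_map_tensor_le (T : H →L[ℂ] H) (S : K →L[ℂ] K) (x : H ⊗[ℂ] K) :
    ‖TensorProduct.map (T : H →ₗ[ℂ] H) (S : K →ₗ[ℂ] K) x‖ ≤ ‖T‖ * ‖S‖ * ‖x‖ := by
  have h1 : TensorProduct.map (T : H →ₗ[ℂ] H) (S : K →ₗ[ℂ] K) x =
      TensorProduct.map (T : H →ₗ[ℂ] H) (LinearMap.id : K →ₗ[ℂ] K)
        (TensorProduct.map (LinearMap.id : H →ₗ[ℂ] H) (S : K →ₗ[ℂ] K) x) := by
    rw [← LinearMap.comp_apply, ← TensorProduct.map_comp]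
    rfl
  have h2 : ‖TensorProduct.map (LinearMap.id : H →ₗ[ℂ] H) (S : K →ₗ[ℂ] K) x‖ ≤ ‖S‖ * ‖x‖ := by
    have h3 := norm_rTensor_le (K := H) S (TensorProduct.comm ℂ H K x)
    have h4 : TensorProduct.map (S : K →ₗ[ℂ] K) (LinearMap.id : H →ₗ[ℂ] H)
        (TensorProduct.comm ℂ H K x) =
        TensorProduct.comm ℂ H K (TensorProduct.map (LinearMap.id : H →ₗ[ℂ] H) (S : K →ₗ[ℂ] K) x) :=
      TensorProduct.map_comm _ _ _
    rw [h4] at h3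
    simpa only [TensorProduct.norm_comm] using h3
  rw [h1, mul_assoc]
  exact (norm_rTensor_le T _).trans (mul_le_mul_of_nonneg_left h2 (norm_nonneg _))

/-- The operator `T ⊗ S` on the algebraic tensor product `H ⊗ K`. -/
def opTensorPre (T : H →L[ℂ] H) (S : K →L[ℂ] K) : (H ⊗[ℂ] K) →L[ℂ] (H ⊗[ℂ] K) :=
  (TensorProduct.map (T : H →ₗ[ℂ] H) (S : K →ₗ[ℂ] K)).mkContinuous (‖T‖ * ‖S‖)
    (norm_map_tensor_le T S)

/-- The bounded operator `T ⊗ S` on the Hilbert space tensor product of `H` and `K`. -/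
def opTensor (T : H →L[ℂ] H) (S : K →L[ℂ] K) : HilbertTensor H K →L[ℂ] HilbertTensor H K :=
  (opTensorPre T S).completion

@[simp] theorem opTensor_tmul (T : H →L[ℂ] H) (S : K →L[ℂ] K) (x : H) (y : K) :
    opTensor T S ((x ⊗ₜ[ℂ] y : H ⊗[ℂ] K) : HilbertTensor H K) = ((T x ⊗ₜ[ℂ] S y : H ⊗[ℂ] K) : HilbertTensor H K) := by
  simp [opTensor, opTensorPre]

theorem HilbertTensor.clm_ext {U V : HilbertTensor H K →L[ℂ] HilbertTensor H K}
    (h : ∀ x y, U ((x ⊗ₜ[ℂ] y : H ⊗[ℂ] K) : HilbertTensor H K) =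
      V ((x ⊗ₜ[ℂ] y : H ⊗[ℂ] K) : HilbertTensor H K)) : U = V := by
  ext v
  induction v using UniformSpace.Completion.induction_on with
  | hp => exact isClosed_eq U.continuous V.continuous
  | ih v =>
    induction v with
    | zero => rw [UniformSpace.Completion.coe_zero, map_zero, map_zero]
    | tmul x y => exact h x y
    | add a b ha hb => rw [UniformSpace.Completion.coe_add, map_add, map_add, ha, hb]

theorem opTensor_add_left (T T' : H →L[ℂ] H) (S : K →L[ℂ] K) :
    opTensor (T + T') S = opTensor T S + opTensor T' S :=
  HilbertTensor.clm_ext fun x y => by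
    simp [TensorProduct.add_tmul, UniformSpace.Completion.coe_add]

theorem opTensor_add_right (T : H →L[ℂ] H) (S S' : K →L[ℂ] K) :
    opTensor T (S + S') = opTensor T S + opTensor T S' :=
  HilbertTensor.clm_ext fun x y => by
    simp [TensorProduct.tmul_add, UniformSpace.Completion.coe_add]

theorem opTensor_smul_left (c : ℂ) (T : H →L[ℂ] H) (S : K →L[ℂ] K) :
    opTensor (c • T) S = c • opTensor T S :=
  HilbertTensor.clm_ext fun x y => by
    rw [smul_apply, opTensor_tmul, opTensor_tmul,
      ← UniformSpace.Completion.coe_smul, TensorProduct.smul_tmul']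
    rfl

theorem opTensor_smul_right (c : ℂ) (T : H →L[ℂ] H) (S : K →L[ℂ] K) :
    opTensor T (c • S) = c • opTensor T S :=
  HilbertTensor.clm_ext fun x y => by
    simp [UniformSpace.Completion.coe_smul]

theorem opTensor_mul (T T' : H →L[ℂ] H) (S S' : K →L[ℂ] K) :
    opTensor T S * opTensor T' S' = opTensor (T * T') (S * S') :=
  HilbertTensor.clm_ext fun x y => by simp

theorem star_opTensor (T : H →L[ℂ] H) (S : K →L[ℂ] K) :
    star (opTensor T S) = opTensor (star T) (star S) := by
  symm
  rw [ContinuousLinearMap.star_eq_adjoint (opTensor T S)]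
  refine (ContinuousLinearMap.eq_adjoint_iff _ _).2 fun x y => ?_
  induction x, y using UniformSpace.Completion.induction_on₂ with
  | hp => apply isClosed_eq <;> fun_prop
  | ih x y =>
    have := inner_map_tensor (star T) (star S) x y
    simp only [star_star] at this
    simpa [opTensor, opTensorPre] using this

theorem norm_opTensor_le (T : H →L[ℂ] H) (S : K →L[ℂ] K) : ‖opTensor T S‖ ≤ ‖T‖ * ‖S‖ := by
  refine ContinuousLinearMap.opNorm_le_bound _ (by positivity) fun v => ?_
  induction v using UniformSpace.Completion.induction_on with
  | hp => apply isClosed_le <;> fun_prop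
  | ih v => simpa [opTensor, opTensorPre] using norm_map_tensor_le T S v

end HilbertTensor

noncomputable section MinTensor

/- The canonical order of a C*-algebra: `0 ≤ x` iff `x` is self-adjoint with nonnegative spectrum. -/
attribute [local instance] CStarAlgebra.spectralOrder CStarAlgebra.spectralOrderedRing

universe u v

variable (A : Type u) (B : Type v) [NonUnitalCStarAlgebra A] [NonUnitalCStarAlgebra B]

/-- Positive linear functionals on a C*-algebra. -/
abbrev PosFunctional : Type u := A →ₚ[ℂ] ℂ

variable {A B}

/-- The GNS Hilbert space of a positive functional. -/
abbrev PosFunctional.Space (f : PosFunctional A) : Type u := PositiveLinearMap.GNS f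

/-- The GNS representation of a positive functional. -/
def PosFunctional.rep (f : PosFunctional A) : A →⋆ₙₐ[ℂ] (f.Space →L[ℂ] f.Space) :=
  PositiveLinearMap.gnsNonUnitalStarAlgHom f

theorem PosFunctional.norm_rep_le (f : PosFunctional A) (a : A) : ‖f.rep a‖ ≤ ‖a‖ :=
  NonUnitalStarAlgHom.norm_apply_le f.rep a

variable (A B)

/-- The C*-algebra of bounded operators on the Hilbert space `H_f ⊗ H_g`. -/
def GNSOp (p : PosFunctional A × PosFunctional B) : Type max u v :=
  HilbertTensor p.1.Space p.2.Space →L[ℂ] HilbertTensor p.1.Space p.2.Space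

instance (p : PosFunctional A × PosFunctional B) : CStarAlgebra (GNSOp A B p) :=
  inferInstanceAs (CStarAlgebra
    (HilbertTensor p.1.Space p.2.Space →L[ℂ] HilbertTensor p.1.Space p.2.Space))

/-- The C*-algebra of bounded families of operators on the Hilbert spaces `H_f ⊗ H_g`, where
`f`, `g` run through the positive functionals on `A`, `B` and `H_f`, `H_g` are the GNS spaces. -/
def GNSTensorAlgebra : Type max u v :=
  lp (GNSOp A B) ∞

instance : NonUnitalCStarAlgebra (GNSTensorAlgebra A B) :=
  inferInstanceAs (NonUnitalCStarAlgebra (lp (GNSOp A B) ∞))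

variable {A B} in
/-- A bounded family of operators, as an element of the algebra of such families. -/
def GNSTensorAlgebra.mk (T : ∀ p, GNSOp A B p) (C : ℝ) (h : ∀ p, ‖T p‖ ≤ C) :
    GNSTensorAlgebra A B :=
  (⟨T, memℓp_infty ⟨C, by rintro _ ⟨p, rfl⟩; exact h p⟩⟩ : lp (GNSOp A B) ∞)

variable {A B} in
/-- The component of a family of operators at `p`. -/
def GNSTensorAlgebra.coord (x : GNSTensorAlgebra A B) (p : PosFunctional A × PosFunctional B) :
    GNSOp A B p :=
  (show lp (GNSOp A B) ∞ from x) p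

variable {A B}

theorem GNSTensorAlgebra.ext {x y : GNSTensorAlgebra A B} (h : ∀ p, x.coord p = y.coord p) :
    x = y :=
  lp.ext (funext h)

theorem GNSTensorAlgebra.coord_add (x y : GNSTensorAlgebra A B) (p) :
    (x + y).coord p = x.coord p + y.coord p := rfl

theorem GNSTensorAlgebra.coord_mul (x y : GNSTensorAlgebra A B) (p) :
    (x * y).coord p = x.coord p * y.coord p := rfl

theorem GNSTensorAlgebra.coord_smul (c : ℂ) (x : GNSTensorAlgebra A B) (p) :
    (c • x).coord p = c • x.coord p := rfl

theorem GNSTensorAlgebra.coord_star (x : GNSTensorAlgebra A B) (p) :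
    (star x).coord p = star (x.coord p) := rfl


/-- The family of operators `π_f(a) ⊗ π_g(b)`. -/
def gnsTensor (a : A) (b : B) : GNSTensorAlgebra A B :=
  .mk (fun p => (opTensor (p.1.rep a) (p.2.rep b) : GNSOp A B p)) (‖a‖ * ‖b‖) fun p =>
    (norm_opTensor_le _ _).trans
      (mul_le_mul (p.1.norm_rep_le a) (p.2.norm_rep_le b) (norm_nonneg _) (norm_nonneg _))

/-- The family of operators `1 ⊗ π_g(b)`. -/
def gnsTensorRight (b : B) : GNSTensorAlgebra A B :=
  .mk (fun p => (opTensor 1 (p.2.rep b) : GNSOp A B p)) ‖b‖ fun p =>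
    ((norm_opTensor_le _ _).trans
      (mul_le_mul ContinuousLinearMap.norm_id_le (p.2.norm_rep_le b) (norm_nonneg _)
        zero_le_one)).trans_eq (one_mul _)

/-- The family of operators `π_f(a) ⊗ 1`. -/
def gnsTensorLeft (a : A) : GNSTensorAlgebra A B :=
  .mk (fun p => (opTensor (p.1.rep a) 1 : GNSOp A B p)) ‖a‖ fun p =>
    ((norm_opTensor_le _ _).trans
      (mul_le_mul (p.1.norm_rep_le a) ContinuousLinearMap.norm_id_le (norm_nonneg _)
        (norm_nonneg _))).trans_eq (mul_one _)

theorem gnsTensor_mul (a a' : A) (b b' : B) :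
    gnsTensor a b * gnsTensor a' b' = gnsTensor (a * a') (b * b') :=
  GNSTensorAlgebra.ext fun p => by
    rw [GNSTensorAlgebra.coord_mul]
    refine (opTensor_mul _ _ _ _).trans ?_
    rw [← map_mul, ← map_mul]; rfl

theorem gnsTensorRight_mul (a : A) (b b' : B) :
    gnsTensorRight b * gnsTensor a b' = gnsTensor a (b * b') :=
  GNSTensorAlgebra.ext fun p => by
    rw [GNSTensorAlgebra.coord_mul]
    refine (opTensor_mul _ _ _ _).trans ?_
    rw [one_mul, ← map_mul]; rfl

theorem mul_gnsTensorRight (a : A) (b b' : B) :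
    gnsTensor a b' * gnsTensorRight b = gnsTensor a (b' * b) :=
  GNSTensorAlgebra.ext fun p => by
    rw [GNSTensorAlgebra.coord_mul]
    refine (opTensor_mul _ _ _ _).trans ?_
    rw [mul_one, ← map_mul]; rfl

theorem gnsTensorLeft_mul (a a' : A) (b : B) :
    gnsTensorLeft a * gnsTensor a' b = gnsTensor (a * a') b :=
  GNSTensorAlgebra.ext fun p => by
    rw [GNSTensorAlgebra.coord_mul]
    refine (opTensor_mul _ _ _ _).trans ?_
    rw [one_mul, ← map_mul]; rfl

theorem mul_gnsTensorLeft (a a' : A) (b : B) :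
    gnsTensor a' b * gnsTensorLeft a = gnsTensor (a' * a) b :=
  GNSTensorAlgebra.ext fun p => by
    rw [GNSTensorAlgebra.coord_mul]
    refine (opTensor_mul _ _ _ _).trans ?_
    rw [mul_one, ← map_mul]; rfl

theorem star_gnsTensor (a : A) (b : B) : star (gnsTensor a b) = gnsTensor (star a) (star b) :=
  GNSTensorAlgebra.ext fun p => by
    rw [GNSTensorAlgebra.coord_star]
    refine (star_opTensor _ _).trans ?_
    rw [← map_star, ← map_star]; rfl

theorem gnsTensor_add_left (a a' : A) (b : B) :
    gnsTensor (a + a') b = gnsTensor a b + gnsTensor a' b :=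
  GNSTensorAlgebra.ext fun p => by
    rw [GNSTensorAlgebra.coord_add]
    refine Eq.trans ?_ (opTensor_add_left _ _ _)
    rw [← map_add]; rfl

theorem gnsTensor_add_right (a : A) (b b' : B) :
    gnsTensor a (b + b') = gnsTensor a b + gnsTensor a b' :=
  GNSTensorAlgebra.ext fun p => by
    rw [GNSTensorAlgebra.coord_add]
    refine Eq.trans ?_ (opTensor_add_right _ _ _)
    rw [← map_add]; rfl

theorem gnsTensor_smul_left (c : ℂ) (a : A) (b : B) :
    gnsTensor (c • a) b = c • gnsTensor a b :=
  GNSTensorAlgebra.ext fun p => by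
    rw [GNSTensorAlgebra.coord_smul]
    refine Eq.trans ?_ (opTensor_smul_left _ _ _)
    rw [← map_smul]; rfl

theorem gnsTensor_smul_right (c : ℂ) (a : A) (b : B) :
    gnsTensor a (c • b) = c • gnsTensor a b :=
  GNSTensorAlgebra.ext fun p => by
    rw [GNSTensorAlgebra.coord_smul]
    refine Eq.trans ?_ (opTensor_smul_right _ _ _)
    rw [← map_smul]; rfl

variable (A B)

/-- The closed `*`-subalgebra generated by the elements `a ⊗ b` in the tensor product of the
universal representations of `A` and `B`. -/
def minTensorSubalgebra : NonUnitalStarSubalgebra ℂ (GNSTensorAlgebra A B) :=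
  (NonUnitalStarAlgebra.adjoin ℂ (Set.range fun p : A × B => gnsTensor p.1 p.2)).topologicalClosure

instance isClosed_minTensorSubalgebra :
    IsClosed (minTensorSubalgebra A B : Set (GNSTensorAlgebra A B)) :=
  NonUnitalStarSubalgebra.isClosed_topologicalClosure _

/-- The minimal (spatial) tensor product of two C*-algebras: the completion of the algebraic
tensor product in the norm `‖t‖ = sup ‖(π_f ⊗ π_g)(t)‖`, the supremum being taken over the GNS
representations of all pairs of positive functionals, i.e. the norm in the tensor product of the
universal representations. -/
def MinTensor : Type max u v := minTensorSubalgebra A B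

instance : NonUnitalCStarAlgebra (MinTensor A B) :=
  inferInstanceAs (NonUnitalCStarAlgebra (minTensorSubalgebra A B))

variable {A B}

namespace MinTensor

/-- The inclusion of the minimal tensor product in the algebra it is generated in. -/
def incl : MinTensor A B →⋆ₙₐ[ℂ] GNSTensorAlgebra A B :=
  NonUnitalStarSubalgebraClass.subtype (minTensorSubalgebra A B)

theorem incl_injective : Function.Injective (incl : MinTensor A B → GNSTensorAlgebra A B) :=
  Subtype.val_injective

theorem continuous_incl : Continuous (incl : MinTensor A B → GNSTensorAlgebra A B) :=
  continuous_subtype_val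

theorem norm_incl (t : MinTensor A B) : ‖incl t‖ = ‖t‖ := rfl

theorem incl_mem (t : MinTensor A B) : incl t ∈ minTensorSubalgebra A B := t.2

/-- An element of the closed subalgebra, as an element of the minimal tensor product. -/
def ofMem (x : GNSTensorAlgebra A B) (hx : x ∈ minTensorSubalgebra A B) : MinTensor A B :=
  ⟨x, hx⟩

theorem incl_ofMem (x : GNSTensorAlgebra A B) (hx) : incl (ofMem x hx) = x := rfl

theorem gnsTensor_mem (a : A) (b : B) : gnsTensor a b ∈ minTensorSubalgebra A B :=
  NonUnitalStarSubalgebra.le_topologicalClosure _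
    (NonUnitalStarAlgebra.subset_adjoin ℂ _ ⟨(a, b), rfl⟩)

/-- The elementary tensor `a ⊗ b` in the minimal tensor product. -/
def tmul (a : A) (b : B) : MinTensor A B := ofMem (gnsTensor a b) (gnsTensor_mem a b)

theorem incl_tmul (a : A) (b : B) : incl (tmul a b) = gnsTensor a b := rfl

theorem tmul_mul_tmul (a a' : A) (b b' : B) : tmul a b * tmul a' b' = tmul (a * a') (b * b') :=
  incl_injective (by rw [map_mul]; exact gnsTensor_mul _ _ _ _)

theorem star_tmul (a : A) (b : B) : star (tmul a b) = tmul (star a) (star b) :=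
  incl_injective (by rw [map_star]; exact star_gnsTensor _ _)

theorem add_tmul (a a' : A) (b : B) : tmul (a + a') b = tmul a b + tmul a' b :=
  incl_injective (by rw [map_add]; exact gnsTensor_add_left _ _ _)

theorem tmul_add (a : A) (b b' : B) : tmul a (b + b') = tmul a b + tmul a b' :=
  incl_injective (by rw [map_add]; exact gnsTensor_add_right _ _ _)

theorem smul_tmul (c : ℂ) (a : A) (b : B) : tmul (c • a) b = c • tmul a b :=
  incl_injective (by rw [map_smul]; exact gnsTensor_smul_left _ _ _)

theorem tmul_smul (c : ℂ) (a : A) (b : B) : tmul a (c • b) = c • tmul a b :=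
  incl_injective (by rw [map_smul]; exact gnsTensor_smul_right _ _ _)

theorem norm_tmul_le (a : A) (b : B) : ‖tmul a b‖ ≤ ‖a‖ * ‖b‖ :=
  lp.norm_le_of_forall_le (by positivity) fun p =>
    (norm_opTensor_le _ _).trans
      (mul_le_mul (p.1.norm_rep_le a) (p.2.norm_rep_le b) (norm_nonneg _) (norm_nonneg _))

/-- The elementary tensor `a ⊗ b` as a bilinear function. -/
def tmulₗ : A →ₗ[ℂ] B →ₗ[ℂ] MinTensor A B :=
  LinearMap.mk₂ ℂ tmul add_tmul smul_tmul tmul_add tmul_smul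

theorem mem_span_of_mem_adjoin {x : GNSTensorAlgebra A B}
    (hx : x ∈ NonUnitalStarAlgebra.adjoin ℂ (Set.range fun p : A × B => gnsTensor p.1 p.2)) :
    x ∈ Submodule.span ℂ (Set.range fun p : A × B => gnsTensor p.1 p.2) := by
  induction hx using NonUnitalStarAlgebra.adjoin_induction with
  | mem x hx => exact Submodule.subset_span hx
  | add x y _ _ hx hy => exact add_mem hx hy
  | zero => exact zero_mem _
  | mul x y mx my hx hy =>
    clear mx my
    induction hx using Submodule.span_induction with
    | mem x hx =>
      obtain ⟨⟨a, b⟩, rfl⟩ := hx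
      induction hy using Submodule.span_induction with
      | mem y hy =>
        obtain ⟨⟨a', b'⟩, rfl⟩ := hy
        exact Submodule.subset_span ⟨(a * a', b * b'), (gnsTensor_mul _ _ _ _).symm⟩
      | zero => rw [mul_zero]; exact zero_mem _
      | add u v _ _ hu hv => rw [mul_add]; exact add_mem hu hv
      | smul c u _ hu => rw [mul_smul_comm]; exact Submodule.smul_mem _ _ hu
    | zero => rw [zero_mul]; exact zero_mem _
    | add u v _ _ hu hv => rw [add_mul]; exact add_mem hu hv
    | smul c u _ hu => rw [smul_mul_assoc]; exact Submodule.smul_mem _ _ hu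
  | smul c x _ hx => exact Submodule.smul_mem _ _ hx
  | star x mx hx =>
    clear mx
    induction hx using Submodule.span_induction with
    | mem x hx =>
      obtain ⟨⟨a, b⟩, rfl⟩ := hx
      exact Submodule.subset_span ⟨(star a, star b), (star_gnsTensor _ _).symm⟩
    | zero => rw [star_zero]; exact zero_mem _
    | add u v _ _ hu hv => rw [star_add]; exact add_mem hu hv
    | smul c u _ hu => rw [star_smul]; exact Submodule.smul_mem _ _ hu

/-- Induction principle: a closed property that holds for elementary tensors and is stable under
sums holds on the whole minimal tensor product. -/
theorem induction_on {P : MinTensor A B → Prop} (hc : IsClosed {t | P t})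
    (h0 : P 0) (ht : ∀ a b, P (tmul a b)) (ha : ∀ s t, P s → P t → P (s + t))
    (t : MinTensor A B) : P t := by
  have h1 : ∀ x, ∀ hx : x ∈ Submodule.span ℂ (Set.range fun p : A × B => gnsTensor p.1 p.2),
      ∃ t : MinTensor A B, incl t = x ∧ P t := by
    intro x hx
    induction hx using Submodule.closure_induction with
    | zero => exact ⟨0, map_zero _, h0⟩
    | add x y _ _ hx hy =>
      obtain ⟨s, rfl, hs⟩ := hx
      obtain ⟨t, rfl, ht⟩ := hy
      exact ⟨s + t, map_add _ _ _, ha s t hs ht⟩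
    | smul_mem c x hx =>
      obtain ⟨⟨a, b⟩, rfl⟩ := hx
      exact ⟨tmul (c • a) b, gnsTensor_smul_left _ _ _, ht _ _⟩
  have h2 : incl t ∈ closure (NonUnitalStarAlgebra.adjoin ℂ
      (Set.range fun p : A × B => gnsTensor p.1 p.2) : Set (GNSTensorAlgebra A B)) := incl_mem t
  have h3 : t ∈ closure {t : MinTensor A B | P t} := by
    rw [Metric.mem_closure_iff] at h2 ⊢
    intro ε hε
    obtain ⟨y, hy, hd⟩ := h2 ε hε
    obtain ⟨s, rfl, hs⟩ := h1 y (mem_span_of_mem_adjoin hy)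
    exact ⟨s, hs, hd⟩
  rwa [hc.closure_eq] at h3

/-- An element of the ambient algebra that multiplies the minimal tensor product into itself
defines a multiplier. -/
def multiplier (y : GNSTensorAlgebra A B)
    (hl : ∀ t : MinTensor A B, y * incl t ∈ minTensorSubalgebra A B)
    (hr : ∀ t : MinTensor A B, incl t * y ∈ minTensorSubalgebra A B) : 𝓜(ℂ, MinTensor A B) where
  fst := LinearMap.mkContinuous
    { toFun := fun t => ofMem (y * incl t) (hl t)
      map_add' := fun s t => incl_injective (by simp [incl_ofMem, mul_add])
      map_smul' := fun c t => incl_injective (mul_smul_comm c y (incl t)) } ‖y‖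
    fun t => norm_mul_le y (incl t)
  snd := LinearMap.mkContinuous
    { toFun := fun t => ofMem (incl t * y) (hr t)
      map_add' := fun s t => incl_injective (by simp [incl_ofMem, add_mul])
      map_smul' := fun c t => incl_injective (smul_mul_assoc c (incl t) y) } ‖y‖
    fun t => (norm_mul_le (incl t) y).trans_eq (mul_comm _ _)
  central := fun s t => incl_injective (mul_assoc (incl s) y (incl t))

/-- The multiplier `1 ⊗ b` of the minimal tensor product. -/
def oneTmul (b : B) : 𝓜(ℂ, MinTensor A B) :=
  multiplier (gnsTensorRight b)
    (fun t => by
      induction t using induction_on with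
      | hc =>
        exact (isClosed_minTensorSubalgebra A B).preimage
          (continuous_const.mul continuous_incl)
      | h0 => rw [map_zero, mul_zero]; exact zero_mem _
      | ht a b' => rw [incl_tmul, gnsTensorRight_mul]; exact gnsTensor_mem _ _
      | ha s t hs ht => rw [map_add, mul_add]; exact add_mem hs ht)
    (fun t => by
      induction t using induction_on with
      | hc =>
        exact (isClosed_minTensorSubalgebra A B).preimage
          (continuous_incl.mul continuous_const)
      | h0 => rw [map_zero, zero_mul]; exact zero_mem _
      | ht a b' => rw [incl_tmul, mul_gnsTensorRight]; exact gnsTensor_mem _ _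
      | ha s t hs ht => rw [map_add, add_mul]; exact add_mem hs ht)

/-- The multiplier `a ⊗ 1` of the minimal tensor product. -/
def tmulOne (a : A) : 𝓜(ℂ, MinTensor A B) :=
  multiplier (gnsTensorLeft a)
    (fun t => by
      induction t using induction_on with
      | hc =>
        exact (isClosed_minTensorSubalgebra A B).preimage
          (continuous_const.mul continuous_incl)
      | h0 => rw [map_zero, mul_zero]; exact zero_mem _
      | ht a b' => rw [incl_tmul, gnsTensorLeft_mul]; exact gnsTensor_mem _ _
      | ha s t hs ht => rw [map_add, mul_add]; exact add_mem hs ht)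
    (fun t => by
      induction t using induction_on with
      | hc =>
        exact (isClosed_minTensorSubalgebra A B).preimage
          (continuous_incl.mul continuous_const)
      | h0 => rw [map_zero, zero_mul]; exact zero_mem _
      | ht a b' => rw [incl_tmul, mul_gnsTensorLeft]; exact gnsTensor_mem _ _
      | ha s t hs ht => rw [map_add, add_mul]; exact add_mem hs ht)

theorem oneTmul_fst_tmul (a : A) (b b' : B) : (oneTmul b).fst (tmul a b') = tmul a (b * b') :=
  incl_injective (gnsTensorRight_mul a b b')

theorem oneTmul_snd_tmul (a : A) (b b' : B) : (oneTmul b).snd (tmul a b') = tmul a (b' * b) :=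
  incl_injective (mul_gnsTensorRight a b b')

theorem tmulOne_fst_tmul (a a' : A) (b : B) : (tmulOne a).fst (tmul a' b) = tmul (a * a') b :=
  incl_injective (gnsTensorLeft_mul a a' b)

theorem tmulOne_snd_tmul (a a' : A) (b : B) : (tmulOne a).snd (tmul a' b) = tmul (a' * a) b :=
  incl_injective (mul_gnsTensorLeft a a' b)

end MinTensor

end MinTensor

noncomputable section C0Sum

open Filter Topology

variable {ι : Type*} (A : ι → Type*) [∀ i, NonUnitalCStarAlgebra (A i)]

/-- The bounded families `x` with `‖x i‖ → 0` as `i → ∞`, as a `*`-subalgebra of the direct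
product of the C*-algebras `A i`. -/
def c0Subalgebra : NonUnitalStarSubalgebra ℂ (lp A ∞) where
  carrier := {x | Tendsto (fun i => ‖x i‖) cofinite (𝓝 0)}
  zero_mem' := by
    have h : (fun i => ‖(0 : lp A ∞) i‖) = fun _ => (0 : ℝ) := funext fun i => norm_zero
    exact (congrArg (fun f => Tendsto f cofinite (𝓝 0)) h).mpr tendsto_const_nhds
  add_mem' {x y} hx hy := by
    have h : Tendsto (fun i => ‖x i‖ + ‖y i‖) cofinite (𝓝 0) := by
      simpa using Tendsto.add hx hy
    exact squeeze_zero (fun i => norm_nonneg _) (fun i => norm_add_le (x i) (y i)) h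
  mul_mem' {x y} hx hy := by
    have h : Tendsto (fun i => ‖x i‖ * ‖y i‖) cofinite (𝓝 0) := by
      simpa using Tendsto.mul hx hy
    exact squeeze_zero (fun i => norm_nonneg _) (fun i => norm_mul_le (x i) (y i)) h
  smul_mem' c x hx := by
    have h : Tendsto (fun i => ‖c‖ * ‖x i‖) cofinite (𝓝 0) := by
      simpa using Tendsto.const_mul ‖c‖ hx
    exact squeeze_zero (fun i => norm_nonneg _) (fun i => (norm_smul c (x i)).le) h
  star_mem' {x} hx := by
    have h : (fun i => ‖(star x : lp A ∞) i‖) = fun i => ‖x i‖ :=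
      funext fun i => norm_star (x i)
    exact (congrArg (fun f => Tendsto f cofinite (𝓝 0)) h).mpr hx

theorem mem_c0Subalgebra (x : lp A ∞) :
    x ∈ c0Subalgebra A ↔ Tendsto (fun i => ‖x i‖) cofinite (𝓝 0) := Iff.rfl

instance isClosed_c0Subalgebra : IsClosed (c0Subalgebra A : Set (lp A ∞)) := by
  refine isClosed_of_closure_subset fun x hx => ?_
  refine (mem_c0Subalgebra A x).2 ?_
  rw [Metric.tendsto_nhds]
  intro ε hε
  obtain ⟨y, hy, hd⟩ := Metric.mem_closure_iff.1 hx (ε / 2) (half_pos hε)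
  have h1 := (Metric.tendsto_nhds.1 ((mem_c0Subalgebra A y).1 hy)) (ε / 2) (half_pos hε)
  filter_upwards [h1] with i hi
  simp only [dist_zero_right, norm_norm] at hi ⊢
  have h2 : ‖x i - y i‖ ≤ ‖x - y‖ := lp.norm_apply_le_norm ENNReal.top_ne_zero (x - y) i
  rw [dist_eq_norm] at hd
  have h3 : ‖x i‖ ≤ ‖x i - y i‖ + ‖y i‖ := by
    simpa using norm_add_le (x i - y i) (y i)
  linarith

/-- The direct sum of a family of C*-algebras: the families `x` with `‖x i‖ → 0` as `i → ∞`,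
with componentwise operations and the norm `sup ‖x i‖`. -/
def C0Sum : Type _ := c0Subalgebra A

instance : NonUnitalCStarAlgebra (C0Sum A) :=
  inferInstanceAs (NonUnitalCStarAlgebra (c0Subalgebra A))

variable {A}

namespace C0Sum

/-- The inclusion of the direct sum in the direct product. -/
def incl : C0Sum A →⋆ₙₐ[ℂ] lp A ∞ :=
  NonUnitalStarSubalgebraClass.subtype (c0Subalgebra A)

/-- The `i`-th component of an element of the direct sum. -/
def coord (x : C0Sum A) (i : ι) : A i := incl x i

theorem ext {x y : C0Sum A} (h : ∀ i, x.coord i = y.coord i) : x = y :=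
  Subtype.ext (lp.ext (funext h))

theorem tendsto_norm_coord (x : C0Sum A) : Tendsto (fun i => ‖x.coord i‖) cofinite (𝓝 0) := x.2

theorem norm_coord_le (x : C0Sum A) (i : ι) : ‖x.coord i‖ ≤ ‖x‖ :=
  lp.norm_apply_le_norm ENNReal.top_ne_zero (incl x) i

theorem norm_le {x : C0Sum A} {C : ℝ} (hC : 0 ≤ C) (h : ∀ i, ‖x.coord i‖ ≤ C) : ‖x‖ ≤ C :=
  lp.norm_le_of_forall_le hC h

/-- The projection of the direct sum onto its `i`-th summand. -/
def proj (i : ι) : C0Sum A →⋆ₙₐ[ℂ] A i where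
  toFun x := x.coord i
  map_smul' _ _ := rfl
  map_zero' := rfl
  map_add' _ _ := rfl
  map_mul' _ _ := rfl
  map_star' _ := rfl

theorem proj_apply (i : ι) (x : C0Sum A) : proj i x = x.coord i := rfl

open Classical in
/-- The element of the direct sum with `i`-th component `a` and all other components zero. -/
def singleFun (i : ι) (a : A i) : C0Sum A :=
  ⟨⟨Pi.single i a, memℓp_infty ⟨‖a‖, by
    rintro _ ⟨j, rfl⟩
    by_cases h : j = i
    · subst h; simp
    · simp [h]⟩⟩, by
    refine (mem_c0Subalgebra A _).2 (tendsto_const_nhds.congr' ?_)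
    have h : ({i}ᶜ : Set ι) ∈ (cofinite : Filter ι) := (Set.finite_singleton i).compl_mem_cofinite
    filter_upwards [h] with j hj
    have hj' : j ≠ i := hj
    exact (by rw [Pi.single_eq_of_ne hj', norm_zero] :
      ‖(Pi.single i a : ∀ j, A j) j‖ = 0).symm⟩

theorem coord_singleFun_same (i : ι) (a : A i) : (singleFun i a).coord i = a :=
  open Classical in Pi.single_eq_same i a

theorem coord_singleFun_of_ne {i j : ι} (h : j ≠ i) (a : A i) : (singleFun i a).coord j = 0 :=
  open Classical in Pi.single_eq_of_ne h a

/-- The inclusion of the `i`-th summand in the direct sum. -/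
def single (i : ι) : A i →⋆ₙₐ[ℂ] C0Sum A where
  toFun := singleFun i
  map_smul' c a := ext fun j => by
    by_cases h : j = i
    · subst h
      exact (coord_singleFun_same _ _).trans (congrArg (c • ·) (coord_singleFun_same j a)).symm
    · exact (coord_singleFun_of_ne h _).trans
        ((congrArg (c • ·) (coord_singleFun_of_ne h a)).trans (smul_zero c)).symm
  map_zero' := ext fun j => by
    by_cases h : j = i
    · subst h; exact coord_singleFun_same _ _
    · exact coord_singleFun_of_ne h _
  map_add' a b := ext fun j => by
    change _ = (singleFun i a).coord j + (singleFun i b).coord j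
    by_cases h : j = i
    · subst h; simp only [coord_singleFun_same]
    · simp only [coord_singleFun_of_ne h, add_zero]
  map_mul' a b := ext fun j => by
    change _ = (singleFun i a).coord j * (singleFun i b).coord j
    by_cases h : j = i
    · subst h; simp only [coord_singleFun_same]
    · simp only [coord_singleFun_of_ne h, mul_zero]
  map_star' a := ext fun j => by
    change _ = star ((singleFun i a).coord j)
    by_cases h : j = i
    · subst h; simp only [coord_singleFun_same]
    · simp only [coord_singleFun_of_ne h, star_zero]

theorem coord_single_same (i : ι) (a : A i) : (single i a).coord i = a :=
  coord_singleFun_same i a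

theorem coord_single_of_ne {i j : ι} (h : j ≠ i) (a : A i) : (single i a).coord j = 0 :=
  coord_singleFun_of_ne h a

/-- Induction principle: a closed property that is stable under sums and holds for elements with
one nonzero component holds on the whole direct sum. -/
theorem induction_on {P : C0Sum A → Prop} (hc : IsClosed {x | P x})
    (h0 : P 0) (hs : ∀ i a, P (single i a)) (ha : ∀ x y, P x → P y → P (x + y))
    (x : C0Sum A) : P x := by
  classical
  have hsum : ∀ F : Finset ι, P (∑ i ∈ F, single i (x.coord i)) := fun F => by
    induction F using Finset.induction_on with
    | empty => simpa using h0
    | insert i F hi ih => rw [Finset.sum_insert hi]; exact ha _ _ (hs _ _) ih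
  have hcoord : ∀ (F : Finset ι) (j : ι), (∑ i ∈ F, single i (x.coord i)).coord j =
      if j ∈ F then x.coord j else 0 := fun F j => by
    rw [← proj_apply, map_sum]
    by_cases hj : j ∈ F
    · rw [Finset.sum_eq_single j, if_pos hj, proj_apply, coord_single_same]
      · intro i _ hij
        exact coord_single_of_ne hij.symm _
      · exact fun h => absurd hj h
    · rw [if_neg hj]
      refine Finset.sum_eq_zero fun i hi => coord_single_of_ne ?_ _
      rintro rfl
      exact hj hi
  have hcl : x ∈ closure {x : C0Sum A | P x} := by
    rw [Metric.mem_closure_iff]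
    intro ε hε
    have h1 := (Metric.tendsto_nhds.1 x.tendsto_norm_coord) (ε / 2) (half_pos hε)
    rw [eventually_cofinite] at h1
    refine ⟨_, hsum h1.toFinset, ?_⟩
    rw [dist_eq_norm]
    refine lt_of_le_of_lt (norm_le (half_pos hε).le fun j => ?_) (half_lt_self hε)
    rw [← proj_apply, map_sub, proj_apply, proj_apply, hcoord]
    split_ifs with hj
    · simp only [sub_self, norm_zero]; exact (half_pos hε).le
    · simp only [Set.Finite.mem_toFinset, Set.mem_ofPred_eq, not_not, dist_zero_right,
        norm_norm] at hj
      rw [sub_zero]; exact hj.le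
  rwa [hc.closure_eq] at hcl

end C0Sum

end C0Sum

section Bialgebra

variable {A B : Type*} [NonUnitalCStarAlgebra A] [NonUnitalCStarAlgebra B]

/-- A unital `*`-homomorphism `F : M(A) → M(B)` is the canonical extension of a nondegenerate
`*`-homomorphism `A → M(B)` if `F(A)B` spans a dense subspace of `B`. Such an `F` is determined by
its restriction to `A`. -/
def IsNondegenerateExtension (F : 𝓜(ℂ, A) →⋆ₐ[ℂ] 𝓜(ℂ, B)) : Prop :=
  Dense (Submodule.span ℂ {y : B | ∃ (a : A) (b : B), y = (F (a : 𝓜(ℂ, A))).fst b} : Set B)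

/-- `F : M(A ⊗ A) → M((A ⊗ A) ⊗ A)` is the extension of `Δ ⊗ id`, that is, of the
`*`-homomorphism on `A ⊗ A` given by `(Δ ⊗ id)(a ⊗ b) (t ⊗ c) = Δ(a) t ⊗ b c`. -/
structure IsComulTensorId (Δ : A →⋆ₙₐ[ℂ] 𝓜(ℂ, MinTensor A A))
    (F : 𝓜(ℂ, MinTensor A A) →⋆ₐ[ℂ] 𝓜(ℂ, MinTensor (MinTensor A A) A)) : Prop where
  nondegenerate : IsNondegenerateExtension F
  apply : ∀ (a b c : A) (t : MinTensor A A),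
    (F (MinTensor.tmul a b : 𝓜(ℂ, MinTensor A A))).fst (MinTensor.tmul t c) =
      MinTensor.tmul ((Δ a).fst t) (b * c)

/-- `F : M(A ⊗ A) → M(A ⊗ (A ⊗ A))` is the extension of `id ⊗ Δ`, that is, of the
`*`-homomorphism on `A ⊗ A` given by `(id ⊗ Δ)(a ⊗ b) (c ⊗ t) = a c ⊗ Δ(b) t`. -/
structure IsIdTensorComul (Δ : A →⋆ₙₐ[ℂ] 𝓜(ℂ, MinTensor A A))
    (F : 𝓜(ℂ, MinTensor A A) →⋆ₐ[ℂ] 𝓜(ℂ, MinTensor A (MinTensor A A))) : Prop where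
  nondegenerate : IsNondegenerateExtension F
  apply : ∀ (a b c : A) (t : MinTensor A A),
    (F (MinTensor.tmul a b : 𝓜(ℂ, MinTensor A A))).fst (MinTensor.tmul c t) =
      MinTensor.tmul (a * c) ((Δ b).fst t)

/-- Coassociativity `(Δ ⊗ id) ∘ Δ = (id ⊗ Δ) ∘ Δ`. The two sides take values in
`M((A ⊗ A) ⊗ A)` and `M(A ⊗ (A ⊗ A))`, which are identified through the associativity isomorphism
`α` of the minimal tensor product. The isomorphism `α` and the extensions `L` of `Δ ⊗ id` and `R`
of `id ⊗ Δ` are uniquely determined by the stated conditions. -/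
def IsCoassociative (Δ : A →⋆ₙₐ[ℂ] 𝓜(ℂ, MinTensor A A)) : Prop :=
  ∃ (α : MinTensor (MinTensor A A) A ≃⋆ₐ[ℂ] MinTensor A (MinTensor A A))
    (L : 𝓜(ℂ, MinTensor A A) →⋆ₐ[ℂ] 𝓜(ℂ, MinTensor (MinTensor A A) A))
    (R : 𝓜(ℂ, MinTensor A A) →⋆ₐ[ℂ] 𝓜(ℂ, MinTensor A (MinTensor A A))),
    (∀ a b c : A, α (MinTensor.tmul (MinTensor.tmul a b) c) =
      MinTensor.tmul a (MinTensor.tmul b c)) ∧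
    IsComulTensorId Δ L ∧ IsIdTensorComul Δ R ∧
    ∀ (x : A) (t : MinTensor (MinTensor A A) A),
      α ((L (Δ x)).fst t) = (R (Δ x)).fst (α t)

/-- `(A, Δ)` is a C*-bialgebra: `Δ` is a `*`-homomorphism from `A` to `M(A ⊗ A)`, the linear span
of `Δ(a)(b ⊗ c)` is norm dense in `A ⊗ A`, and `Δ` is coassociative. -/
structure IsCStarBialgebra (Δ : A →⋆ₙₐ[ℂ] 𝓜(ℂ, MinTensor A A)) : Prop where
  dense_span : Dense (Submodule.span ℂ
    {t : MinTensor A A | ∃ a b c : A, t = (Δ a).fst (MinTensor.tmul b c)} : Set (MinTensor A A))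
  coassociative : IsCoassociative Δ

/-- `ε` is a counit: `(ε ⊗ id) ∘ Δ = id = (id ⊗ ε) ∘ Δ`. Here `L` and `R` are the extensions to
`M(A ⊗ A)` of `ε ⊗ id` and `id ⊗ ε`, viewed as maps to `A = ℂ ⊗ A = A ⊗ ℂ`. -/
def IsCounit (Δ : A →⋆ₙₐ[ℂ] 𝓜(ℂ, MinTensor A A)) (ε : A →⋆ₙₐ[ℂ] ℂ) : Prop :=
  ∃ L R : 𝓜(ℂ, MinTensor A A) →⋆ₐ[ℂ] 𝓜(ℂ, A),
    IsNondegenerateExtension L ∧ IsNondegenerateExtension R ∧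
    (∀ a b : A, L (MinTensor.tmul a b : 𝓜(ℂ, MinTensor A A)) = (ε a • b : A)) ∧
    (∀ a b : A, R (MinTensor.tmul a b : 𝓜(ℂ, MinTensor A A)) = (ε b • a : A)) ∧
    ∀ x : A, L (Δ x) = x ∧ R (Δ x) = x

/-- `Δ` is cocommutative: it is invariant under the flip automorphism `a ⊗ b ↦ b ⊗ a` of `A ⊗ A`,
extended to `M(A ⊗ A)`. -/
def IsCocommutative (Δ : A →⋆ₙₐ[ℂ] 𝓜(ℂ, MinTensor A A)) : Prop :=
  ∀ σ : MinTensor A A ≃⋆ₐ[ℂ] MinTensor A A,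
    (∀ a b : A, σ (MinTensor.tmul a b) = MinTensor.tmul b a) →
    ∀ (x : A) (t : MinTensor A A), σ ((Δ x).fst t) = (Δ x).fst (σ t)

/-- `(A, Δ)` is proper: `Δ(a)(1 ⊗ b)` and `(b ⊗ 1)Δ(a)` belong to `A ⊗ A`. -/
def IsProperComul (Δ : A →⋆ₙₐ[ℂ] 𝓜(ℂ, MinTensor A A)) : Prop :=
  ∀ a b : A, (∃ t : MinTensor A A, Δ a * MinTensor.oneTmul b = (t : 𝓜(ℂ, MinTensor A A))) ∧
    ∃ t : MinTensor A A, MinTensor.tmulOne b * Δ a = (t : 𝓜(ℂ, MinTensor A A))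

/-- The cancellation law: the linear spans `Δ(A)(1 ⊗ A)` and `Δ(A)(A ⊗ 1)` consist of elements of
`A ⊗ A` and are dense in `A ⊗ A`. -/
structure HasCancellation (Δ : A →⋆ₙₐ[ℂ] 𝓜(ℂ, MinTensor A A)) : Prop where
  mem_right : ∀ a b : A,
    ∃ t : MinTensor A A, Δ a * MinTensor.oneTmul b = (t : 𝓜(ℂ, MinTensor A A))
  mem_left : ∀ a b : A,
    ∃ t : MinTensor A A, Δ a * MinTensor.tmulOne b = (t : 𝓜(ℂ, MinTensor A A))
  dense_right : Dense (Submodule.span ℂ {t : MinTensor A A | ∃ a b : A,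
    (t : 𝓜(ℂ, MinTensor A A)) = Δ a * MinTensor.oneTmul b} : Set (MinTensor A A))
  dense_left : Dense (Submodule.span ℂ {t : MinTensor A A | ∃ a b : A,
    (t : 𝓜(ℂ, MinTensor A A)) = Δ a * MinTensor.tmulOne b} : Set (MinTensor A A))

end Bialgebra

noncomputable section UHF

open scoped CStarAlgebra

/-- The index set `{1, …, a₁} × ⋯ × {1, …, aₙ}` (counted from zero). -/
abbrev UHFIndex (a : ℕ → ℕ) (n : ℕ) : Type := ∀ j : Fin n, Fin (a j)

namespace UHFIndex

variable {a : ℕ → ℕ} {n m k : ℕ}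

/-- The first `n` entries of a multi-index. -/
def trunc (h : n ≤ m) (J : UHFIndex a m) : UHFIndex a n := fun j => J (Fin.castLE h j)

/-- Two multi-indices have the same entries from position `n` on. -/
def SameTail (n : ℕ) (J K : UHFIndex a m) : Prop := ∀ j : Fin m, n ≤ (j : ℕ) → J j = K j

instance (n : ℕ) (J K : UHFIndex a m) : Decidable (SameTail n J K) := by
  unfold SameTail; infer_instance

/-- The multi-index with first `n` entries from `P` and the remaining ones from `J`. -/
def glue (P : UHFIndex a n) (J : UHFIndex a m) : UHFIndex a m := fun j =>
  if h : (j : ℕ) < n then P ⟨j, h⟩ else J j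

theorem trunc_glue (h : n ≤ m) (P : UHFIndex a n) (J : UHFIndex a m) :
    trunc h (glue P J) = P := by
  funext j
  have hj : ((Fin.castLE h j : Fin m) : ℕ) < n := j.2
  exact dif_pos hj

theorem sameTail_glue (P : UHFIndex a n) (J : UHFIndex a m) : SameTail n J (glue P J) :=
  fun j hj => (dif_neg (not_lt.2 hj) : glue P J j = J j).symm

theorem glue_trunc (h : n ≤ m) {J K : UHFIndex a m} (hJK : SameTail n J K) :
    glue (trunc h K) J = K := by
  funext j
  by_cases hj : (j : ℕ) < n
  · exact dif_pos hj
  · exact (dif_neg hj).trans (hJK j (not_lt.1 hj))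

theorem SameTail.symm {J K : UHFIndex a m} (h : SameTail n J K) : SameTail n K J :=
  fun j hj => (h j hj).symm

theorem SameTail.trans {J K L : UHFIndex a m} (h : SameTail n J K) (h' : SameTail n K L) :
    SameTail n J L :=
  fun j hj => (h j hj).trans (h' j hj)

theorem SameTail.refl (J : UHFIndex a m) : SameTail n J J := fun _ _ => rfl

theorem sum_sameTail (h : n ≤ m) (J : UHFIndex a m) {M : Type*} [AddCommMonoid M]
    (g : UHFIndex a n → M) :
    (∑ L : UHFIndex a m, if SameTail n J L then g (trunc h L) else 0) = ∑ P, g P := by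
  rw [← Finset.sum_filter]
  refine Finset.sum_bij' (fun L _ => trunc h L) (fun P _ => glue P J) ?_ ?_ ?_ ?_ ?_
  · exact fun _ _ => Finset.mem_univ _
  · exact fun P _ => Finset.mem_filter.2 ⟨Finset.mem_univ _, sameTail_glue P J⟩
  · exact fun L hL => glue_trunc h (Finset.mem_filter.1 hL).2
  · exact fun P _ => trunc_glue h P J
  · exact fun _ _ => rfl

end UHFIndex

open UHFIndex

/-- The matrix algebra `M_{a₁} ⊗ ⋯ ⊗ M_{aₙ}`, as the C*-algebra of matrices indexed by
`{1, …, a₁} × ⋯ × {1, …, aₙ}`: the tensor product of matrix units `E_{j₁,k₁} ⊗ ⋯ ⊗ E_{jₙ,kₙ}` is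
the matrix unit `E_{J,K}` with `J = (j₁, …, jₙ)`, `K = (k₁, …, kₙ)`. -/
abbrev UHFMatrix (a : ℕ → ℕ) (n : ℕ) : Type := CStarMatrix (UHFIndex a n) (UHFIndex a n) ℂ

/-- The entry of a matrix at the pair of multi-indices `J`, `K`. -/
def UHFMatrix.entry {a : ℕ → ℕ} {n : ℕ} (M : UHFMatrix a n) (J K : UHFIndex a n) : ℂ := M J K

namespace UHFMatrix

variable {a : ℕ → ℕ} {n : ℕ}

theorem ext {M N : UHFMatrix a n} (h : ∀ J K, M.entry J K = N.entry J K) : M = N :=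
  CStarMatrix.ext h

theorem entry_mul (M N : UHFMatrix a n) (J K : UHFIndex a n) :
    UHFMatrix.entry (M * N) J K = ∑ L, M.entry J L * N.entry L K := CStarMatrix.mul_apply

theorem entry_one (J K : UHFIndex a n) : (1 : UHFMatrix a n).entry J K = if J = K then 1 else 0 :=
  CStarMatrix.one_apply

theorem entry_add (M N : UHFMatrix a n) (J K : UHFIndex a n) :
    (M + N).entry J K = M.entry J K + N.entry J K := rfl

theorem entry_smul (c : ℂ) (M : UHFMatrix a n) (J K : UHFIndex a n) :
    (c • M).entry J K = c * M.entry J K := rfl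

theorem entry_star (M : UHFMatrix a n) (J K : UHFIndex a n) :
    (star M).entry J K = star (M.entry K J) := rfl

/-- The matrix with given entries. -/
def of (g : UHFIndex a n → UHFIndex a n → ℂ) : UHFMatrix a n := CStarMatrix.ofMatrix g

theorem entry_of (g : UHFIndex a n → UHFIndex a n → ℂ) (J K : UHFIndex a n) :
    (of g).entry J K = g J K := rfl

/-- The matrix unit `E_{J,K} = E_{j₁,k₁} ⊗ ⋯ ⊗ E_{jₙ,kₙ}`. -/
def unit (J K : UHFIndex a n) : UHFMatrix a n := of fun P Q => if P = J ∧ Q = K then 1 else 0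

end UHFMatrix

open UHFMatrix

/-- The embedding `A ↦ A ⊗ I` of `M_{a₁} ⊗ ⋯ ⊗ M_{aₙ}` in `M_{a₁} ⊗ ⋯ ⊗ M_{aₘ}` for `n ≤ m`,
as a linear map. -/
def uhfEmbedₗ (a : ℕ → ℕ) (n m : ℕ) (h : n ≤ m) : UHFMatrix a n →ₗ[ℂ] UHFMatrix a m where
  toFun M := UHFMatrix.of fun J K =>
    if SameTail n J K then M.entry (trunc h J) (trunc h K) else 0
  map_add' M N := UHFMatrix.ext fun J K => by
    simp only [entry_add, entry_of]
    split_ifs <;> simp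
  map_smul' c M := UHFMatrix.ext fun J K => by
    simp only [RingHom.id_apply, entry_smul, entry_of]
    split_ifs <;> simp

theorem entry_uhfEmbedₗ (a : ℕ → ℕ) (n m : ℕ) (h : n ≤ m) (M : UHFMatrix a n)
    (J K : UHFIndex a m) : (uhfEmbedₗ a n m h M).entry J K =
      if SameTail n J K then M.entry (trunc h J) (trunc h K) else 0 := rfl

theorem uhfEmbedₗ_one (a : ℕ → ℕ) (n m : ℕ) (h : n ≤ m) : uhfEmbedₗ a n m h 1 = 1 :=
  UHFMatrix.ext fun J K => by
    rw [entry_uhfEmbedₗ, entry_one, entry_one]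
    by_cases hJK : J = K
    · subst hJK
      rw [if_pos (SameTail.refl J), if_pos rfl, if_pos rfl]
    · rw [if_neg hJK]
      split_ifs with ht h'
      · refine absurd ?_ hJK
        rw [← glue_trunc h (SameTail.refl (n := n) J), h', glue_trunc h ht]
      · rfl
      · rfl

theorem uhfEmbedₗ_mul (a : ℕ → ℕ) (n m : ℕ) (h : n ≤ m) (M N : UHFMatrix a n) :
    uhfEmbedₗ a n m h (M * N) = uhfEmbedₗ a n m h M * uhfEmbedₗ a n m h N :=
  UHFMatrix.ext fun J K => by
    rw [entry_uhfEmbedₗ, entry_mul, entry_mul]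
    simp only [entry_uhfEmbedₗ]
    split_ifs with ht
    · rw [← sum_sameTail h J fun P => M.entry (trunc h J) P * N.entry P (trunc h K)]
      refine Finset.sum_congr rfl fun L _ => ?_
      by_cases h1 : SameTail n J L
      · rw [if_pos h1, if_pos h1, if_pos (h1.symm.trans ht)]
      · rw [if_neg h1, if_neg h1, zero_mul]
    · symm
      refine Finset.sum_eq_zero fun L _ => ?_
      by_cases h1 : SameTail n J L
      · rw [if_neg (fun h2 => ht (h1.trans h2)), mul_zero]
      · rw [if_neg h1, zero_mul]

/-- The embedding `A ↦ A ⊗ I` of `M_{a₁} ⊗ ⋯ ⊗ M_{aₙ}` in `M_{a₁} ⊗ ⋯ ⊗ M_{aₘ}` for `n ≤ m`. -/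
def uhfEmbed (a : ℕ → ℕ) (n m : ℕ) (h : n ≤ m) : UHFMatrix a n →⋆ₐ[ℂ] UHFMatrix a m where
  __ := AlgHom.ofLinearMap (uhfEmbedₗ a n m h) (uhfEmbedₗ_one a n m h) (uhfEmbedₗ_mul a n m h)
  map_star' M := UHFMatrix.ext fun J K => by
    change (uhfEmbedₗ a n m h (star M)).entry J K = (star (uhfEmbedₗ a n m h M)).entry J K
    rw [entry_star, entry_uhfEmbedₗ, entry_uhfEmbedₗ, entry_star]
    by_cases ht : SameTail n J K
    · rw [if_pos ht, if_pos ht.symm]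
    · rw [if_neg ht, if_neg (fun h' => ht h'.symm), star_zero]

theorem entry_uhfEmbed (a : ℕ → ℕ) (n m : ℕ) (h : n ≤ m) (M : UHFMatrix a n)
    (J K : UHFIndex a m) : (uhfEmbed a n m h M).entry J K =
      if SameTail n J K then M.entry (trunc h J) (trunc h K) else 0 := rfl

instance uhfDirectedSystem (a : ℕ → ℕ) :
    DirectedSystem (UHFMatrix a) (fun n m h => uhfEmbed a n m h) where
  map_self n M := UHFMatrix.ext fun J K => by
    have h : SameTail n J K := fun j hj => absurd j.2 (not_lt.2 hj)
    rw [entry_uhfEmbed, if_pos h]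
    rfl
  map_map k m n hnm hmk M := UHFMatrix.ext fun J K => by
    simp only [entry_uhfEmbed]
    by_cases h1 : SameTail n J K
    · have h2 : SameTail m J K := fun j hj => h1 j (hnm.trans hj)
      have h3 : SameTail n (trunc hmk J) (trunc hmk K) := fun j hj => h1 (Fin.castLE hmk j) hj
      rw [if_pos h1, if_pos h2, if_pos h3]
      rfl
    · rw [if_neg h1]
      split_ifs with h2 h3
      · refine absurd (fun j hj => ?_) h1
        by_cases hj' : (j : ℕ) < m
        · exact h3 ⟨j, hj'⟩ hj
        · exact h2 j (not_lt.1 hj')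
      · rfl
      · rfl

/-- A sequence of positive integers. -/
class PosSeq (a : ℕ → ℕ) : Prop where
  pos : ∀ j, 0 < a j

instance (a : ℕ → ℕ) [PosSeq a] (n : ℕ) : Nonempty (UHFIndex a n) :=
  ⟨fun j => ⟨0, PosSeq.pos (j : ℕ)⟩⟩

theorem uhfEmbed_injective (a : ℕ → ℕ) [PosSeq a] (n m : ℕ) (h : n ≤ m) :
    Function.Injective (uhfEmbed a n m h) := by
  refine fun M N hMN => UHFMatrix.ext fun P Q => ?_
  obtain ⟨J⟩ := (inferInstance : Nonempty (UHFIndex a m))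
  have h1 := congrArg (fun X : UHFMatrix a m => X.entry (glue P J) (glue Q J)) hMN
  have ht : SameTail n (glue P J) (glue Q J) := (sameTail_glue P J).symm.trans (sameTail_glue Q J)
  simp only [entry_uhfEmbed] at h1
  rwa [if_pos ht, if_pos ht, trunc_glue, trunc_glue] at h1

theorem norm_uhfEmbed (a : ℕ → ℕ) [PosSeq a] (n m : ℕ) (h : n ≤ m) (M : UHFMatrix a n) :
    ‖uhfEmbed a n m h M‖ = ‖M‖ :=
  NonUnitalStarAlgHom.norm_map (uhfEmbed a n m h) (uhfEmbed_injective a n m h) M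

/-- The union of the matrix algebras `M_{a₁} ⊗ ⋯ ⊗ M_{aₙ}` along the embeddings `A ↦ A ⊗ I`,
that is, their algebraic direct limit. -/
def PreUHF (a : ℕ → ℕ) : Type := DirectLimit (UHFMatrix a) (uhfEmbed a)

namespace PreUHF

instance (a : ℕ → ℕ) : Ring (PreUHF a) :=
  inferInstanceAs (Ring (DirectLimit (UHFMatrix a) (uhfEmbed a)))

instance (a : ℕ → ℕ) : StarRing (PreUHF a) :=
  inferInstanceAs (StarRing (DirectLimit (UHFMatrix a) (uhfEmbed a)))

instance instAlgebra (a : ℕ → ℕ) : Algebra ℂ (PreUHF a) :=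
  inferInstanceAs (Algebra ℂ (DirectLimit (UHFMatrix a) (uhfEmbed a)))

instance (a : ℕ → ℕ) : StarModule ℂ (PreUHF a) :=
  inferInstanceAs (StarModule ℂ (DirectLimit (UHFMatrix a) (uhfEmbed a)))

/-- The canonical map from `M_{a₁} ⊗ ⋯ ⊗ M_{aₙ}` to the union. -/
def ofMatrix (a : ℕ → ℕ) (n : ℕ) : UHFMatrix a n →⋆ₐ[ℂ] PreUHF a where
  __ := AlgHom.ofLinearMap
    { toFun := fun M => (⟦⟨n, M⟩⟧ : DirectLimit (UHFMatrix a) (uhfEmbed a))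
      map_add' := fun M N => (DirectLimit.add_def n M N).symm
      map_smul' := fun c M => (DirectLimit.smul_def n M c).symm }
    (DirectLimit.one_def n).symm (fun M N => (DirectLimit.mul_def n M N).symm)
  map_star' M := (DirectLimit.star_def n M).symm

theorem ofMatrix_uhfEmbed (a : ℕ → ℕ) {n m : ℕ} (h : n ≤ m) (M : UHFMatrix a n) :
    ofMatrix a m (uhfEmbed a n m h M) = ofMatrix a n M :=
  DirectLimit.mk_apply n m M h

theorem induction {a : ℕ → ℕ} {P : PreUHF a → Prop} (h : ∀ n M, P (ofMatrix a n M)) (x : PreUHF a) :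
    P x :=
  DirectLimit.induction (uhfEmbed a) h x

theorem induction₂ {a : ℕ → ℕ} {P : PreUHF a → PreUHF a → Prop}
    (h : ∀ n M N, P (ofMatrix a n M) (ofMatrix a n N)) (x y : PreUHF a) : P x y :=
  DirectLimit.induction₂ (uhfEmbed a) h x y

variable (a : ℕ → ℕ) [PosSeq a]

instance : Norm (PreUHF a) where
  norm := DirectLimit.lift (uhfEmbed a) (fun _ M => ‖M‖)
    (fun n m h M => (norm_uhfEmbed a n m h M).symm)

theorem norm_ofMatrix (n : ℕ) (M : UHFMatrix a n) : ‖ofMatrix a n M‖ = ‖M‖ := rfl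

instance : NormedRing (PreUHF a) where
  __ := (inferInstance : Ring (PreUHF a))
  __ := AddGroupNorm.toNormedAddCommGroup (E := PreUHF a)
    { toFun := fun x => ‖x‖
      map_zero' := by
        rw [← map_zero (ofMatrix a 0), norm_ofMatrix, norm_zero]
      add_le' := induction₂ fun n M N => by
        rw [← map_add]; simp only [norm_ofMatrix]; exact norm_add_le M N
      neg' := induction fun n M => by
        rw [← map_neg]; simp only [norm_ofMatrix]; exact norm_neg M
      eq_zero_of_map_eq_zero' := induction fun n M hM => by
        rw [norm_ofMatrix] at hM
        rw [norm_eq_zero.1 hM, map_zero] }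
  norm_mul_le := induction₂ fun n M N => by
    rw [← map_mul]; exact norm_mul_le M N

instance : NormedAlgebra ℂ (PreUHF a) where
  __ := instAlgebra a
  norm_smul_le c := induction fun n M => by
    rw [← map_smul]; exact norm_smul_le c M

instance : CStarRing (PreUHF a) where
  norm_mul_self_le := induction fun n M => by
    rw [← map_star, ← map_mul]; exact CStarRing.norm_mul_self_le M

end PreUHF

section Completion

/- The completion of a normed `*`-algebra satisfying the C*-identity. -/
variable (D : Type*) [NormedRing D] [NormedAlgebra ℂ D] [StarRing D] [StarModule ℂ D] [CStarRing D]

open UniformSpace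

instance completionStar : Star (Completion D) where
  star := Completion.map star

variable {D}

theorem completion_coe_star (x : D) : ((star x : D) : Completion D) = star (x : Completion D) :=
  (Completion.map_coe (star_isometry (E := D)).uniformContinuous x).symm

theorem continuous_completion_star : Continuous (star : Completion D → Completion D) :=
  Completion.continuous_map

instance completionStarRing : StarRing (Completion D) where
  star_involutive x := by
    induction x using Completion.induction_on with
    | hp =>
      exact isClosed_eq (continuous_completion_star.comp continuous_completion_star) continuous_id
    | ih x => rw [← completion_coe_star, ← completion_coe_star, star_star]
  star_mul x y := by
    induction x, y using Completion.induction_on₂ with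
    | hp =>
      exact isClosed_eq (continuous_completion_star.comp (continuous_fst.mul continuous_snd))
        ((continuous_completion_star.comp continuous_snd).mul
          (continuous_completion_star.comp continuous_fst))
    | ih x y =>
      rw [← Completion.coe_mul, ← completion_coe_star, star_mul, Completion.coe_mul,
        completion_coe_star, completion_coe_star]
  star_add x y := by
    induction x, y using Completion.induction_on₂ with
    | hp =>
      exact isClosed_eq (continuous_completion_star.comp (continuous_fst.add continuous_snd))
        ((continuous_completion_star.comp continuous_fst).add
          (continuous_completion_star.comp continuous_snd))
    | ih x y =>
      rw [← Completion.coe_add, ← completion_coe_star, star_add, Completion.coe_add,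
        completion_coe_star, completion_coe_star]

instance completionNormedAlgebra : NormedAlgebra ℂ (Completion D) where
  __ := (inferInstance : Algebra ℂ (Completion D))
  norm_smul_le := norm_smul_le

instance completionStarModule : StarModule ℂ (Completion D) where
  star_smul c x := by
    induction x using Completion.induction_on with
    | hp =>
      exact isClosed_eq (continuous_completion_star.comp (continuous_const_smul c))
        (continuous_completion_star.const_smul (star c))
    | ih x =>
      rw [← Completion.coe_smul, ← completion_coe_star, star_smul, Completion.coe_smul,
        completion_coe_star]

instance completionCStarRing : CStarRing (Completion D) where
  norm_mul_self_le x := by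
    induction x using Completion.induction_on with
    | hp =>
      exact isClosed_le (continuous_norm.mul continuous_norm)
        (continuous_norm.comp (continuous_completion_star.mul continuous_id))
    | ih x =>
      rw [← completion_coe_star, ← Completion.coe_mul, Completion.norm_coe, Completion.norm_coe]
      exact CStarRing.norm_mul_self_le x

/-- The completion of a normed `*`-algebra satisfying the C*-identity is a C*-algebra. -/
instance completionCStarAlgebra : CStarAlgebra (Completion D) where

end Completion

/-- The C*-algebra `A(a)`: the C*-inductive limit of the matrix algebras `M_{a₁} ⊗ ⋯ ⊗ M_{aₙ}`
along the embeddings `A ↦ A ⊗ I`. -/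
def UHF (a : ℕ → ℕ) [PosSeq a] : Type := UniformSpace.Completion (PreUHF a)

namespace UHF

variable (a : ℕ → ℕ) [PosSeq a]

instance : CStarAlgebra (UHF a) :=
  inferInstanceAs (CStarAlgebra (UniformSpace.Completion (PreUHF a)))

/-- The inclusion of the union of the matrix algebras. -/
def ofPre : PreUHF a →⋆ₐ[ℂ] UHF a where
  toFun x := (x : UniformSpace.Completion (PreUHF a))
  map_one' := UniformSpace.Completion.coe_one _
  map_mul' := UniformSpace.Completion.coe_mul
  map_zero' := UniformSpace.Completion.coe_zero
  map_add' := UniformSpace.Completion.coe_add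
  commutes' _ := rfl
  map_star' := completion_coe_star

/-- The canonical map from `M_{a₁} ⊗ ⋯ ⊗ M_{aₙ}` to `A(a)`. -/
def ofMatrix (n : ℕ) : UHFMatrix a n →⋆ₐ[ℂ] UHF a := (ofPre a).comp (PreUHF.ofMatrix a n)

theorem ofMatrix_uhfEmbed {n m : ℕ} (h : n ≤ m) (M : UHFMatrix a n) :
    ofMatrix a m (uhfEmbed a n m h M) = ofMatrix a n M :=
  congrArg (ofPre a) (PreUHF.ofMatrix_uhfEmbed a h M)

theorem norm_ofMatrix (n : ℕ) (M : UHFMatrix a n) : ‖ofMatrix a n M‖ = ‖M‖ :=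
  (UniformSpace.Completion.norm_coe (PreUHF.ofMatrix a n M)).trans (PreUHF.norm_ofMatrix a n M)

variable {a}

theorem induction_on {P : UHF a → Prop} (hc : IsClosed {x | P x})
    (h : ∀ n M, P (ofMatrix a n M)) (x : UHF a) : P x :=
  UniformSpace.Completion.induction_on x hc (PreUHF.induction h)

section Lift

variable {C : Type*} [NonUnitalCStarAlgebra C] (f : ∀ n, UHFMatrix a n →⋆ₙₐ[ℂ] C)
  (hf : ∀ n m h M, f m (uhfEmbed a n m h M) = f n M)

/-- The map on the union of the matrix algebras defined by a compatible sequence of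
`*`-homomorphisms on the matrix algebras. -/
def preLift : PreUHF a →⋆ₙₐ[ℂ] C where
  toFun := DirectLimit.lift (uhfEmbed a) (fun n M => f n M) (fun n m h M => (hf n m h M).symm)
  map_smul' c := PreUHF.induction fun n M => by
    rw [← map_smul]; exact map_smul (f n) c M
  map_zero' := by
    rw [← map_zero (PreUHF.ofMatrix a 0)]; exact map_zero (f 0)
  map_add' := PreUHF.induction₂ fun n M N => by
    rw [← map_add]; exact map_add (f n) M N
  map_mul' := PreUHF.induction₂ fun n M N => by
    rw [← map_mul]; exact map_mul (f n) M N
  map_star' := PreUHF.induction fun n M => by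
    rw [← map_star]; exact map_star (f n) M

theorem preLift_ofMatrix (n : ℕ) (M : UHFMatrix a n) :
    preLift f hf (PreUHF.ofMatrix a n M) = f n M := rfl

theorem norm_preLift_le (x : PreUHF a) : ‖preLift f hf x‖ ≤ ‖x‖ := by
  induction x using PreUHF.induction with
  | h n M =>
    rw [preLift_ofMatrix, PreUHF.norm_ofMatrix]
    exact NonUnitalStarAlgHom.norm_apply_le (f n) M

theorem uniformContinuous_preLift : UniformContinuous (preLift f hf) :=
  (AddMonoidHomClass.lipschitz_of_bound (preLift f hf) 1
    (fun x => by rw [one_mul]; exact norm_preLift_le f hf x)).uniformContinuous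

/-- The extension to `A(a)` of the map `preLift`, as a function. -/
def liftFun : UHF a → C := UniformSpace.Completion.extension (preLift f hf)

theorem continuous_liftFun : Continuous (liftFun f hf) :=
  UniformSpace.Completion.continuous_extension

theorem liftFun_ofMatrix (n : ℕ) (M : UHFMatrix a n) :
    liftFun f hf (ofMatrix a n M) = f n M :=
  UniformSpace.Completion.extension_coe (uniformContinuous_preLift f hf) (PreUHF.ofMatrix a n M)

theorem induction_on₂ {P : UHF a → UHF a → Prop} (hc : IsClosed {x : UHF a × UHF a | P x.1 x.2})
    (h : ∀ n M N, P (ofMatrix a n M) (ofMatrix a n N)) (x y : UHF a) : P x y :=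
  UniformSpace.Completion.induction_on₂ x y hc (PreUHF.induction₂ h)

/-- The `*`-homomorphism on `A(a)` defined by a compatible sequence of `*`-homomorphisms on the
matrix algebras. -/
def lift : UHF a →⋆ₙₐ[ℂ] C where
  toFun := liftFun f hf
  map_smul' c x := by
    induction x using induction_on with
    | hc =>
      exact isClosed_eq ((continuous_liftFun f hf).comp (continuous_const_smul c))
        ((continuous_liftFun f hf).const_smul c)
    | h n M =>
      rw [← map_smul, liftFun_ofMatrix, liftFun_ofMatrix]; exact map_smul (f n) c M
  map_zero' := by
    rw [← map_zero (ofMatrix a 0), liftFun_ofMatrix, map_zero]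
  map_add' x y := by
    induction x, y using induction_on₂ with
    | hc =>
      exact isClosed_eq ((continuous_liftFun f hf).comp (continuous_fst.add continuous_snd))
        (((continuous_liftFun f hf).comp continuous_fst).add
          ((continuous_liftFun f hf).comp continuous_snd))
    | h n M N =>
      rw [← map_add, liftFun_ofMatrix, liftFun_ofMatrix, liftFun_ofMatrix, map_add]
  map_mul' x y := by
    induction x, y using induction_on₂ with
    | hc =>
      exact isClosed_eq ((continuous_liftFun f hf).comp (continuous_fst.mul continuous_snd))
        (((continuous_liftFun f hf).comp continuous_fst).mul
          ((continuous_liftFun f hf).comp continuous_snd))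
    | h n M N =>
      rw [← map_mul, liftFun_ofMatrix, liftFun_ofMatrix, liftFun_ofMatrix, map_mul]
  map_star' x := by
    induction x using induction_on with
    | hc =>
      exact isClosed_eq ((continuous_liftFun f hf).comp continuous_star)
        ((continuous_liftFun f hf).star)
    | h n M =>
      rw [← map_star, liftFun_ofMatrix, liftFun_ofMatrix, map_star]

theorem lift_ofMatrix (n : ℕ) (M : UHFMatrix a n) : lift f hf (ofMatrix a n M) = f n M :=
  liftFun_ofMatrix f hf n M

end Lift

end UHF

end UHF

noncomputable section Kronecker

open UHFIndex UHFMatrix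

/-- The sequences `a` of integers `≥ 2` and the constant sequence `1`, as a monoid under
componentwise multiplication. -/
def UHFMonoid : Submonoid (ℕ → ℕ) where
  carrier := {a | (∀ j, 2 ≤ a j) ∨ a = 1}
  one_mem' := Or.inr rfl
  mul_mem' {a b} ha hb := by
    rcases ha with ha | rfl
    · rcases hb with hb | rfl
      · exact Or.inl fun j => (ha j).trans
          (Nat.le_mul_of_pos_right _ (lt_of_lt_of_le two_pos (hb j)))
      · rw [mul_one]; exact Or.inl ha
    · rw [one_mul]; exact hb

instance (a : UHFMonoid) : PosSeq (a : ℕ → ℕ) where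
  pos j := by
    rcases a.2 with h | h
    · exact lt_of_lt_of_le two_pos (h j)
    · rw [h]; exact one_pos

instance posSeqMul (b c : ℕ → ℕ) [PosSeq b] [PosSeq c] : PosSeq (b * c) where
  pos j := Nat.mul_pos (PosSeq.pos j) (PosSeq.pos j)

instance posSeqOne : PosSeq 1 where
  pos _ := one_pos

section MatrixUnits

variable {a : ℕ → ℕ} {n : ℕ}

theorem UHFMatrix.entry_unit (J K P Q : UHFIndex a n) :
    (unit J K).entry P Q = if P = J ∧ Q = K then 1 else 0 := rfl

theorem UHFMatrix.unit_mul_unit (J K P Q : UHFIndex a n) :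
    unit J K * unit P Q = if K = P then unit J Q else 0 :=
  UHFMatrix.ext fun X Y => by
    rw [entry_mul]
    simp only [entry_unit]
    by_cases hKP : K = P
    · subst hKP
      rw [if_pos rfl, entry_unit, Finset.sum_eq_single K]
      · by_cases h1 : X = J <;> by_cases h2 : Y = Q <;> simp [h1, h2]
      · intro L _ hL; simp [hL]
      · exact fun h => absurd (Finset.mem_univ _) h
    · rw [if_neg hKP]
      refine Finset.sum_eq_zero fun L _ => ?_
      by_cases h1 : L = K
      · subst h1; simp [hKP]
      · simp [h1]

theorem UHFMatrix.star_unit (J K : UHFIndex a n) : star (unit J K) = unit K J :=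
  UHFMatrix.ext fun X Y => by
    rw [entry_star, entry_unit, entry_unit]
    by_cases h1 : X = K <;> by_cases h2 : Y = J <;> simp [h1, h2]

theorem UHFMatrix.entry_sum {ι : Type*} (s : Finset ι) (M : ι → UHFMatrix a n) (J K : UHFIndex a n) :
    UHFMatrix.entry (∑ i ∈ s, M i) J K = ∑ i ∈ s, (M i).entry J K := by
  classical
  induction s using Finset.induction_on with
  | empty => rfl
  | insert i s hi ih => rw [Finset.sum_insert hi, Finset.sum_insert hi, entry_add, ih]

theorem UHFMatrix.eq_sum_unit (M : UHFMatrix a n) :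
    M = ∑ J, ∑ K, M.entry J K • unit J K :=
  UHFMatrix.ext fun X Y => by
    simp only [entry_sum, entry_smul, entry_unit]
    rw [Finset.sum_eq_single X, Finset.sum_eq_single Y]
    · simp
    · intro K _ hK; simp [Ne.symm hK]
    · exact fun h => absurd (Finset.mem_univ _) h
    · intro J _ hJ; simp [Ne.symm hJ]
    · exact fun h => absurd (Finset.mem_univ _) h

/-- The `*`-homomorphism sending the matrix units `E_{J,K}` to a given system of matrix units. -/
def unitsHom {C : Type*} [NonUnitalCStarAlgebra C] (e : UHFIndex a n → UHFIndex a n → C)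
    (hmul : ∀ J K P Q, e J K * e P Q = if K = P then e J Q else 0)
    (hstar : ∀ J K, star (e J K) = e K J) : UHFMatrix a n →⋆ₙₐ[ℂ] C where
  toFun M := ∑ J, ∑ K, M.entry J K • e J K
  map_smul' c M := by
    simp only [entry_smul, mul_smul, Finset.smul_sum, MonoidHom.id_apply]
  map_zero' := by
    refine Finset.sum_eq_zero fun J _ => Finset.sum_eq_zero fun K _ => ?_
    exact zero_smul ℂ _
  map_add' M N := by
    simp only [entry_add, add_smul, Finset.sum_add_distrib]
  map_mul' M N := by
    simp only [entry_mul, Finset.sum_smul]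
    rw [Finset.sum_mul]
    refine Finset.sum_congr rfl fun J _ => ?_
    rw [Finset.sum_mul]
    refine Eq.trans Finset.sum_comm (Finset.sum_congr rfl fun L _ => ?_)
    rw [Finset.mul_sum]
    refine Eq.trans ?_ (Finset.sum_eq_single L ?_ ?_).symm
    · rw [Finset.mul_sum]
      refine Finset.sum_congr rfl fun K _ => ?_
      rw [smul_mul_smul_comm, hmul, if_pos rfl]
    · intro P _ hP
      rw [Finset.mul_sum]
      refine Finset.sum_eq_zero fun K _ => ?_
      rw [smul_mul_smul_comm, hmul, if_neg (Ne.symm hP), smul_zero]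
    · exact fun h => absurd (Finset.mem_univ _) h
  map_star' M := by
    simp only [entry_star, star_sum, star_smul, hstar]
    rw [Finset.sum_comm]

theorem unitsHom_apply {C : Type*} [NonUnitalCStarAlgebra C] (e : UHFIndex a n → UHFIndex a n → C)
    (hmul) (hstar) (M : UHFMatrix a n) :
    unitsHom e hmul hstar M = ∑ J, ∑ K, M.entry J K • e J K := rfl

theorem unitsHom_unit {C : Type*} [NonUnitalCStarAlgebra C] (e : UHFIndex a n → UHFIndex a n → C)
    (hmul) (hstar) (P Q : UHFIndex a n) : unitsHom e hmul hstar (unit P Q) = e P Q := by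
  rw [unitsHom_apply, Finset.sum_eq_single P, Finset.sum_eq_single Q]
  · simp [entry_unit]
  · intro K _ hK; simp [entry_unit, hK]
  · exact fun h => absurd (Finset.mem_univ _) h
  · intro J _ hJ; simp [entry_unit, hJ]
  · exact fun h => absurd (Finset.mem_univ _) h

end MatrixUnits

namespace UHFIndex

variable {b c : ℕ → ℕ} {n m : ℕ}

/-- The bijection `J ↦ (J', J'')` from `∏ {1, …, bᵢcᵢ}` to `∏ {1, …, bᵢ} × ∏ {1, …, cᵢ}`. Counting
indices from zero, it is given by `jᵢ = cᵢ jᵢ' + jᵢ''` with `0 ≤ jᵢ' < bᵢ` and `0 ≤ jᵢ'' < cᵢ`. -/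
def split (b c : ℕ → ℕ) (n : ℕ) : UHFIndex (b * c) n ≃ UHFIndex b n × UHFIndex c n where
  toFun J := (fun i => (finProdFinEquiv.symm (J i : Fin (b i * c i))).1,
    fun i => (finProdFinEquiv.symm (J i : Fin (b i * c i))).2)
  invFun p := fun i => (finProdFinEquiv (p.1 i, p.2 i) : Fin (b i * c i))
  left_inv J := funext fun i => finProdFinEquiv.apply_symm_apply (J i : Fin (b i * c i))
  right_inv p := by
    refine Prod.ext (funext fun i => ?_) (funext fun i => ?_)
    · exact congrArg Prod.fst (finProdFinEquiv.symm_apply_apply (p.1 i, p.2 i))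
    · exact congrArg Prod.snd (finProdFinEquiv.symm_apply_apply (p.1 i, p.2 i))

theorem split_spec (J : UHFIndex (b * c) n) (i : Fin n) :
    (J i : ℕ) = c i * ((split b c n J).1 i : ℕ) + ((split b c n J).2 i : ℕ) := by
  have h := congrArg (fun J : UHFIndex (b * c) n => (J i : ℕ)) ((split b c n).symm_apply_apply J)
  refine h.symm.trans ?_
  exact (add_comm _ _)

theorem split_trunc (h : n ≤ m) (J : UHFIndex (b * c) m) :
    split b c n (trunc h J) = (trunc h (split b c m J).1, trunc h (split b c m J).2) := rfl

theorem sameTail_split (J K : UHFIndex (b * c) m) : SameTail n J K ↔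
    SameTail n (split b c m J).1 (split b c m K).1 ∧
      SameTail n (split b c m J).2 (split b c m K).2 := by
  constructor
  · intro h
    constructor
    · intro i hi
      exact congrArg (fun z : Fin (b i * c i) => (finProdFinEquiv.symm z).1) (h i hi)
    · intro i hi
      exact congrArg (fun z : Fin (b i * c i) => (finProdFinEquiv.symm z).2) (h i hi)
  · rintro ⟨h1, h2⟩ i hi
    exact finProdFinEquiv.symm.injective (Prod.ext (h1 i hi) (h2 i hi))

end UHFIndex

section KroneckerHom

variable {b c : ℕ → ℕ} [PosSeq b] [PosSeq c] {X Y : Type*} [NonUnitalCStarAlgebra X]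
  [NonUnitalCStarAlgebra Y] (f : UHF b →⋆ₙₐ[ℂ] X) (g : UHF c →⋆ₙₐ[ℂ] Y)

/-- The element `f(E_{J',K'}) ⊗ g(E_{J'',K''})`, where `J ↦ (J', J'')` is the bijection
`UHFIndex.split`. -/
def kroneckerUnit (n : ℕ) (J K : UHFIndex (b * c) n) : MinTensor X Y :=
  MinTensor.tmul
    (f (UHF.ofMatrix b n (unit (split b c n J).1 (split b c n K).1)))
    (g (UHF.ofMatrix c n (unit (split b c n J).2 (split b c n K).2)))

theorem kroneckerUnit_mul (n : ℕ) (J K P Q : UHFIndex (b * c) n) :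
    kroneckerUnit f g n J K * kroneckerUnit f g n P Q =
      if K = P then kroneckerUnit f g n J Q else 0 := by
  unfold kroneckerUnit
  rw [MinTensor.tmul_mul_tmul, ← map_mul, ← map_mul, ← map_mul, ← map_mul, unit_mul_unit,
    unit_mul_unit]
  by_cases hKP : K = P
  · subst hKP
    rw [if_pos rfl, if_pos rfl, if_pos rfl]
  · rw [if_neg hKP]
    by_cases h1 : (split b c n K).1 = (split b c n P).1
    · have h2 : (split b c n K).2 ≠ (split b c n P).2 := fun h2 =>
        hKP ((split b c n).injective (Prod.ext h1 h2))
      rw [if_neg h2, map_zero, map_zero]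
      exact map_zero (MinTensor.tmulₗ _)
    · rw [if_neg h1, map_zero, map_zero]
      exact LinearMap.map_zero₂ MinTensor.tmulₗ _

theorem star_kroneckerUnit (n : ℕ) (J K : UHFIndex (b * c) n) :
    star (kroneckerUnit f g n J K) = kroneckerUnit f g n K J := by
  unfold kroneckerUnit
  rw [MinTensor.star_tmul, ← map_star, ← map_star, ← map_star, ← map_star, star_unit, star_unit]

/-- The `*`-homomorphism `(f ⊗ g) ∘ φ⁽ⁿ⁾` on the `n`-th matrix algebra, where `φ⁽ⁿ⁾` is the
Kronecker coproduct `E_{J,K} ↦ E_{J',K'} ⊗ E_{J'',K''}`. -/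
def kroneckerMatrixHom (n : ℕ) : UHFMatrix (b * c) n →⋆ₙₐ[ℂ] MinTensor X Y :=
  unitsHom (kroneckerUnit f g n) (kroneckerUnit_mul f g n) (star_kroneckerUnit f g n)

theorem tmul_ofMatrix (n : ℕ) (M : UHFMatrix b n) (N : UHFMatrix c n) :
    MinTensor.tmul (f (UHF.ofMatrix b n M)) (g (UHF.ofMatrix c n N)) =
      ∑ J, ∑ K, (M.entry (split b c n J).1 (split b c n K).1 *
        N.entry (split b c n J).2 (split b c n K).2) • kroneckerUnit f g n J K := by
  have h1 : ∀ F : UHFIndex b n × UHFIndex c n → MinTensor X Y,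
      ∑ J, F (split b c n J) = ∑ P, ∑ Q, F (P, Q) := fun F => by
    rw [(split b c n).sum_comp F, Fintype.sum_prod_type]
  have h2 : ∀ F : UHFIndex b n × UHFIndex c n → UHFIndex b n × UHFIndex c n → MinTensor X Y,
      ∑ J, ∑ K, F (split b c n J) (split b c n K) = ∑ P, ∑ P', ∑ Q, ∑ Q', F (P, P') (Q, Q') :=
    fun F => by
      rw [h1 fun p => ∑ K, F p (split b c n K)]
      exact Finset.sum_congr rfl fun P _ => Finset.sum_congr rfl fun P' _ => h1 _
  refine Eq.trans ?_ (h2 fun p q => (M.entry p.1 q.1 * N.entry p.2 q.2) • MinTensor.tmul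
    (f (UHF.ofMatrix b n (unit p.1 q.1))) (g (UHF.ofMatrix c n (unit p.2 q.2)))).symm
  change MinTensor.tmulₗ _ _ = _
  conv_lhs => rw [eq_sum_unit M, eq_sum_unit N]
  simp only [map_sum, map_smul, LinearMap.sum_apply, LinearMap.smul_apply, Finset.smul_sum,
    smul_smul]
  refine Eq.trans (Finset.sum_congr rfl fun P' _ => ?_) Finset.sum_comm
  refine Eq.trans ?_ (Finset.sum_congr rfl fun P _ => Finset.sum_comm)
  refine Eq.trans (Finset.sum_congr rfl fun Q' _ => ?_) Finset.sum_comm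
  refine Finset.sum_congr rfl fun P _ => Finset.sum_congr rfl fun Q _ => ?_
  rw [mul_comm]
  rfl

theorem kroneckerMatrixHom_uhfEmbed (n m : ℕ) (h : n ≤ m) (M : UHFMatrix (b * c) n) :
    kroneckerMatrixHom f g m (uhfEmbed (b * c) n m h M) = kroneckerMatrixHom f g n M := by
  have key : ∀ P Q : UHFIndex (b * c) n,
      kroneckerMatrixHom f g m (uhfEmbed (b * c) n m h (unit P Q)) =
        kroneckerMatrixHom f g n (unit P Q) := fun P Q => by
    refine Eq.trans ?_ (unitsHom_unit _ _ _ P Q).symm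
    unfold kroneckerUnit
    rw [← UHF.ofMatrix_uhfEmbed b h, ← UHF.ofMatrix_uhfEmbed c h, tmul_ofMatrix]
    refine Finset.sum_congr rfl fun J _ => Finset.sum_congr rfl fun K _ => ?_
    congr 1
    simp only [entry_uhfEmbed, entry_unit]
    by_cases ht : SameTail n J K
    · obtain ⟨h1, h2⟩ := (sameTail_split J K).1 ht
      rw [if_pos ht, if_pos h1, if_pos h2]
      have e1 : ∀ J : UHFIndex (b * c) m, ∀ P : UHFIndex (b * c) n, trunc h J = P ↔
          trunc h (split b c m J).1 = (split b c n P).1 ∧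
            trunc h (split b c m J).2 = (split b c n P).2 := fun J P => by
        rw [← (split b c n).injective.eq_iff, split_trunc, Prod.ext_iff]
      simp only [e1 J P, e1 K Q]
      split_ifs <;> simp_all
    · rw [if_neg ht]
      by_cases h1 : SameTail n (split b c m J).1 (split b c m K).1
      · have h2 : ¬ SameTail n (split b c m J).2 (split b c m K).2 := fun h2 =>
          ht ((sameTail_split J K).2 ⟨h1, h2⟩)
        rw [if_neg h2, mul_zero]
      · rw [if_neg h1, zero_mul]
  rw [eq_sum_unit M]
  simp only [map_sum, map_smul, key]

/-- The `*`-homomorphism `(f ⊗ g) ∘ φ_{b,c} : A(b·c) → X ⊗ Y`, where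
`φ_{b,c} : A(b·c) → A(b) ⊗ A(c)` is the Kronecker coproduct: it sends the matrix unit `E_{J,K}` to
`f(E_{J',K'}) ⊗ g(E_{J'',K''})`. -/
def kroneckerHom : UHF (b * c) →⋆ₙₐ[ℂ] MinTensor X Y :=
  UHF.lift (kroneckerMatrixHom f g) (kroneckerMatrixHom_uhfEmbed f g)

theorem kroneckerHom_unit (n : ℕ) (J K : UHFIndex (b * c) n) :
    kroneckerHom f g (UHF.ofMatrix (b * c) n (unit J K)) = kroneckerUnit f g n J K :=
  (UHF.lift_ofMatrix _ _ n _).trans (unitsHom_unit _ _ _ J K)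

end KroneckerHom

/-- The Kronecker coproduct `φ_{b,c} : A(b·c) → A(b) ⊗ A(c)`. -/
def kroneckerCoproduct (b c : ℕ → ℕ) [PosSeq b] [PosSeq c] :
    UHF (b * c) →⋆ₙₐ[ℂ] MinTensor (UHF b) (UHF c) :=
  kroneckerHom (NonUnitalStarAlgHom.id ℂ (UHF b)) (NonUnitalStarAlgHom.id ℂ (UHF c))

end Kronecker

noncomputable section Comultiplication

open UHFIndex UHFMatrix Filter Topology

theorem continuous_starAlgHom {A B : Type*} [NonUnitalCStarAlgebra A] [NonUnitalCStarAlgebra B]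
    (f : A →⋆ₙₐ[ℂ] B) : Continuous f :=
  AddMonoidHomClass.continuous_of_bound f 1 fun x =>
    (NonUnitalStarAlgHom.norm_apply_le f x).trans_eq (one_mul _).symm

/-- The C*-algebra `A(*)`: the direct sum of the C*-algebras `A(a)`, where `a` runs through the
sequences of integers `≥ 2` and the constant sequence `1`. -/
abbrev UHFSum : Type := C0Sum fun a : UHFMonoid => UHF (a : ℕ → ℕ)

/-- The `(b, c)`-block of the comultiplication: the `*`-homomorphism `(ι_b ⊗ ι_c) ∘ φ_{b,c}` from
`A(b·c)` to `A(*) ⊗ A(*)`, where `φ_{b,c} : A(b·c) → A(b) ⊗ A(c)` is the Kronecker coproduct and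
`ι_b`, `ι_c` are the inclusions of `A(b)`, `A(c)` in `A(*)`. -/
def comulBlock (p : UHFMonoid × UHFMonoid) :
    UHF ((p.1 * p.2 : UHFMonoid) : ℕ → ℕ) →⋆ₙₐ[ℂ] MinTensor UHFSum UHFSum :=
  kroneckerHom (b := (p.1 : ℕ → ℕ)) (c := (p.2 : ℕ → ℕ))
    (C0Sum.single (A := fun a : UHFMonoid => UHF (a : ℕ → ℕ)) p.1)
    (C0Sum.single (A := fun a : UHFMonoid => UHF (a : ℕ → ℕ)) p.2)

/-- The element `(ι_b ⊗ ι_c)(φ_{b,c}(x_{b·c}))` of `A(*) ⊗ A(*)`, where `x_{b·c}` is the component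
of `x` in `A(b·c)`. -/
def comulTerm (p : UHFMonoid × UHFMonoid) : UHFSum →⋆ₙₐ[ℂ] MinTensor UHFSum UHFSum :=
  (comulBlock p).comp (C0Sum.proj (p.1 * p.2))

theorem C0Sum.single_mul_single_of_ne {ι : Type*} {A : ι → Type*} [∀ i, NonUnitalCStarAlgebra (A i)]
    {i j : ι} (h : i ≠ j) (x : A i) (y : A j) : C0Sum.single i x * C0Sum.single j y = 0 :=
  C0Sum.ext fun k => by
    change (C0Sum.single i x).coord k * (C0Sum.single j y).coord k = 0
    by_cases hk : k = i
    · subst hk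
      rw [C0Sum.coord_single_of_ne h y, mul_zero]
    · rw [C0Sum.coord_single_of_ne hk, zero_mul]

theorem comulBlock_ofMatrix (p : UHFMonoid × UHFMonoid) (n : ℕ)
    (M : UHFMatrix ((p.1 * p.2 : UHFMonoid) : ℕ → ℕ) n) :
    comulBlock p (UHF.ofMatrix _ n M) = kroneckerMatrixHom (b := (p.1 : ℕ → ℕ))
      (c := (p.2 : ℕ → ℕ)) (C0Sum.single (A := fun a : UHFMonoid => UHF (a : ℕ → ℕ)) p.1)
        (C0Sum.single (A := fun a : UHFMonoid => UHF (a : ℕ → ℕ)) p.2) n M :=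
  UHF.lift_ofMatrix _ _ n M

/-- On matrix units, `comulBlock` is `E_{J,K} ↦ ι_b(E_{J',K'}) ⊗ ι_c(E_{J'',K''})`. -/
theorem comulBlock_unit (p : UHFMonoid × UHFMonoid) (n : ℕ)
    (J K : UHFIndex ((p.1 : ℕ → ℕ) * (p.2 : ℕ → ℕ)) n) :
    comulBlock p (UHF.ofMatrix _ n (unit J K)) = MinTensor.tmul
      (C0Sum.single p.1 (UHF.ofMatrix (p.1 : ℕ → ℕ) n
        (unit (split _ _ n J).1 (split _ _ n K).1)) : UHFSum)
      (C0Sum.single p.2 (UHF.ofMatrix (p.2 : ℕ → ℕ) n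
        (unit (split _ _ n J).2 (split _ _ n K).2)) : UHFSum) :=
  kroneckerHom_unit (b := (p.1 : ℕ → ℕ)) (c := (p.2 : ℕ → ℕ)) _ _ n J K

theorem comulBlock_mul_tmul {p q : UHFMonoid × UHFMonoid} (h : p ≠ q)
    (x : UHF ((p.1 * p.2 : UHFMonoid) : ℕ → ℕ)) (y : UHF (q.1 : ℕ → ℕ)) (z : UHF (q.2 : ℕ → ℕ)) :
    comulBlock p x * MinTensor.tmul (C0Sum.single q.1 y : UHFSum) (C0Sum.single q.2 z : UHFSum)
      = 0 := by
  induction x using UHF.induction_on with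
  | hc =>
    exact isClosed_eq ((continuous_starAlgHom (comulBlock p)).mul continuous_const)
      continuous_const
  | h n M =>
    rw [comulBlock_ofMatrix]
    refine (Finset.sum_mul _ _ _).trans (Finset.sum_eq_zero fun J _ => ?_)
    refine (Finset.sum_mul _ _ _).trans (Finset.sum_eq_zero fun K _ => ?_)
    rw [smul_mul_assoc]
    refine Eq.trans (congrArg _ ?_) (smul_zero _)
    refine (MinTensor.tmul_mul_tmul _ _ _ _).trans ?_
    by_cases h1 : p.1 = q.1
    · have h2 : p.2 ≠ q.2 := fun h2 => h (Prod.ext h1 h2)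
      rw [C0Sum.single_mul_single_of_ne h2]
      exact map_zero (MinTensor.tmulₗ _)
    · rw [C0Sum.single_mul_single_of_ne h1]
      exact LinearMap.map_zero₂ MinTensor.tmulₗ _

theorem comulBlock_mul_comulBlock {p q : UHFMonoid × UHFMonoid} (h : p ≠ q)
    (x : UHF ((p.1 * p.2 : UHFMonoid) : ℕ → ℕ)) (y : UHF ((q.1 * q.2 : UHFMonoid) : ℕ → ℕ)) :
    comulBlock p x * comulBlock q y = 0 := by
  induction y using UHF.induction_on with
  | hc =>
    exact isClosed_eq (continuous_const.mul (continuous_starAlgHom (comulBlock q)))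
      continuous_const
  | h n M =>
    rw [comulBlock_ofMatrix]
    refine (Finset.mul_sum _ _ _).trans (Finset.sum_eq_zero fun J _ => ?_)
    refine (Finset.mul_sum _ _ _).trans (Finset.sum_eq_zero fun K _ => ?_)
    rw [mul_smul_comm]
    exact (congrArg _ (comulBlock_mul_tmul h x _ _)).trans (smul_zero _)

theorem comulTerm_mul_comulTerm {p q : UHFMonoid × UHFMonoid} (h : p ≠ q) (x y : UHFSum) :
    comulTerm p x * comulTerm q y = 0 :=
  comulBlock_mul_comulBlock h _ _

/-- The finite partial sums of the comultiplication. -/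
def comulPartial (F : Finset (UHFMonoid × UHFMonoid)) :
    UHFSum →⋆ₙₐ[ℂ] MinTensor UHFSum UHFSum where
  toFun x := ∑ p ∈ F, comulTerm p x
  map_smul' c x := by simp only [map_smul, Finset.smul_sum, MonoidHom.id_apply]
  map_zero' := by simp only [map_zero, Finset.sum_const_zero]
  map_add' x y := by simp only [map_add, Finset.sum_add_distrib]
  map_mul' x y := by
    rw [Finset.sum_mul]
    refine Finset.sum_congr rfl fun p hp => ?_
    rw [Finset.mul_sum, Finset.sum_eq_single p, map_mul]
    · exact fun q _ hq => comulTerm_mul_comulTerm hq.symm x y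
    · exact fun h => absurd hp h
  map_star' x := by simp only [map_star, star_sum]

theorem norm_sum_comulTerm_le (F : Finset (UHFMonoid × UHFMonoid)) (x : UHFSum) :
    ‖∑ p ∈ F, comulTerm p x‖ ≤ ‖x‖ :=
  NonUnitalStarAlgHom.norm_apply_le (comulPartial F) x

theorem norm_sum_comulTerm_mul_le (F : Finset (UHFMonoid × UHFMonoid)) (x : UHFSum)
    (t : MinTensor UHFSum UHFSum) : ‖∑ p ∈ F, comulTerm p x * t‖ ≤ ‖x‖ * ‖t‖ := by
  rw [← Finset.sum_mul]
  exact (norm_mul_le _ _).trans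
    (mul_le_mul_of_nonneg_right (norm_sum_comulTerm_le F x) (norm_nonneg _))

theorem isClosed_summable_comulTerm (x : UHFSum) :
    IsClosed {t : MinTensor UHFSum UHFSum | Summable fun p => comulTerm p x * t} := by
  refine isClosed_of_closure_subset fun t ht => ?_
  refine summable_iff_vanishing_norm.2 fun ε hε => ?_
  obtain ⟨s, hs, hd⟩ := Metric.mem_closure_iff.1 ht (ε / (2 * (‖x‖ + 1))) (by positivity)
  obtain ⟨F₀, hF₀⟩ := summable_iff_vanishing_norm.1 hs (ε / 2) (half_pos hε)
  refine ⟨F₀, fun F hF => ?_⟩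
  have h1 : ∑ p ∈ F, comulTerm p x * t =
      ∑ p ∈ F, comulTerm p x * (t - s) + ∑ p ∈ F, comulTerm p x * s := by
    rw [← Finset.sum_add_distrib]
    refine Finset.sum_congr rfl fun p _ => ?_
    rw [← mul_add, sub_add_cancel]
  have h2 : ‖∑ p ∈ F, comulTerm p x * (t - s)‖ ≤ ‖x‖ * ‖t - s‖ := norm_sum_comulTerm_mul_le F x _
  rw [dist_eq_norm, lt_div_iff₀ (by positivity)] at hd
  have h3 : ‖x‖ * ‖t - s‖ ≤ ε / 2 := by nlinarith [norm_nonneg (t - s), norm_nonneg x]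
  rw [h1]
  exact (norm_add_le _ _).trans_lt (by linarith [hF₀ F hF])

theorem MinTensor.continuous_tmul_left {A B : Type*} [NonUnitalCStarAlgebra A]
    [NonUnitalCStarAlgebra B] (b : B) : Continuous fun a : A => MinTensor.tmul a b :=
  AddMonoidHomClass.continuous_of_bound (MinTensor.tmulₗ.flip b : A →ₗ[ℂ] MinTensor A B) ‖b‖
    fun a => (MinTensor.norm_tmul_le a b).trans_eq (mul_comm _ _)

theorem MinTensor.continuous_tmul_right {A B : Type*} [NonUnitalCStarAlgebra A]
    [NonUnitalCStarAlgebra B] (a : A) : Continuous fun b : B => MinTensor.tmul a b :=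
  AddMonoidHomClass.continuous_of_bound (MinTensor.tmulₗ a : B →ₗ[ℂ] MinTensor A B) ‖a‖
    fun b => MinTensor.norm_tmul_le a b

theorem summable_comulTerm_mul (x : UHFSum) (t : MinTensor UHFSum UHFSum) :
    Summable fun p => comulTerm p x * t := by
  have h0 : Summable fun p => comulTerm p x * (0 : MinTensor UHFSum UHFSum) := by
    simp only [mul_zero]; exact summable_zero
  have hadd : ∀ s t : MinTensor UHFSum UHFSum, (Summable fun p => comulTerm p x * s) →
      (Summable fun p => comulTerm p x * t) → Summable fun p => comulTerm p x * (s + t) :=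
    fun s t hs ht => by simp only [mul_add]; exact hs.add ht
  induction t using MinTensor.induction_on with
  | hc => exact isClosed_summable_comulTerm x
  | h0 => exact h0
  | ha s t hs ht => exact hadd s t hs ht
  | ht u v =>
    induction u using C0Sum.induction_on with
    | hc => exact (isClosed_summable_comulTerm x).preimage (MinTensor.continuous_tmul_left v)
    | h0 =>
      rw [show MinTensor.tmul (0 : UHFSum) v = 0 from LinearMap.map_zero₂ MinTensor.tmulₗ v]
      exact h0
    | ha u u' hu hu' => rw [MinTensor.add_tmul]; exact hadd _ _ hu hu'
    | hs b y =>
      induction v using C0Sum.induction_on with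
      | hc => exact (isClosed_summable_comulTerm x).preimage (MinTensor.continuous_tmul_right _)
      | h0 =>
        rw [show MinTensor.tmul (C0Sum.single b y : UHFSum) (0 : UHFSum) = 0 from
          map_zero (MinTensor.tmulₗ _)]
        exact h0
      | ha v v' hv hv' => rw [MinTensor.tmul_add]; exact hadd _ _ hv hv'
      | hs c z =>
        refine summable_of_ne_finset_zero (s := {(b, c)}) fun p hp => ?_
        exact comulBlock_mul_tmul (q := (b, c)) (fun h => hp (Finset.mem_singleton.2 h)) _ y z

theorem star_mul_comulTerm (p) (x : UHFSum) (t : MinTensor UHFSum UHFSum) :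
    star (t * comulTerm p x) = comulTerm p (star x) * star t := by
  rw [star_mul, map_star]

theorem summable_mul_comulTerm (x : UHFSum) (t : MinTensor UHFSum UHFSum) :
    Summable fun p => t * comulTerm p x := by
  have h := (summable_comulTerm_mul (star x) (star t)).star
  refine h.congr fun p => ?_
  rw [← star_mul_comulTerm, star_star]

theorem norm_tsum_comulTerm_mul_le (x : UHFSum) (t : MinTensor UHFSum UHFSum) :
    ‖∑' p, comulTerm p x * t‖ ≤ ‖x‖ * ‖t‖ :=
  le_of_tendsto (summable_comulTerm_mul x t).hasSum.norm
    (Eventually.of_forall fun F => norm_sum_comulTerm_mul_le F x t)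

theorem norm_tsum_mul_comulTerm_le (x : UHFSum) (t : MinTensor UHFSum UHFSum) :
    ‖∑' p, t * comulTerm p x‖ ≤ ‖x‖ * ‖t‖ := by
  have h := norm_tsum_comulTerm_mul_le (star x) (star t)
  rw [norm_star, norm_star] at h
  refine Eq.trans_le ?_ h
  rw [← norm_star, tsum_star]
  simp only [star_mul_comulTerm]

/-- The multiplier `Δ(x)` of `A(*) ⊗ A(*)`: it is the family of all `φ_{b,c}(x_{b·c})`, an element
of the direct product of the C*-algebras `A(b) ⊗ A(c)`, acting on `A(*) ⊗ A(*)` by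
`Δ(x) t = ∑ (ι_b ⊗ ι_c)(φ_{b,c}(x_{b·c})) t` and `t Δ(x) = ∑ t (ι_b ⊗ ι_c)(φ_{b,c}(x_{b·c}))`, the
sums being taken over all pairs `(b, c)`. -/
def comulMultiplier (x : UHFSum) : 𝓜(ℂ, MinTensor UHFSum UHFSum) where
  fst := LinearMap.mkContinuous
    { toFun := fun t => ∑' p, comulTerm p x * t
      map_add' := fun s t => by
        simp only [mul_add]
        exact (summable_comulTerm_mul x s).tsum_add (summable_comulTerm_mul x t)
      map_smul' := fun c t => by
        simp only [mul_smul_comm]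
        exact (summable_comulTerm_mul x t).tsum_const_smul c } ‖x‖
    (norm_tsum_comulTerm_mul_le x)
  snd := LinearMap.mkContinuous
    { toFun := fun t => ∑' p, t * comulTerm p x
      map_add' := fun s t => by
        simp only [add_mul]
        exact (summable_mul_comulTerm x s).tsum_add (summable_mul_comulTerm x t)
      map_smul' := fun c t => by
        simp only [smul_mul_assoc]
        exact (summable_mul_comulTerm x t).tsum_const_smul c } ‖x‖
    (norm_tsum_mul_comulTerm_le x)
  central := fun s t => by
    change (∑' p, s * comulTerm p x) * t = s * ∑' p, comulTerm p x * t
    rw [← (summable_mul_comulTerm x s).tsum_mul_right, ← (summable_comulTerm_mul x t).tsum_mul_left]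
    simp only [mul_assoc]

theorem comulMultiplier_fst (x : UHFSum) (t : MinTensor UHFSum UHFSum) :
    (comulMultiplier x).fst t = ∑' p, comulTerm p x * t := rfl

theorem comulMultiplier_snd (x : UHFSum) (t : MinTensor UHFSum UHFSum) :
    (comulMultiplier x).snd t = ∑' p, t * comulTerm p x := rfl

theorem comulTerm_mul_fst (p) (x y : UHFSum) (t : MinTensor UHFSum UHFSum) :
    comulTerm p x * (comulMultiplier y).fst t = comulTerm p (x * y) * t := by
  rw [comulMultiplier_fst, ← (summable_comulTerm_mul y t).tsum_mul_left, tsum_eq_single p]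
  · rw [← mul_assoc, map_mul]
  · intro q hq
    rw [← mul_assoc, comulTerm_mul_comulTerm hq.symm, zero_mul]

theorem snd_mul_comulTerm (p) (x y : UHFSum) (t : MinTensor UHFSum UHFSum) :
    (comulMultiplier x).snd t * comulTerm p y = t * comulTerm p (x * y) := by
  rw [comulMultiplier_snd, ← (summable_mul_comulTerm x t).tsum_mul_right, tsum_eq_single p]
  · rw [mul_assoc, map_mul]
  · intro q hq
    rw [mul_assoc, comulTerm_mul_comulTerm hq, mul_zero]

/-- The comultiplication `Δ_φ : A(*) → M(A(*) ⊗ A(*))`. -/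
def uhfComul : UHFSum →⋆ₙₐ[ℂ] 𝓜(ℂ, MinTensor UHFSum UHFSum) where
  toFun := comulMultiplier
  map_smul' c x := by
    refine DoubleCentralizer.ext ℂ _ _ _ (Prod.ext ?_ ?_)
    · ext t
      change ∑' p, comulTerm p (c • x) * t = c • ∑' p, comulTerm p x * t
      rw [← (summable_comulTerm_mul x t).tsum_const_smul c]
      simp only [map_smul, smul_mul_assoc]
    · ext t
      change ∑' p, t * comulTerm p (c • x) = c • ∑' p, t * comulTerm p x
      rw [← (summable_mul_comulTerm x t).tsum_const_smul c]
      simp only [map_smul, mul_smul_comm]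
  map_zero' := by
    refine DoubleCentralizer.ext ℂ _ _ _ (Prod.ext ?_ ?_)
    · ext t
      change ∑' p, comulTerm p 0 * t = 0
      simp only [map_zero, zero_mul, tsum_zero]
    · ext t
      change ∑' p, t * comulTerm p 0 = 0
      simp only [map_zero, mul_zero, tsum_zero]
  map_add' x y := by
    refine DoubleCentralizer.ext ℂ _ _ _ (Prod.ext ?_ ?_)
    · ext t
      change ∑' p, comulTerm p (x + y) * t = (∑' p, comulTerm p x * t) + ∑' p, comulTerm p y * t
      rw [← (summable_comulTerm_mul x t).tsum_add (summable_comulTerm_mul y t)]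
      simp only [map_add, add_mul]
    · ext t
      change ∑' p, t * comulTerm p (x + y) = (∑' p, t * comulTerm p x) + ∑' p, t * comulTerm p y
      rw [← (summable_mul_comulTerm x t).tsum_add (summable_mul_comulTerm y t)]
      simp only [map_add, mul_add]
  map_mul' x y := by
    refine DoubleCentralizer.ext ℂ _ _ _ (Prod.ext ?_ ?_)
    · ext t
      change ∑' p, comulTerm p (x * y) * t = ∑' p, comulTerm p x * (comulMultiplier y).fst t
      simp only [comulTerm_mul_fst]
    · ext t
      change ∑' p, t * comulTerm p (x * y) = ∑' p, (comulMultiplier x).snd t * comulTerm p y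
      simp only [snd_mul_comulTerm]
  map_star' x := by
    refine DoubleCentralizer.ext ℂ _ _ _ (Prod.ext ?_ ?_)
    · ext t
      change ∑' p, comulTerm p (star x) * t = star (∑' p, star t * comulTerm p x)
      rw [tsum_star]
      simp only [star_mul_comulTerm, star_star]
    · ext t
      change ∑' p, t * comulTerm p (star x) = star (∑' p, comulTerm p x * star t)
      rw [tsum_star]
      simp only [star_mul, map_star, star_star]

instance uniqueIndexOne (n : ℕ) : Unique (UHFIndex 1 n) :=
  inferInstanceAs (Unique (Fin n → Fin 1))

/-- The identification of `M_1 ⊗ ⋯ ⊗ M_1` with `ℂ`. -/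
def matrixOneHom (n : ℕ) : UHFMatrix 1 n →⋆ₙₐ[ℂ] ℂ where
  toFun M := M.entry default default
  map_smul' _ _ := rfl
  map_zero' := rfl
  map_add' _ _ := rfl
  map_mul' M N := by rw [entry_mul, Fintype.sum_unique]
  map_star' _ := rfl

theorem matrixOneHom_uhfEmbed (n m : ℕ) (h : n ≤ m) (M : UHFMatrix 1 n) :
    matrixOneHom m (uhfEmbed 1 n m h M) = matrixOneHom n M := by
  change (uhfEmbed 1 n m h M).entry default default = M.entry default default
  rw [entry_uhfEmbed, if_pos (SameTail.refl _), Subsingleton.elim (trunc h default) default]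

/-- The identification of `A(1)` with `ℂ`, where `1` is the constant sequence. -/
def uhfOneHom : UHF 1 →⋆ₙₐ[ℂ] ℂ := UHF.lift matrixOneHom matrixOneHom_uhfEmbed

theorem algebraMap_uhfOneHom (x : UHF 1) : algebraMap ℂ (UHF 1) (uhfOneHom x) = x := by
  induction x using UHF.induction_on with
  | hc =>
    exact isClosed_eq ((continuous_algebraMap ℂ (UHF 1)).comp
      (continuous_starAlgHom uhfOneHom)) continuous_id
  | h n M =>
    have h1 : M = algebraMap ℂ (UHFMatrix 1 n) (M.entry default default) :=
      UHFMatrix.ext fun J K => by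
        rw [Algebra.algebraMap_eq_smul_one, entry_smul, entry_one,
          if_pos (Subsingleton.elim J K), mul_one, Subsingleton.elim J default,
          Subsingleton.elim K default]
    have h2 : uhfOneHom (UHF.ofMatrix 1 n M) = M.entry default default :=
      UHF.lift_ofMatrix matrixOneHom matrixOneHom_uhfEmbed n M
    rw [h2]
    conv_rhs => rw [h1]
    exact (AlgHomClass.commutes (UHF.ofMatrix 1 n) _).symm

theorem uhfOneHom_algebraMap (z : ℂ) : uhfOneHom (algebraMap ℂ (UHF 1) z) = z := by
  rw [← AlgHomClass.commutes (UHF.ofMatrix 1 0) z]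
  refine (UHF.lift_ofMatrix matrixOneHom matrixOneHom_uhfEmbed 0 _).trans ?_
  change (algebraMap ℂ (UHFMatrix 1 0) z).entry default default = z
  rw [Algebra.algebraMap_eq_smul_one, entry_smul, entry_one, if_pos rfl, mul_one]

/-- The isomorphism `A(1) = ℂ`. -/
def uhfOneEquiv : UHF 1 ≃⋆ₐ[ℂ] ℂ where
  toFun := uhfOneHom
  invFun := algebraMap ℂ (UHF 1)
  left_inv := algebraMap_uhfOneHom
  right_inv := uhfOneHom_algebraMap
  map_mul' := map_mul uhfOneHom
  map_add' := map_add uhfOneHom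
  map_star' := map_star uhfOneHom
  map_smul' := map_smul uhfOneHom

/-- The map `ε : A(*) → ℂ`: the projection of `A(*)` onto its summand `A(1) = ℂ`. -/
def uhfCounit : UHFSum →⋆ₙₐ[ℂ] ℂ where
  toFun x := uhfOneEquiv (C0Sum.proj (1 : UHFMonoid) x)
  map_smul' c x := by rw [map_smul]; exact map_smul uhfOneHom c _
  map_zero' := by rw [map_zero]; exact map_zero uhfOneHom
  map_add' x y := by rw [map_add]; exact map_add uhfOneHom _ _
  map_mul' x y := by rw [map_mul]; exact map_mul uhfOneHom _ _
  map_star' x := by rw [map_star]; exact map_star uhfOneHom _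

end Comultiplication

/-! Everything rests on coordinates in which A(*) ⊗ A(*) is again a c₀-direct sum of UHF algebras.
The maps `comulBlock (b, c)`, that is A(b·c) → A(b) ⊗ A(c) → A(*) ⊗ A(*), are injective, have
mutually orthogonal ranges and span a dense subspace (`isBlockDecomposition_comulBlock`). The blocks
are unital, so a multiplier of such a sum amounts to a bounded family of elements of the blocks
(`IsBlockDecomposition.coeff`, `IsBlockDecomposition.multiplier_ext`,
`IsBlockDecomposition.diagonal`). In these coordinates Δ_φ(x) is the family (x_{b·c})
(`uhfCoeff_comul`): the comultiplication is pullback along the multiplication S × S → S.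

The assertions thereby become facts about the monoid S and the Kronecker product. The extensions of
Δ ⊗ id, id ⊗ Δ, ε ⊗ id and id ⊗ ε are also pullbacks of families (`IsBlockDecomposition.pullback`),
along (b, c, d) ↦ (bc, d), (b, c, d) ↦ (b, cd), a ↦ (1, a) and a ↦ (a, 1). Coassociativity is
therefore (bc)d = b(cd) together with the associativity of Kronecker products
(`UHF.cast_kron_kron`), and the counit law is 1·a = a = a·1.

Properness and the cancellation law hold because S is cancellative. For x in A(a) and y in A(c) the
multiplier Δ(x)(1 ⊗ y) has at most one nonzero component, at the pair (b, c) with bc = a, so it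
belongs to A(*) ⊗ A(*) (`exists_coe_eq_mul`). For y = 1 these products exhaust the blocks
(`coe_comulBlock_eq_mul_oneTmul`). Cocommutativity fails because the flip exchanges the two digits
of an index, and for b = 2, c = 3 this moves a matrix unit of M_6.

The analytic content is the injectivity of the blocks. A *-homomorphism on a UHF algebra is
injective as soon as it kills no diagonal matrix unit (`UHF.injective_of_ne_zero`). The minimal
tensor product acts on tensor products of GNS spaces, so p ⊗ q ≠ 0 for projections p and q at which
some positive functionals do not vanish; moreover a vector functional of A ⊗ B does not vanish at p
⊗ q (`MinTensor.isSupported_tmul`). The hypothesis thus reproduces itself and the argument iterates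
to triple tensor products, which is why `IsUHFDecomposition` asks for such functionals instead of
injectivity. -/

/-! ### C*-algebras as c₀-direct sums of orthogonal blocks. -/

noncomputable section BlockDecomposition

open Filter Topology

namespace C0Sum

variable {ι : Type*} {A : ι → Type*} [∀ i, NonUnitalCStarAlgebra (A i)]

/-- The element of the direct sum with given components, which tend to zero. -/
def mk (f : ∀ i, A i) (h : Tendsto (fun i => ‖f i‖) cofinite (𝓝 0)) : C0Sum A :=
  ⟨⟨f, memℓp_infty h.bddAbove_range_of_cofinite⟩, h⟩

theorem coord_mk (f : ∀ i, A i) (h) (i : ι) : (mk f h).coord i = f i := rfl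

theorem coord_add (x y : C0Sum A) (i : ι) : (x + y).coord i = x.coord i + y.coord i := rfl

theorem coord_mul (x y : C0Sum A) (i : ι) : (x * y).coord i = x.coord i * y.coord i := rfl

theorem coord_smul (c : ℂ) (x : C0Sum A) (i : ι) : (c • x).coord i = c • x.coord i := rfl

theorem coord_star (x : C0Sum A) (i : ι) : (star x).coord i = star (x.coord i) := rfl

theorem coord_zero (i : ι) : (0 : C0Sum A).coord i = 0 := rfl

theorem single_injective (i : ι) : Function.Injective (single (A := A) i) := fun a b h => by
  rw [← coord_single_same i a, h, coord_single_same]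

theorem mul_single (x : C0Sum A) (i : ι) (a : A i) :
    x * single i a = single i (x.coord i * a) := ext fun j => by
  rw [coord_mul]
  by_cases h : j = i
  · subst h; simp only [coord_single_same]
  · simp only [coord_single_of_ne h, mul_zero]

theorem coord_sum_single (F : Finset ι) [DecidableEq ι] (x : C0Sum A) (j : ι) :
    (∑ i ∈ F, single i (x.coord i)).coord j = if j ∈ F then x.coord j else 0 := by
  rw [← proj_apply, map_sum]
  by_cases hj : j ∈ F
  · rw [Finset.sum_eq_single j, if_pos hj, proj_apply, coord_single_same]
    · exact fun i _ hij => coord_single_of_ne hij.symm _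
    · exact fun h => absurd hj h
  · rw [if_neg hj]
    refine Finset.sum_eq_zero fun i hi => coord_single_of_ne ?_ _
    rintro rfl
    exact hj hi

end C0Sum

/-- A family of injective `*`-homomorphisms `β i : B i → C` with mutually orthogonal ranges whose
sum is dense in `C`. It exhibits `C` as the direct sum of the C*-algebras `B i`. -/
structure IsBlockDecomposition {ι : Type*} {B : ι → Type*} [∀ i, NonUnitalCStarAlgebra (B i)]
    {C : Type*} [NonUnitalCStarAlgebra C] (β : ∀ i, B i →⋆ₙₐ[ℂ] C) : Prop where
  orthogonal : ∀ i j, i ≠ j → ∀ x y, β i x * β j y = 0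
  injective : ∀ i, Function.Injective (β i)
  dense : Dense (Submodule.span ℂ {t : C | ∃ i x, t = β i x} : Set C)

namespace IsBlockDecomposition

variable {ι : Type*} {B : ι → Type*} [∀ i, NonUnitalCStarAlgebra (B i)]
  {C : Type*} [NonUnitalCStarAlgebra C] {β : ∀ i, B i →⋆ₙₐ[ℂ] C}

theorem induction_on (hβ : IsBlockDecomposition β) {P : C → Prop} (hc : IsClosed {t | P t})
    (h0 : P 0) (hb : ∀ i x, P (β i x)) (ha : ∀ s t, P s → P t → P (s + t)) (t : C) : P t := by
  have h1 : (Submodule.span ℂ {t : C | ∃ i x, t = β i x} : Set C) ⊆ {t | P t} := by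
    intro t ht
    induction ht using Submodule.closure_induction with
    | zero => exact h0
    | add x y _ _ hx hy => exact ha x y hx hy
    | smul_mem c x hx =>
      obtain ⟨i, x, rfl⟩ := hx
      rw [← map_smul]
      exact hb i _
  exact hc.closure_subset_iff.2 h1 (hβ.dense t)

/-- The finite partial sums of the map `x ↦ ∑ β i (x i)`. -/
def partialHom (hβ : IsBlockDecomposition β) (F : Finset ι) : C0Sum B →⋆ₙₐ[ℂ] C where
  toFun x := ∑ i ∈ F, β i (x.coord i)
  map_smul' c x := by simp only [C0Sum.coord_smul, map_smul, Finset.smul_sum, MonoidHom.id_apply]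
  map_zero' := by simp only [C0Sum.coord_zero, map_zero, Finset.sum_const_zero]
  map_add' x y := by simp only [C0Sum.coord_add, map_add, Finset.sum_add_distrib]
  map_mul' x y := by
    rw [Finset.sum_mul]
    refine Finset.sum_congr rfl fun i hi => ?_
    rw [Finset.mul_sum, Finset.sum_eq_single i, C0Sum.coord_mul, map_mul]
    · exact fun j _ hj => hβ.orthogonal i j hj.symm _ _
    · exact fun h => absurd hi h
  map_star' x := by simp only [C0Sum.coord_star, map_star, star_sum]

/-- Orthogonality makes a finite partial sum a *-homomorphism, hence contractive. Applied to the
truncation of x to F, whose norm is at most r, this gives a bound that does not grow with the number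
of terms. -/
theorem norm_sum_le (hβ : IsBlockDecomposition β) (F : Finset ι) (x : C0Sum B) {r : ℝ}
    (hr : 0 ≤ r) (h : ∀ i ∈ F, ‖x.coord i‖ ≤ r) : ‖∑ i ∈ F, β i (x.coord i)‖ ≤ r := by
  classical
  have h1 := NonUnitalStarAlgHom.norm_apply_le (hβ.partialHom F)
    (∑ i ∈ F, C0Sum.single i (x.coord i))
  have h2 : hβ.partialHom F (∑ i ∈ F, C0Sum.single i (x.coord i)) = ∑ i ∈ F, β i (x.coord i) :=
    Finset.sum_congr rfl fun i hi => by rw [C0Sum.coord_sum_single, if_pos hi]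
  rw [h2] at h1
  refine h1.trans (C0Sum.norm_le hr fun i => ?_)
  rw [C0Sum.coord_sum_single]
  split_ifs with hi
  · exact h i hi
  · rwa [norm_zero]

/-- Outside a finite set all components are smaller than ε/2, and `norm_sum_le` then bounds every
finite sum over indices outside that set: this is the Cauchy criterion. -/
theorem summable (hβ : IsBlockDecomposition β) (x : C0Sum B) :
    Summable fun i => β i (x.coord i) := by
  refine summable_iff_vanishing_norm.2 fun ε hε => ?_
  have h1 := (Metric.tendsto_nhds.1 x.tendsto_norm_coord) (ε / 2) (half_pos hε)
  rw [eventually_cofinite] at h1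
  refine ⟨h1.toFinset, fun F hF => ?_⟩
  refine (hβ.norm_sum_le F x (half_pos hε).le fun i hi => ?_).trans_lt (half_lt_self hε)
  by_contra hlt
  refine Finset.disjoint_left.1 hF hi (h1.mem_toFinset.2 fun h => hlt ?_)
  simpa using h.le

theorem tsum_mul (hβ : IsBlockDecomposition β) (x : C0Sum B) (i : ι) (y : B i) :
    (∑' j, β j (x.coord j)) * β i y = β i (x.coord i * y) := by
  rw [← (hβ.summable x).tsum_mul_right, tsum_eq_single i, map_mul]
  exact fun j hj => hβ.orthogonal j i hj _ _

/-- The `*`-homomorphism `x ↦ ∑ β i (x i)`. -/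
def sumHom (hβ : IsBlockDecomposition β) : C0Sum B →⋆ₙₐ[ℂ] C where
  toFun x := ∑' i, β i (x.coord i)
  map_smul' c x := by
    simp only [C0Sum.coord_smul, map_smul, MonoidHom.id_apply]
    exact (hβ.summable x).tsum_const_smul c
  map_zero' := by simp only [C0Sum.coord_zero, map_zero, tsum_zero]
  map_add' x y := by
    simp only [C0Sum.coord_add, map_add]
    exact (hβ.summable x).tsum_add (hβ.summable y)
  map_mul' x y := by
    rw [← (hβ.summable y).tsum_mul_left]
    simp only [hβ.tsum_mul, C0Sum.coord_mul]
  map_star' x := by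
    rw [tsum_star]
    simp only [C0Sum.coord_star, map_star]

theorem sumHom_apply (hβ : IsBlockDecomposition β) (x : C0Sum B) :
    hβ.sumHom x = ∑' i, β i (x.coord i) := rfl

theorem sumHom_single (hβ : IsBlockDecomposition β) (i : ι) (y : B i) :
    hβ.sumHom (C0Sum.single i y) = β i y := by
  rw [sumHom_apply, tsum_eq_single i, C0Sum.coord_single_same]
  intro j hj
  rw [C0Sum.coord_single_of_ne hj, map_zero]

/-- Multiplying ∑ β j (x j) = 0 by β i (x i)* isolates β i (x i (x i)*) = 0, and the C*-identity
gives x i = 0. -/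
theorem sumHom_injective (hβ : IsBlockDecomposition β) : Function.Injective hβ.sumHom := by
  refine (injective_iff_map_eq_zero hβ.sumHom).2 fun x hx => C0Sum.ext fun i => ?_
  have h := hβ.tsum_mul x i (star (x.coord i))
  rw [← hβ.sumHom_apply, hx, zero_mul, ← map_zero (β i)] at h
  exact CStarRing.mul_star_self_eq_zero_iff _ |>.1 (hβ.injective i h).symm

/-- An injective *-homomorphism of C*-algebras is isometric, so its range is closed; it contains the
blocks, whose span is dense. -/
theorem sumHom_surjective (hβ : IsBlockDecomposition β) : Function.Surjective hβ.sumHom := by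
  have hcl : IsClosed (Set.range hβ.sumHom) :=
    (NonUnitalStarAlgHom.isometry hβ.sumHom hβ.sumHom_injective).isClosedEmbedding.isClosed_range
  intro t
  induction t using hβ.induction_on with
  | hc => exact hcl
  | h0 => exact ⟨0, map_zero _⟩
  | hb i x => exact ⟨_, hβ.sumHom_single i x⟩
  | ha s t hs ht =>
    obtain ⟨x, rfl⟩ := hs
    obtain ⟨y, rfl⟩ := ht
    exact ⟨x + y, map_add _ _ _⟩

/-- The isomorphism of the direct sum of the C*-algebras `B i` with `C`. -/
def equiv (hβ : IsBlockDecomposition β) : C0Sum B ≃⋆ₐ[ℂ] C :=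
  StarAlgEquiv.ofBijective hβ.sumHom ⟨hβ.sumHom_injective, hβ.sumHom_surjective⟩

theorem equiv_single (hβ : IsBlockDecomposition β) (i : ι) (y : B i) :
    hβ.equiv (C0Sum.single i y) = β i y := hβ.sumHom_single i y

theorem equiv_symm_apply (hβ : IsBlockDecomposition β) (i : ι) (y : B i) :
    hβ.equiv.symm (β i y) = C0Sum.single i y := by
  rw [← hβ.equiv_single, StarAlgEquiv.symm_apply_apply]

/-- The component of an element of `C` in the block `B i`. -/
def component (hβ : IsBlockDecomposition β) (i : ι) : C →⋆ₙₐ[ℂ] B i :=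
  (C0Sum.proj i).comp hβ.equiv.symm.toNonUnitalStarAlgHom

theorem component_apply (hβ : IsBlockDecomposition β) (i : ι) (t : C) :
    hβ.component i t = (hβ.equiv.symm t).coord i := rfl

theorem component_same (hβ : IsBlockDecomposition β) (i : ι) (y : B i) :
    hβ.component i (β i y) = y := by
  rw [component_apply, equiv_symm_apply, C0Sum.coord_single_same]

/-- Each block is an ideal of C, as is seen in the isomorphic direct sum. -/
theorem mul_apply (hβ : IsBlockDecomposition β) (t : C) (i : ι) (y : B i) :
    t * β i y = β i (hβ.component i t * y) := by
  apply EquivLike.injective hβ.equiv.symm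
  rw [map_mul, equiv_symm_apply, equiv_symm_apply, C0Sum.mul_single, component_apply]

/-- A block decomposition can be reindexed and composed with isomorphisms of the blocks. -/
theorem reindex (hβ : IsBlockDecomposition β) {κ : Type*} {D : κ → Type*}
    [∀ k, NonUnitalCStarAlgebra (D k)] (e : κ ≃ ι) (θ : ∀ k, D k →⋆ₙₐ[ℂ] B (e k))
    (hθ : ∀ k, Function.Bijective (θ k)) :
    IsBlockDecomposition (B := D) fun k => (β (e k)).comp (θ k) where
  orthogonal _ _ h _ _ := hβ.orthogonal _ _ (e.injective.ne h) _ _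
  injective k := (hβ.injective _).comp (hθ k).1
  dense := by
    refine hβ.dense.mono (Submodule.span_mono ?_)
    rintro _ ⟨i, x, rfl⟩
    obtain ⟨k, rfl⟩ := e.surjective i
    obtain ⟨y, rfl⟩ := (hθ k).2 x
    exact ⟨k, y, rfl⟩

end IsBlockDecomposition

theorem C0Sum.isBlockDecomposition_single {ι : Type*} (A : ι → Type*)
    [∀ i, NonUnitalCStarAlgebra (A i)] :
    IsBlockDecomposition fun i => C0Sum.single (A := A) i where
  orthogonal _ _ h := C0Sum.single_mul_single_of_ne h
  injective := C0Sum.single_injective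
  dense x := by
    induction x using C0Sum.induction_on with
    | hc => exact isClosed_closure
    | h0 => exact subset_closure (zero_mem _)
    | hs i a => exact subset_closure (Submodule.subset_span ⟨i, a, rfl⟩)
    | ha x y hx hy => exact (Submodule.span ℂ _).topologicalClosure.add_mem hx hy

end BlockDecomposition

/-! ### Multipliers of a direct sum of unital blocks. -/

noncomputable section Multipliers

open Filter Topology

section DoubleCentralizer

variable {C : Type*} [NonUnitalCStarAlgebra C]

/-- The choice s = (x - y)* and the C*-identity suffice; no unit is needed. -/
theorem CStarRing.eq_of_mul_left_eq {x y : C} (h : ∀ s, s * x = s * y) : x = y := by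
  rw [← sub_eq_zero, ← CStarRing.star_mul_self_eq_zero_iff, mul_sub, h, sub_self]

theorem CStarRing.eq_of_mul_right_eq {x y : C} (h : ∀ s, x * s = y * s) : x = y := by
  rw [← sub_eq_zero, ← CStarRing.mul_star_self_eq_zero_iff, sub_mul, h, sub_self]

namespace DoubleCentralizer

/-- The module property follows from centrality alone: multiplied by s on the left, both sides
become (s m) x y. -/
theorem fst_mul (m : 𝓜(ℂ, C)) (x y : C) : m.fst (x * y) = m.fst x * y :=
  CStarRing.eq_of_mul_left_eq fun s => by
    rw [← m.central, ← mul_assoc, ← mul_assoc, ← m.central]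

/-- The norm of a double centralizer equals the norm of its left action, so the left action
determines it. -/
theorem eq_of_fst {m m' : 𝓜(ℂ, C)} (h : ∀ t, m.fst t = m'.fst t) : m = m' := by
  rw [← sub_eq_zero, ← norm_eq_zero, ← norm_fst, sub_fst, norm_eq_zero, sub_eq_zero]
  exact ContinuousLinearMap.ext h

theorem norm_coe (t : C) : ‖(t : 𝓜(ℂ, C))‖ = ‖t‖ := by
  rw [← norm_fst, coe_fst]
  exact ContinuousLinearMap.opNorm_mul_apply ℂ C t

theorem coe_add (s t : C) : ((s + t : C) : 𝓜(ℂ, C)) = (s : 𝓜(ℂ, C)) + (t : 𝓜(ℂ, C)) :=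
  map_add (coeHom : C →⋆ₙₐ[ℂ] 𝓜(ℂ, C)) s t

theorem coe_zero : ((0 : C) : 𝓜(ℂ, C)) = 0 := map_zero (coeHom : C →⋆ₙₐ[ℂ] 𝓜(ℂ, C))

theorem coe_star (t : C) : ((star t : C) : 𝓜(ℂ, C)) = star (t : 𝓜(ℂ, C)) :=
  map_star (coeHom : C →⋆ₙₐ[ℂ] 𝓜(ℂ, C)) t

theorem coe_fst_apply (s t : C) : (s : 𝓜(ℂ, C)).fst t = s * t := rfl

theorem mul_fst_apply (m m' : 𝓜(ℂ, C)) (t : C) : (m * m').fst t = m.fst (m'.fst t) := rfl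

/-- The embedding of C in its multiplier algebra is isometric and C is complete. This lets
properness be checked on a dense set of elements. -/
theorem isClosed_range_coe : IsClosed {m : 𝓜(ℂ, C) | ∃ t : C, m = (t : 𝓜(ℂ, C))} := by
  have h : Isometry (coeHom : C →⋆ₙₐ[ℂ] 𝓜(ℂ, C)) := AddMonoidHomClass.isometry_of_norm _ norm_coe
  convert h.isClosedEmbedding.isClosed_range using 1
  ext m
  exact exists_congr fun t => eq_comm

end DoubleCentralizer

end DoubleCentralizer

open DoubleCentralizer

namespace IsBlockDecomposition

variable {ι : Type*} {B : ι → Type*} [∀ i, CStarAlgebra (B i)]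
  {C : Type*} [NonUnitalCStarAlgebra C] {β : ∀ i, B i →⋆ₙₐ[ℂ] C}

/-- The component of a multiplier of `C` in the block `B i`, as a function. -/
def coeffFun (hβ : IsBlockDecomposition β) (i : ι) (m : 𝓜(ℂ, C)) : B i :=
  hβ.component i (m.fst (β i 1))

/-- Here the unit of the block enters: y = 1 · y and the module property reduce m on the whole block
to the single element m β i (1), and multiplication of that element by β i (y) only sees its i-th
component. -/
theorem fst_apply' (hβ : IsBlockDecomposition β) (m : 𝓜(ℂ, C)) (i : ι) (y : B i) :
    m.fst (β i y) = β i (hβ.coeffFun i m * y) := by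
  conv_lhs => rw [← one_mul y, map_mul, fst_mul]
  exact hβ.mul_apply _ _ _

theorem coeffFun_eq (hβ : IsBlockDecomposition β) {m : 𝓜(ℂ, C)} {i : ι} {z : B i}
    (h : ∀ y, m.fst (β i y) = β i (z * y)) : hβ.coeffFun i m = z := by
  have h1 := (hβ.fst_apply' m i 1).symm.trans (h 1)
  rw [mul_one, mul_one] at h1
  exact hβ.injective i h1

/-- Centrality transfers the formula for the left action to the right action. Tested against an
element of another block, both sides vanish by orthogonality. -/
theorem snd_apply' (hβ : IsBlockDecomposition β) (m : 𝓜(ℂ, C)) (i : ι) (y : B i) :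
    m.snd (β i y) = β i (y * hβ.coeffFun i m) :=
  CStarRing.eq_of_mul_right_eq fun t => by
    induction t using hβ.induction_on with
    | hc =>
      exact isClosed_eq (continuous_const_mul (m.snd (β i y)))
        (continuous_const_mul (β i (y * hβ.coeffFun i m)))
    | h0 => rw [mul_zero, mul_zero]
    | ha s t hs ht => rw [mul_add, mul_add, hs, ht]
    | hb j z =>
      rw [m.central, hβ.fst_apply']
      by_cases h : i = j
      · subst h
        rw [← map_mul, ← map_mul, mul_assoc]
      · rw [hβ.orthogonal i j h, hβ.orthogonal i j h]

/-- The component of a multiplier of `C` in the block `B i`. -/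
def coeff (hβ : IsBlockDecomposition β) (i : ι) : 𝓜(ℂ, C) →⋆ₐ[ℂ] B i where
  toFun := hβ.coeffFun i
  map_one' := hβ.coeffFun_eq fun y => by rw [one_mul]; rfl
  map_mul' m m' := hβ.coeffFun_eq fun y => by
    rw [mul_fst_apply, hβ.fst_apply', hβ.fst_apply', mul_assoc]
  map_zero' := hβ.coeffFun_eq fun y => by rw [zero_mul, map_zero]; rfl
  map_add' m m' := hβ.coeffFun_eq fun y => by
    rw [add_mul, map_add, ← hβ.fst_apply', ← hβ.fst_apply']; rfl
  commutes' c := hβ.coeffFun_eq fun y => by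
    rw [algebraMap_fst, ← Algebra.smul_def, map_smul, Algebra.algebraMap_eq_smul_one]; rfl
  map_star' m := hβ.coeffFun_eq fun y => by
    rw [star_fst, ← map_star (β i), hβ.snd_apply', ← map_star, star_mul, star_star]

theorem fst_apply (hβ : IsBlockDecomposition β) (m : 𝓜(ℂ, C)) (i : ι) (y : B i) :
    m.fst (β i y) = β i (hβ.coeff i m * y) := hβ.fst_apply' m i y

theorem coeff_eq (hβ : IsBlockDecomposition β) {m : 𝓜(ℂ, C)} {i : ι} {z : B i}
    (h : ∀ y, m.fst (β i y) = β i (z * y)) : hβ.coeff i m = z := hβ.coeffFun_eq h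

/-- The components of Δ(x), 1 ⊗ x, x ⊗ 1 and x ⊗ y are all computed in this way, by applying the
multiplier to the unit of a block. -/
theorem coeff_eq_of_fst_one (hβ : IsBlockDecomposition β) {m : 𝓜(ℂ, C)} {i : ι} {z : B i}
    (h : m.fst (β i 1) = β i z) : hβ.coeff i m = z :=
  (congrArg (hβ.component i) h).trans (hβ.component_same i z)

theorem component_of_ne (hβ : IsBlockDecomposition β) {i j : ι} (h : j ≠ i) (y : B i) :
    hβ.component j (β i y) = 0 := by
  rw [component_apply, equiv_symm_apply, C0Sum.coord_single_of_ne h]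

theorem coeff_coe (hβ : IsBlockDecomposition β) (i : ι) (t : C) :
    hβ.coeff i (t : 𝓜(ℂ, C)) = hβ.component i t := hβ.coeff_eq fun y => hβ.mul_apply t i y

theorem multiplier_ext (hβ : IsBlockDecomposition β) {m m' : 𝓜(ℂ, C)}
    (h : ∀ i, hβ.coeff i m = hβ.coeff i m') : m = m' := eq_of_fst fun t => by
  induction t using hβ.induction_on with
  | hc => exact isClosed_eq m.fst.continuous m'.fst.continuous
  | h0 => rw [map_zero, map_zero]
  | hb i y => rw [hβ.fst_apply, hβ.fst_apply, h]
  | ha s t hs ht => rw [map_add, map_add, hs, ht]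

theorem tendsto_mul_coord {f : ∀ i, B i} {r : ℝ} (hf : ∀ i, ‖f i‖ ≤ r) (x : C0Sum B) :
    Tendsto (fun i => ‖f i * x.coord i‖) cofinite (𝓝 0) :=
  squeeze_zero (fun _ => norm_nonneg _)
    (fun i => (norm_mul_le _ _).trans (mul_le_mul_of_nonneg_right (hf i) (norm_nonneg _)))
    (by simpa using x.tendsto_norm_coord.const_mul r)

theorem tendsto_coord_mul {f : ∀ i, B i} {r : ℝ} (hf : ∀ i, ‖f i‖ ≤ r) (x : C0Sum B) :
    Tendsto (fun i => ‖x.coord i * f i‖) cofinite (𝓝 0) :=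
  squeeze_zero (fun _ => norm_nonneg _)
    (fun i => (norm_mul_le _ _).trans (mul_le_mul_of_nonneg_left (hf i) (norm_nonneg _)))
    (by simpa using x.tendsto_norm_coord.mul_const r)

/-- The multiplier of `C` defined by a bounded family of elements of the blocks. -/
def diagonal (hβ : IsBlockDecomposition β) (f : ∀ i, B i) (r : ℝ) (hr : 0 ≤ r)
    (hf : ∀ i, ‖f i‖ ≤ r) : 𝓜(ℂ, C) where
  fst := LinearMap.mkContinuous
    { toFun := fun t => hβ.equiv (C0Sum.mk _ (tendsto_mul_coord hf (hβ.equiv.symm t)))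
      map_add' := fun s t => by
        rw [← map_add]
        refine congrArg hβ.equiv (C0Sum.ext fun i => ?_)
        rw [C0Sum.coord_add, C0Sum.coord_mk, C0Sum.coord_mk, C0Sum.coord_mk, map_add,
          C0Sum.coord_add, mul_add]
      map_smul' := fun c t => by
        rw [RingHom.id_apply, ← map_smul hβ.equiv]
        refine congrArg hβ.equiv (C0Sum.ext fun i => ?_)
        rw [C0Sum.coord_smul, C0Sum.coord_mk, C0Sum.coord_mk, map_smul, C0Sum.coord_smul,
          mul_smul_comm] } r fun t => by
      refine (NonUnitalStarAlgHom.norm_apply_le hβ.equiv _).trans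
        (C0Sum.norm_le (by positivity) fun i => ?_)
      refine (norm_mul_le _ _).trans (mul_le_mul (hf i) ?_ (norm_nonneg _) hr)
      exact (C0Sum.norm_coord_le _ i).trans (NonUnitalStarAlgHom.norm_apply_le hβ.equiv.symm t)
  snd := LinearMap.mkContinuous
    { toFun := fun t => hβ.equiv (C0Sum.mk _ (tendsto_coord_mul hf (hβ.equiv.symm t)))
      map_add' := fun s t => by
        rw [← map_add]
        refine congrArg hβ.equiv (C0Sum.ext fun i => ?_)
        rw [C0Sum.coord_add, C0Sum.coord_mk, C0Sum.coord_mk, C0Sum.coord_mk, map_add,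
          C0Sum.coord_add, add_mul]
      map_smul' := fun c t => by
        rw [RingHom.id_apply, ← map_smul hβ.equiv]
        refine congrArg hβ.equiv (C0Sum.ext fun i => ?_)
        rw [C0Sum.coord_smul, C0Sum.coord_mk, C0Sum.coord_mk, map_smul, C0Sum.coord_smul,
          smul_mul_assoc] } r fun t => by
      refine (NonUnitalStarAlgHom.norm_apply_le hβ.equiv _).trans
        (C0Sum.norm_le (by positivity) fun i => ?_)
      rw [C0Sum.coord_mk, mul_comm r]
      refine (norm_mul_le _ _).trans (mul_le_mul ?_ (hf i) (norm_nonneg _) (norm_nonneg _))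
      exact (C0Sum.norm_coord_le _ i).trans (NonUnitalStarAlgHom.norm_apply_le hβ.equiv.symm t)
  central := fun s t => by
    apply EquivLike.injective hβ.equiv.symm
    change hβ.equiv.symm (hβ.equiv _ * t) = hβ.equiv.symm (s * hβ.equiv _)
    rw [map_mul hβ.equiv.symm, map_mul hβ.equiv.symm, StarAlgEquiv.symm_apply_apply,
      StarAlgEquiv.symm_apply_apply]
    exact C0Sum.ext fun i => mul_assoc _ _ _

theorem coeff_diagonal (hβ : IsBlockDecomposition β) (f : ∀ i, B i) (r : ℝ) (hr : 0 ≤ r)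
    (hf : ∀ i, ‖f i‖ ≤ r) (i : ι) : hβ.coeff i (hβ.diagonal f r hr hf) = f i :=
  hβ.coeff_eq fun y => by
    change hβ.equiv _ = _
    refine Eq.trans (congrArg hβ.equiv (C0Sum.ext fun j => ?_)) (hβ.equiv_single i (f i * y))
    rw [C0Sum.coord_mk, equiv_symm_apply]
    by_cases h : j = i
    · subst h; rw [C0Sum.coord_single_same, C0Sum.coord_single_same]
    · rw [C0Sum.coord_single_of_ne h, C0Sum.coord_single_of_ne h, mul_zero]

/-- The `*`-homomorphism to the multiplier algebra of `C` with given components. -/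
def diagonalHom (hβ : IsBlockDecomposition β) {R : Type*} [CStarAlgebra R]
    (Θ : ∀ i, R →⋆ₐ[ℂ] B i) : R →⋆ₐ[ℂ] 𝓜(ℂ, C) where
  -- Every `Θ i` is contractive, so ‖x‖ bounds the family uniformly in i.
  toFun x := hβ.diagonal (fun i => Θ i x) ‖x‖ (norm_nonneg x)
    fun i => NonUnitalStarAlgHom.norm_apply_le (Θ i) x
  map_one' := hβ.multiplier_ext fun i => by rw [coeff_diagonal, map_one, map_one]
  map_mul' x y := hβ.multiplier_ext fun i => by
    rw [map_mul, coeff_diagonal, coeff_diagonal, coeff_diagonal, map_mul]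
  map_zero' := hβ.multiplier_ext fun i => by rw [coeff_diagonal, map_zero, map_zero]
  map_add' x y := hβ.multiplier_ext fun i => by
    rw [map_add, coeff_diagonal, coeff_diagonal, coeff_diagonal, map_add]
  commutes' c := hβ.multiplier_ext fun i => by
    rw [coeff_diagonal, AlgHomClass.commutes, AlgHomClass.commutes]
  map_star' x := hβ.multiplier_ext fun i => by
    rw [map_star, coeff_diagonal, coeff_diagonal, map_star]

theorem coeff_diagonalHom (hβ : IsBlockDecomposition β) {R : Type*} [CStarAlgebra R]
    (Θ : ∀ i, R →⋆ₐ[ℂ] B i) (x : R) (i : ι) : hβ.coeff i (hβ.diagonalHom Θ x) = Θ i x :=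
  hβ.coeff_diagonal _ ‖x‖ (norm_nonneg x) (fun i => NonUnitalStarAlgHom.norm_apply_le (Θ i) x) i

/-- The map of multiplier algebras `(m i) ↦ (θ k (m (e k)))`, where `m i` are the components of a
multiplier `m`. -/
def pullback (hβ : IsBlockDecomposition β) {κ : Type*} {D : κ → Type*} [∀ k, CStarAlgebra (D k)]
    {E : Type*} [NonUnitalCStarAlgebra E] {γ : ∀ k, D k →⋆ₙₐ[ℂ] E} (hγ : IsBlockDecomposition γ)
    (e : κ → ι) (θ : ∀ k, B (e k) →⋆ₐ[ℂ] D k) : 𝓜(ℂ, C) →⋆ₐ[ℂ] 𝓜(ℂ, E) :=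
  hγ.diagonalHom fun k => (θ k).comp (hβ.coeff (e k))

section Pullback

variable (hβ : IsBlockDecomposition β) {κ : Type*} {D : κ → Type*} [∀ k, CStarAlgebra (D k)]
    {E : Type*} [NonUnitalCStarAlgebra E] {γ : ∀ k, D k →⋆ₙₐ[ℂ] E} (hγ : IsBlockDecomposition γ)
    (e : κ → ι) (θ : ∀ k, B (e k) →⋆ₐ[ℂ] D k)

theorem coeff_pullback (m : 𝓜(ℂ, C)) (k : κ) :
    hγ.coeff k (hβ.pullback hγ e θ m) = θ k (hβ.coeff (e k) m) :=
  hγ.coeff_diagonalHom _ m k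

theorem pullback_fst (m : 𝓜(ℂ, C)) (k : κ) (y : D k) :
    (hβ.pullback hγ e θ m).fst (γ k y) = γ k (θ k (hβ.coeff (e k) m) * y) := by
  rw [hγ.fst_apply, coeff_pullback]

/-- Since θ k is unital, the image of β (e k) (1) acts as the identity on the k-th block. Every
block element thus has the required form F(a) b, and the blocks span a dense subspace. -/
theorem pullback_nondegenerate : IsNondegenerateExtension (hβ.pullback hγ e θ) := by
  refine hγ.dense.mono (Submodule.span_mono ?_)
  rintro _ ⟨k, y, rfl⟩
  refine ⟨β (e k) 1, γ k y, ?_⟩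
  rw [pullback_fst, coeff_coe, component_same, map_one, one_mul]

end Pullback

end IsBlockDecomposition

end Multipliers

/-! ### Homomorphisms, reindexings and positive functionals of UHF algebras. -/

noncomputable section UHFMaps

open UHFIndex UHFMatrix Filter Topology

/-- Closedness in each variable separately is enough, and two matrices from different levels are
moved to the common level max n m. -/
theorem UHF.induction_on₂' {a b : ℕ → ℕ} [PosSeq a] [PosSeq b] {P : UHF a → UHF b → Prop}
    (hc₁ : ∀ y, IsClosed {x | P x y}) (hc₂ : ∀ x, IsClosed {y | P x y})
    (h : ∀ n M N, P (UHF.ofMatrix a n M) (UHF.ofMatrix b n N)) (x : UHF a) (y : UHF b) :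
    P x y := by
  induction x using UHF.induction_on with
  | hc => exact hc₁ y
  | h n M =>
    induction y using UHF.induction_on with
    | hc => exact hc₂ _
    | h m N =>
      rw [← UHF.ofMatrix_uhfEmbed a (le_max_left n m), ← UHF.ofMatrix_uhfEmbed b (le_max_right n m)]
      exact h _ _ _

theorem UHF.induction_on₃ {a b c : ℕ → ℕ} [PosSeq a] [PosSeq b] [PosSeq c]
    {P : UHF a → UHF b → UHF c → Prop}
    (hc₁ : ∀ y z, IsClosed {x | P x y z}) (hc₂ : ∀ x z, IsClosed {y | P x y z})
    (hc₃ : ∀ x y, IsClosed {z | P x y z})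
    (h : ∀ n M N O, P (UHF.ofMatrix a n M) (UHF.ofMatrix b n N) (UHF.ofMatrix c n O))
    (x : UHF a) (y : UHF b) (z : UHF c) : P x y z := by
  induction x, y using UHF.induction_on₂' with
  | hc₁ y => exact hc₁ y z
  | hc₂ x => exact hc₂ x z
  | h n M N =>
    induction z using UHF.induction_on with
    | hc => exact hc₃ _ _
    | h m O =>
      rw [← UHF.ofMatrix_uhfEmbed a (le_max_left n m), ← UHF.ofMatrix_uhfEmbed b (le_max_left n m),
        ← UHF.ofMatrix_uhfEmbed c (le_max_right n m)]
      exact h _ _ _ _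

section Injective

variable {a : ℕ → ℕ} {C : Type*} [NonUnitalCStarAlgebra C]

/-- Compression by matrix units isolates one entry, so a homomorphism that kills M kills every
M_{J,K} E_{J,J}. -/
theorem UHFMatrix.unit_mul_mul_unit {n : ℕ} (M : UHFMatrix a n) (J K : UHFIndex a n) :
    unit J J * M * unit K J = M.entry J K • unit J J := UHFMatrix.ext fun P Q => by
  rw [entry_mul, entry_smul, Finset.sum_eq_single K, entry_mul, Finset.sum_eq_single J]
  · by_cases h1 : P = J <;> by_cases h2 : Q = J <;> simp [entry_unit, h1, h2]
  · intro L _ hL; simp [entry_unit, hL]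
  · exact fun h => absurd (Finset.mem_univ _) h
  · intro L _ hL; simp [entry_unit, hL]
  · exact fun h => absurd (Finset.mem_univ _) h

/-- If no diagonal matrix unit is killed, g is injective on every matrix algebra by
`UHFMatrix.unit_mul_mul_unit`, hence isometric there. The isometry passes to the completion, whereas
injectivity on a dense subalgebra alone would not. -/
theorem UHF.injective_of_ne_zero [PosSeq a] (g : UHF a →⋆ₙₐ[ℂ] C)
    (hg : ∀ n J, g (UHF.ofMatrix a n (unit J J)) ≠ 0) : Function.Injective g := by
  have h1 : ∀ n, Function.Injective (g.comp (UHF.ofMatrix a n : UHFMatrix a n →⋆ₙₐ[ℂ] UHF a)) := by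
    intro n
    refine (injective_iff_map_eq_zero _).2 fun M hM => UHFMatrix.ext fun J K => ?_
    have h2 := congrArg (g.comp (UHF.ofMatrix a n : UHFMatrix a n →⋆ₙₐ[ℂ] UHF a))
      (unit_mul_mul_unit M J K)
    rw [map_mul, map_mul, hM, mul_zero, zero_mul, map_smul] at h2
    exact (smul_eq_zero.1 h2.symm).resolve_right (hg n J)
  have h2 : ∀ x, ‖g x‖ = ‖x‖ := fun x => by
    induction x using UHF.induction_on with
    | hc => exact isClosed_eq (continuous_starAlgHom g).norm continuous_norm
    | h n M =>
      rw [UHF.norm_ofMatrix]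
      exact NonUnitalStarAlgHom.norm_map _ (h1 n) M
  exact (AddMonoidHomClass.isometry_of_norm g h2).injective

end Injective

/-! ### Isomorphisms of UHF algebras that permute or rename the indices. -/

section Reindex

variable {a a' : ℕ → ℕ}

/-- The bijection of multi-indices defined by bijections of the ranges of the entries. -/
def UHFIndex.map (τ : ∀ j, Fin (a j) ≃ Fin (a' j)) (n : ℕ) : UHFIndex a n ≃ UHFIndex a' n :=
  Equiv.piCongrRight fun j : Fin n => τ j

theorem UHFIndex.map_symm_apply (τ : ∀ j, Fin (a j) ≃ Fin (a' j)) (n : ℕ) (J : UHFIndex a' n)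
    (j : Fin n) : (UHFIndex.map τ n).symm J j = (τ j).symm (J j) := rfl

/-- The isomorphism of matrix algebras defined by a bijection of the index sets. -/
def UHFMatrix.reindex (τ : ∀ j, Fin (a j) ≃ Fin (a' j)) (n : ℕ) :
    UHFMatrix a n →⋆ₙₐ[ℂ] UHFMatrix a' n where
  toFun M := UHFMatrix.of fun J K =>
    M.entry ((UHFIndex.map τ n).symm J) ((UHFIndex.map τ n).symm K)
  map_smul' _ _ := rfl
  map_zero' := rfl
  map_add' _ _ := rfl
  map_mul' M N := UHFMatrix.ext fun J K => by
    rw [entry_mul, entry_of, entry_mul]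
    exact ((UHFIndex.map τ n).symm.sum_comp _).symm
  map_star' _ := rfl

theorem UHFMatrix.entry_reindex (τ : ∀ j, Fin (a j) ≃ Fin (a' j)) (n : ℕ) (M : UHFMatrix a n)
    (J K : UHFIndex a' n) : (UHFMatrix.reindex τ n M).entry J K =
      M.entry ((UHFIndex.map τ n).symm J) ((UHFIndex.map τ n).symm K) := rfl

theorem UHFMatrix.reindex_one (τ : ∀ j, Fin (a j) ≃ Fin (a' j)) (n : ℕ) :
    UHFMatrix.reindex τ n 1 = 1 := UHFMatrix.ext fun J K => by
  rw [entry_reindex, entry_one, entry_one]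
  simp only [EmbeddingLike.apply_eq_iff_eq]

theorem UHFMatrix.reindex_uhfEmbed (τ : ∀ j, Fin (a j) ≃ Fin (a' j)) (n m : ℕ) (h : n ≤ m)
    (M : UHFMatrix a n) : UHFMatrix.reindex τ m (uhfEmbed a n m h M) =
      uhfEmbed a' n m h (UHFMatrix.reindex τ n M) := UHFMatrix.ext fun J K => by
  rw [entry_reindex, entry_uhfEmbed, entry_uhfEmbed, entry_reindex]
  refine if_congr ?_ rfl rfl
  exact forall₂_congr fun j _ => (τ j).symm.apply_eq_iff_eq

variable [PosSeq a] [PosSeq a']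

/-- The isomorphism `A(a) → A(a')` defined by bijections of the index sets, as a map. -/
def UHF.reindexHom (τ : ∀ j, Fin (a j) ≃ Fin (a' j)) : UHF a →⋆ₙₐ[ℂ] UHF a' :=
  UHF.lift (fun n => (UHF.ofMatrix a' n : UHFMatrix a' n →⋆ₙₐ[ℂ] UHF a').comp
    (UHFMatrix.reindex τ n)) fun n m h M =>
      (congrArg (UHF.ofMatrix a' m) (reindex_uhfEmbed τ n m h M)).trans
        (UHF.ofMatrix_uhfEmbed a' h _)

theorem UHF.reindexHom_ofMatrix (τ : ∀ j, Fin (a j) ≃ Fin (a' j)) (n : ℕ) (M : UHFMatrix a n) :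
    UHF.reindexHom τ (UHF.ofMatrix a n M) = UHF.ofMatrix a' n (UHFMatrix.reindex τ n M) :=
  UHF.lift_ofMatrix _ _ n M

theorem UHF.reindexHom_one (τ : ∀ j, Fin (a j) ≃ Fin (a' j)) : UHF.reindexHom τ 1 = 1 := by
  rw [← map_one (UHF.ofMatrix a 0), UHF.reindexHom_ofMatrix, reindex_one, map_one]

/-- The isomorphism `A(a) → A(a')` defined by bijections of the index sets. -/
def UHF.reindex (τ : ∀ j, Fin (a j) ≃ Fin (a' j)) : UHF a →⋆ₐ[ℂ] UHF a' where
  __ := UHF.reindexHom τ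
  map_one' := UHF.reindexHom_one τ
  commutes' c := by
    change UHF.reindexHom τ (algebraMap ℂ _ c) = _
    rw [Algebra.algebraMap_eq_smul_one, map_smul, UHF.reindexHom_one,
      Algebra.algebraMap_eq_smul_one]

theorem UHF.reindex_ofMatrix (τ : ∀ j, Fin (a j) ≃ Fin (a' j)) (n : ℕ) (M : UHFMatrix a n) :
    UHF.reindex τ (UHF.ofMatrix a n M) = UHF.ofMatrix a' n (UHFMatrix.reindex τ n M) :=
  UHF.reindexHom_ofMatrix τ n M

theorem UHF.continuous_reindex (τ : ∀ j, Fin (a j) ≃ Fin (a' j)) : Continuous (UHF.reindex τ) :=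
  continuous_starAlgHom (UHF.reindexHom τ)

theorem UHF.reindex_symm_reindex (τ : ∀ j, Fin (a j) ≃ Fin (a' j)) (x : UHF a) :
    UHF.reindex (fun j => (τ j).symm) (UHF.reindex τ x) = x := by
  induction x using UHF.induction_on with
  | hc =>
    exact isClosed_eq ((UHF.continuous_reindex _).comp (UHF.continuous_reindex τ)) continuous_id
  | h n M =>
    rw [UHF.reindex_ofMatrix, UHF.reindex_ofMatrix]
    refine congrArg _ (UHFMatrix.ext fun J K => ?_)
    rw [entry_reindex, entry_reindex]
    congr 1 <;> funext j <;> simp [UHFIndex.map_symm_apply]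

theorem UHF.reindex_bijective (τ : ∀ j, Fin (a j) ≃ Fin (a' j)) :
    Function.Bijective (UHF.reindex τ) :=
  Function.bijective_iff_has_inverse.2 ⟨UHF.reindex fun j => (τ j).symm,
    UHF.reindex_symm_reindex τ, UHF.reindex_symm_reindex fun j => (τ j).symm⟩

/-- The identity map between `A(a)` and `A(a')` for equal sequences `a` and `a'`. -/
def UHF.cast (h : a = a') : UHF a →⋆ₐ[ℂ] UHF a' := UHF.reindex fun j => finCongr (congrFun h j)

theorem UHF.cast_rfl (x : UHF a) : UHF.cast rfl x = x := by
  induction x using UHF.induction_on with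
  | hc => exact isClosed_eq (UHF.continuous_reindex _) continuous_id
  | h n M => exact UHF.reindex_ofMatrix _ n M

end Reindex

/-! ### Positive functionals that do not vanish at given projections. -/

section VectorFunctional

attribute [local instance] CStarAlgebra.spectralOrder CStarAlgebra.spectralOrderedRing

variable {a : ℕ → ℕ} [PosSeq a]

/-- The multi-index formed by the first `n` entries of a sequence. -/
def UHFIndex.ofSeq (J : ∀ j, Fin (a j)) (n : ℕ) : UHFIndex a n := fun j => J j

/-- This compatibility makes the diagonal entry along an infinite sequence well defined on the
direct limit. -/
theorem UHFMatrix.entry_uhfEmbed_ofSeq {a : ℕ → ℕ} (J : ∀ j, Fin (a j)) (n m : ℕ) (h : n ≤ m)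
    (M : UHFMatrix a n) : (uhfEmbed a n m h M).entry (ofSeq J m) (ofSeq J m) =
      M.entry (ofSeq J n) (ofSeq J n) := by
  rw [entry_uhfEmbed, if_pos (SameTail.refl _)]; rfl

/-- The diagonal matrix entry at the first entries of a sequence, as a functional on the union of
the matrix algebras. -/
def PreUHF.diagEntry (J : ∀ j, Fin (a j)) : PreUHF a →L[ℂ] ℂ :=
  LinearMap.mkContinuous
    { toFun := DirectLimit.lift (uhfEmbed a)
        (fun n M => UHFMatrix.entry M (ofSeq J n) (ofSeq J n))
        (fun n m h M => (entry_uhfEmbed_ofSeq J n m h M).symm)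
      map_add' := PreUHF.induction₂ fun n M N => by rw [← map_add]; rfl
      map_smul' := fun c => PreUHF.induction fun n M => by rw [← map_smul]; rfl } 1
    (PreUHF.induction fun n M => by
      rw [one_mul]
      exact CStarMatrix.norm_entry_le_norm (M := M))

/-- The pure state of `A(a)` given by the diagonal matrix entry at the first entries of a
sequence. -/
def UHF.diagEntry (J : ∀ j, Fin (a j)) : UHF a →L[ℂ] ℂ :=
  (PreUHF.diagEntry J).extend (UniformSpace.Completion.toComplL : PreUHF a →L[ℂ] _)

theorem UHF.diagEntry_ofMatrix (J : ∀ j, Fin (a j)) (n : ℕ) (M : UHFMatrix a n) :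
    UHF.diagEntry J (UHF.ofMatrix a n M) = M.entry (ofSeq J n) (ofSeq J n) :=
  ContinuousLinearMap.extend_eq (f := PreUHF.diagEntry J)
    (e := (UniformSpace.Completion.toComplL : PreUHF a →L[ℂ] _))
    UniformSpace.Completion.denseRange_coe
    (UniformSpace.Completion.isUniformInducing_coe _) (PreUHF.ofMatrix a n M)

/-- On matrices the diagonal entry of x*x at J is ∑ |x_{L,J}|², summed over L; the general case
follows by continuity. -/
theorem UHF.diagEntry_nonneg (J : ∀ j, Fin (a j)) (x : UHF a) :
    0 ≤ UHF.diagEntry J (star x * x) := by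
  induction x using UHF.induction_on with
  | hc =>
    exact isClosed_Ici.preimage
      ((UHF.diagEntry J).continuous.comp (continuous_star.mul continuous_id))
  | h n M =>
    rw [← map_star, ← map_mul, UHF.diagEntry_ofMatrix, entry_mul]
    refine Finset.sum_nonneg fun L _ => ?_
    rw [entry_star]
    exact star_mul_self_nonneg _

/-- A positive functional on a C*-algebra from a linear functional that is nonnegative on the
elements `x* x`. -/
def PosFunctional.ofLinear {A : Type*} [NonUnitalCStarAlgebra A] (f : A →ₗ[ℂ] ℂ)
    (hf : ∀ x, 0 ≤ f (star x * x)) : PosFunctional A :=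
  PositiveLinearMap.mk₀ f fun x hx => by
    obtain ⟨y, rfl⟩ := CStarAlgebra.nonneg_iff_eq_star_mul_self.1 hx
    exact hf y

/-- There is a positive functional that does not vanish at `x`. -/
def IsSupported {A : Type*} [NonUnitalCStarAlgebra A] (x : A) : Prop :=
  ∃ f : PosFunctional A, f x ≠ 0

theorem IsSupported.ne_zero {A : Type*} [NonUnitalCStarAlgebra A] {x : A} (h : IsSupported x) :
    x ≠ 0 := by
  rintro rfl
  obtain ⟨f, hf⟩ := h
  exact hf (map_zero f)

theorem IsSupported.of_map {A B : Type*} [NonUnitalCStarAlgebra A] [NonUnitalCStarAlgebra B]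
    (φ : A →⋆ₙₐ[ℂ] B) {x : A} (h : IsSupported (φ x)) : IsSupported x := by
  obtain ⟨f, hf⟩ := h
  refine ⟨PosFunctional.ofLinear (f.toLinearMap ∘ₗ (φ : A →ₗ[ℂ] B)) fun x => ?_, hf⟩
  change 0 ≤ f (φ (star x * x))
  rw [map_mul, map_star]
  exact f.map_nonneg (star_mul_self_nonneg _)

theorem UHF.isSupported_unit (n : ℕ) (P : UHFIndex a n) :
    IsSupported (UHF.ofMatrix a n (unit P P)) := by
  -- The finite index P is continued by zeros. Any continuation would do, since the functional reads
  -- only the first n entries on the n-th matrix algebra.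
  let J : ∀ j, Fin (a j) := fun j =>
    if h : j < n then P ⟨j, h⟩ else ⟨0, PosSeq.pos j⟩
  have hJ : ofSeq J n = P := funext fun j => dif_pos j.2
  refine ⟨PosFunctional.ofLinear (UHF.diagEntry J : UHF a →ₗ[ℂ] ℂ) (UHF.diagEntry_nonneg J), ?_⟩
  change UHF.diagEntry J _ ≠ 0
  rw [UHF.diagEntry_ofMatrix, hJ, entry_unit, if_pos ⟨rfl, rfl⟩]
  exact one_ne_zero

/-- The class of p itself in the GNS space serves as the vector, so no unit and no cyclic vector are
needed: p acts on it by p · p = p, and its squared norm is f(p* p) = f(p). -/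
theorem PosFunctional.exists_vector {A : Type*} [NonUnitalCStarAlgebra A] (f : PosFunctional A)
    {p : A} (hp : IsStarProjection p) : ∃ u : f.Space, f.rep p u = u ∧ ⟪u, u⟫_ℂ = f p := by
  refine ⟨((f.toPreGNS p : f.PreGNS) : UniformSpace.Completion f.PreGNS), ?_, ?_⟩
  · refine (PositiveLinearMap.gnsNonUnitalStarAlgHom_apply_coe f).trans ?_
    rw [PositiveLinearMap.leftMulMapPreGNS_apply]
    simp [hp.isIdempotentElem.eq]
  · refine (UniformSpace.Completion.inner_coe _ _).trans ?_
    rw [PositiveLinearMap.preGNS_inner_def]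
    simp [hp.isIdempotentElem.eq, hp.isSelfAdjoint.star_eq]

variable {A B : Type*} [NonUnitalCStarAlgebra A] [NonUnitalCStarAlgebra B]

/-- The projection to one of the components of the algebra of families of operators. -/
def GNSTensorAlgebra.coordHom (p : PosFunctional A × PosFunctional B) :
    GNSTensorAlgebra A B →⋆ₙₐ[ℂ] GNSOp A B p where
  toFun x := x.coord p
  map_smul' c x := GNSTensorAlgebra.coord_smul c x p
  map_zero' := rfl
  map_add' x y := GNSTensorAlgebra.coord_add x y p
  map_mul' x y := GNSTensorAlgebra.coord_mul x y p
  map_star' x := GNSTensorAlgebra.coord_star x p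

/-- The identity map of the operators on `H_f ⊗ H_g`. -/
def GNSOp.toOperator (p : PosFunctional A × PosFunctional B) : GNSOp A B p →⋆ₙₐ[ℂ]
    (HilbertTensor p.1.Space p.2.Space →L[ℂ] HilbertTensor p.1.Space p.2.Space) :=
  NonUnitalStarAlgHom.id ℂ
    (HilbertTensor p.1.Space p.2.Space →L[ℂ] HilbertTensor p.1.Space p.2.Space)

/-- The action of the minimal tensor product on the Hilbert space `H_f ⊗ H_g`. -/
def MinTensor.rep (p : PosFunctional A × PosFunctional B) : MinTensor A B →⋆ₙₐ[ℂ]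
    (HilbertTensor p.1.Space p.2.Space →L[ℂ] HilbertTensor p.1.Space p.2.Space) :=
  (GNSOp.toOperator p).comp ((GNSTensorAlgebra.coordHom p).comp MinTensor.incl)

theorem MinTensor.rep_tmul (p : PosFunctional A × PosFunctional B) (a : A) (b : B) :
    MinTensor.rep p (MinTensor.tmul a b) = opTensor (p.1.rep a) (p.2.rep b) := rfl

/-- The positive functional `x ↦ ⟪w, ρ(x) w⟫` of a representation `ρ`. -/
def PosFunctional.ofVector {H : Type*} [NormedAddCommGroup H] [InnerProductSpace ℂ H]
    [CompleteSpace H] (ρ : A →⋆ₙₐ[ℂ] (H →L[ℂ] H)) (w : H) : PosFunctional A :=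
  PosFunctional.ofLinear
    { toFun := fun t => ⟪w, ρ t w⟫_ℂ
      map_add' := fun s t => by rw [map_add]; exact inner_add_right _ _ _
      map_smul' := fun c t => by rw [map_smul]; exact inner_smul_right _ _ _ } fun t => by
    change 0 ≤ ⟪w, ρ (star t * t) w⟫_ℂ
    rw [map_mul, map_star, _root_.mul_apply_eq_comp, ContinuousLinearMap.star_eq_adjoint,
      ContinuousLinearMap.adjoint_inner_right, inner_self_eq_norm_sq_to_K]
    exact pow_nonneg (Complex.zero_le_real.2 (norm_nonneg (ρ t w))) 2

theorem PosFunctional.ofVector_apply {H : Type*} [NormedAddCommGroup H] [InnerProductSpace ℂ H]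
    [CompleteSpace H] (ρ : A →⋆ₙₐ[ℂ] (H →L[ℂ] H)) (w : H) (x : A) :
    PosFunctional.ofVector ρ w x = ⟪w, ρ x w⟫_ℂ := rfl

/-- With the GNS vectors u and v of `PosFunctional.exists_vector`, the vector functional at u ⊗ v
takes the value ⟪u, u⟫ ⟪v, v⟫ = f(p) g(q) ≠ 0 at p ⊗ q. It is a positive functional on A ⊗ B, so the
result can be applied again with A ⊗ B as a factor. -/
theorem MinTensor.isSupported_tmul {p : A} {q : B} (hp : IsStarProjection p)
    (hq : IsStarProjection q) (hp' : IsSupported p) (hq' : IsSupported q) :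
    IsSupported (MinTensor.tmul p q) := by
  obtain ⟨r, hf, hg⟩ : ∃ r : PosFunctional A × PosFunctional B, r.1 p ≠ 0 ∧ r.2 q ≠ 0 :=
    ⟨(hp'.choose, hq'.choose), hp'.choose_spec, hq'.choose_spec⟩
  obtain ⟨u, hu, huu⟩ := r.1.exists_vector hp
  obtain ⟨v, hv, hvv⟩ := r.2.exists_vector hq
  refine ⟨PosFunctional.ofVector (MinTensor.rep r)
    ((u ⊗ₜ[ℂ] v : r.1.Space ⊗[ℂ] r.2.Space) : HilbertTensor r.1.Space r.2.Space), ?_⟩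
  rw [PosFunctional.ofVector_apply, MinTensor.rep_tmul, opTensor_tmul, hu, hv,
    UniformSpace.Completion.inner_coe, TensorProduct.inner_tmul, huu, hvv]
  exact mul_ne_zero hf hg

end VectorFunctional

end UHFMaps

/-! ### The Kronecker coproduct as an isomorphism, and tensor products of decompositions. -/

noncomputable section UHFDecompositions

open UHFIndex UHFMatrix Filter Topology

section Kron

variable {b c : ℕ → ℕ}

/-- The Kronecker product of matrices. -/
def UHFMatrix.kron {n : ℕ} (M : UHFMatrix b n) (N : UHFMatrix c n) : UHFMatrix (b * c) n :=
  UHFMatrix.of fun J K => M.entry (split b c n J).1 (split b c n K).1 *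
    N.entry (split b c n J).2 (split b c n K).2

theorem UHFMatrix.entry_kron {n : ℕ} (M : UHFMatrix b n) (N : UHFMatrix c n)
    (J K : UHFIndex (b * c) n) : (UHFMatrix.kron M N).entry J K =
      M.entry (split b c n J).1 (split b c n K).1 *
        N.entry (split b c n J).2 (split b c n K).2 := rfl

variable [PosSeq b] [PosSeq c] {X Y : Type*} [NonUnitalCStarAlgebra X]
  [NonUnitalCStarAlgebra Y] (f : UHF b →⋆ₙₐ[ℂ] X) (g : UHF c →⋆ₙₐ[ℂ] Y)

theorem kroneckerHom_ofMatrix (n : ℕ) (M : UHFMatrix (b * c) n) :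
    kroneckerHom f g (UHF.ofMatrix (b * c) n M) = ∑ J, ∑ K, M.entry J K • kroneckerUnit f g n J K :=
  UHF.lift_ofMatrix _ _ n M

theorem kroneckerHom_ofMatrix_kron (n : ℕ) (M : UHFMatrix b n) (N : UHFMatrix c n) :
    kroneckerHom f g (UHF.ofMatrix (b * c) n (UHFMatrix.kron M N)) =
      MinTensor.tmul (f (UHF.ofMatrix b n M)) (g (UHF.ofMatrix c n N)) :=
  (kroneckerHom_ofMatrix f g n _).trans (tmul_ofMatrix f g n M N).symm

/-- On a matrix algebra the value is a finite sum of elementary tensors of matrix units, with the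
scalars absorbed into the first factor; the rest is approximation. -/
theorem kroneckerHom_induction {P : MinTensor X Y → Prop} (hc : IsClosed {t | P t}) (h0 : P 0)
    (ht : ∀ x y, P (MinTensor.tmul (f x) (g y))) (ha : ∀ s t, P s → P t → P (s + t))
    (z : UHF (b * c)) : P (kroneckerHom f g z) := by
  induction z using UHF.induction_on with
  | hc => exact hc.preimage (continuous_starAlgHom (kroneckerHom f g))
  | h n M =>
    rw [kroneckerHom_ofMatrix]
    refine Finset.sum_induction _ P ha h0 fun J _ => Finset.sum_induction _ P ha h0 fun K _ => ?_
    unfold kroneckerUnit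
    rw [← MinTensor.smul_tmul, ← map_smul]
    exact ht _ _

/-- For matrices of a common level the elementary tensor is the image of their Kronecker product;
general x and y are approximated by such matrices. -/
theorem tmul_mem_range_closure (x : UHF b) (y : UHF c) :
    MinTensor.tmul (f x) (g y) ∈ closure (Set.range (kroneckerHom f g)) := by
  induction x, y using UHF.induction_on₂' with
  | hc₁ y =>
    exact isClosed_closure.preimage
      ((MinTensor.continuous_tmul_left (g y)).comp (continuous_starAlgHom f))
  | hc₂ x =>
    exact isClosed_closure.preimage
      ((MinTensor.continuous_tmul_right (f x)).comp (continuous_starAlgHom g))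
  | h n M N =>
    rw [← kroneckerHom_ofMatrix_kron]
    exact subset_closure ⟨_, rfl⟩

theorem UHF.isStarProjection_unit (n : ℕ) (P : UHFIndex b n) :
    IsStarProjection (UHF.ofMatrix b n (unit P P)) where
  isIdempotentElem := by
    change _ * _ = _
    rw [← map_mul, unit_mul_unit, if_pos rfl]
  isSelfAdjoint := by
    change star _ = _
    rw [← map_star, star_unit]

theorem IsStarProjection.apply {A B : Type*} [NonUnitalCStarAlgebra A] [NonUnitalCStarAlgebra B]
    {p : A} (hp : IsStarProjection p) (f : A →⋆ₙₐ[ℂ] B) : IsStarProjection (f p) where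
  isIdempotentElem := by
    change f p * f p = f p
    rw [← map_mul, hp.isIdempotentElem.eq]
  isSelfAdjoint := by
    change star (f p) = f p
    rw [← map_star, hp.isSelfAdjoint.star_eq]

/-- A diagonal matrix unit is sent to the tensor product of the images of two diagonal matrix units,
which are projections. -/
theorem isSupported_kroneckerHom (hf : ∀ n P, IsSupported (f (UHF.ofMatrix b n (unit P P))))
    (hg : ∀ n P, IsSupported (g (UHF.ofMatrix c n (unit P P)))) (n : ℕ)
    (P : UHFIndex (b * c) n) :
    IsSupported (kroneckerHom f g (UHF.ofMatrix (b * c) n (unit P P))) := by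
  rw [kroneckerHom_unit]
  exact MinTensor.isSupported_tmul ((UHF.isStarProjection_unit n _).apply f)
    ((UHF.isStarProjection_unit n _).apply g) (hf _ _) (hg _ _)

/-- Injectivity holds because the diagonal matrix units are not killed. The map is then isometric
with closed range, and the range contains the elementary tensors. -/
theorem kroneckerCoproduct_bijective (b c : ℕ → ℕ) [PosSeq b] [PosSeq c] :
    Function.Bijective (kroneckerCoproduct b c) := by
  have hinj : Function.Injective (kroneckerCoproduct b c) :=
    UHF.injective_of_ne_zero _ fun n P =>
      (isSupported_kroneckerHom _ _ UHF.isSupported_unit UHF.isSupported_unit n P).ne_zero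
  have hcl : IsClosed (Set.range (kroneckerCoproduct b c)) :=
    (NonUnitalStarAlgHom.isometry _ hinj).isClosedEmbedding.isClosed_range
  refine ⟨hinj, fun t => ?_⟩
  induction t using MinTensor.induction_on with
  | hc => exact hcl
  | h0 => exact ⟨0, map_zero _⟩
  | ht x y =>
    have h := tmul_mem_range_closure (NonUnitalStarAlgHom.id ℂ (UHF b))
      (NonUnitalStarAlgHom.id ℂ (UHF c)) x y
    change _ ∈ closure (Set.range (kroneckerCoproduct b c)) at h
    rwa [hcl.closure_eq] at h
  | ha s t hs ht =>
    obtain ⟨x, rfl⟩ := hs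
    obtain ⟨y, rfl⟩ := ht
    exact ⟨x + y, map_add _ _ _⟩

/-- The Kronecker coproduct as an isomorphism `A(b·c) ≃ A(b) ⊗ A(c)`. -/
def kroneckerEquiv (b c : ℕ → ℕ) [PosSeq b] [PosSeq c] :
    UHF (b * c) ≃⋆ₐ[ℂ] MinTensor (UHF b) (UHF c) :=
  StarAlgEquiv.ofBijective (kroneckerCoproduct b c) (kroneckerCoproduct_bijective b c)

/-- The Kronecker product `A(b) × A(c) → A(b·c)`. -/
def UHF.kron (x : UHF b) (y : UHF c) : UHF (b * c) :=
  (kroneckerEquiv b c).symm (MinTensor.tmul x y)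

theorem UHF.continuous_kron_left (y : UHF c) : Continuous fun x : UHF b => UHF.kron x y :=
  (continuous_starAlgHom (kroneckerEquiv b c).symm.toNonUnitalStarAlgHom).comp
    (MinTensor.continuous_tmul_left y)

theorem UHF.continuous_kron_right (x : UHF b) : Continuous fun y : UHF c => UHF.kron x y :=
  (continuous_starAlgHom (kroneckerEquiv b c).symm.toNonUnitalStarAlgHom).comp
    (MinTensor.continuous_tmul_right x)

theorem UHF.kron_mul_kron (x x' : UHF b) (y y' : UHF c) :
    UHF.kron x y * UHF.kron x' y' = UHF.kron (x * x') (y * y') := by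
  unfold UHF.kron
  rw [← map_mul, MinTensor.tmul_mul_tmul]

theorem UHF.smul_kron (z : ℂ) (x : UHF b) (y : UHF c) :
    UHF.kron (z • x) y = z • UHF.kron x y := by
  unfold UHF.kron
  rw [← map_smul, MinTensor.smul_tmul]

theorem UHF.kron_smul (z : ℂ) (x : UHF b) (y : UHF c) :
    UHF.kron x (z • y) = z • UHF.kron x y := by
  unfold UHF.kron
  rw [← map_smul, MinTensor.tmul_smul]

theorem UHF.kron_ofMatrix (n : ℕ) (M : UHFMatrix b n) (N : UHFMatrix c n) :
    UHF.kron (UHF.ofMatrix b n M) (UHF.ofMatrix c n N) =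
      UHF.ofMatrix (b * c) n (UHFMatrix.kron M N) := by
  apply EquivLike.injective (kroneckerEquiv b c)
  refine (StarAlgEquiv.apply_symm_apply _ _).trans ?_
  exact (kroneckerHom_ofMatrix_kron (NonUnitalStarAlgHom.id ℂ (UHF b))
    (NonUnitalStarAlgHom.id ℂ (UHF c)) n M N).symm

theorem UHF.kron_one_one : UHF.kron (1 : UHF b) (1 : UHF c) = 1 := by
  -- At level 0 there is only the empty multi-index, so the units are compared as 1 × 1 matrices.
  rw [← map_one (UHF.ofMatrix b 0), ← map_one (UHF.ofMatrix c 0), UHF.kron_ofMatrix,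
    ← map_one (UHF.ofMatrix (b * c) 0)]
  refine congrArg _ (UHFMatrix.ext fun J K => ?_)
  rw [entry_kron, entry_one, entry_one, entry_one, if_pos (Subsingleton.elim _ _),
    if_pos (Subsingleton.elim _ _), if_pos (Subsingleton.elim _ _), one_mul]

theorem UHF.zero_kron (y : UHF c) : UHF.kron (0 : UHF b) y = 0 := by
  rw [← zero_smul ℂ (0 : UHF b), UHF.smul_kron, zero_smul]

theorem UHF.kron_zero (x : UHF b) : UHF.kron x (0 : UHF c) = 0 := by
  rw [← zero_smul ℂ (0 : UHF c), UHF.kron_smul, zero_smul]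

/-- Under the identification of A(b·c) with A(b) ⊗ A(c), `kroneckerHom f g` is therefore the tensor
product f ⊗ g. -/
theorem kroneckerHom_kron (x : UHF b) (y : UHF c) :
    kroneckerHom f g (UHF.kron x y) = MinTensor.tmul (f x) (g y) := by
  induction x, y using UHF.induction_on₂' with
  | hc₁ y =>
    exact isClosed_eq ((continuous_starAlgHom _).comp (UHF.continuous_kron_left y))
      ((MinTensor.continuous_tmul_left (g y)).comp (continuous_starAlgHom f))
  | hc₂ x =>
    exact isClosed_eq ((continuous_starAlgHom _).comp (UHF.continuous_kron_right x))
      ((MinTensor.continuous_tmul_right (f x)).comp (continuous_starAlgHom g))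
  | h n M N => rw [UHF.kron_ofMatrix, kroneckerHom_ofMatrix_kron]

/-- The bijection `j = c j' + j'' ↦ b j'' + j'` between two copies of `{1, …, bc}`. -/
def finSwap (m n : ℕ) : Fin (m * n) ≃ Fin (n * m) :=
  finProdFinEquiv.symm.trans ((Equiv.prodComm _ _).trans finProdFinEquiv)

/-- The isomorphism `A(b·c) → A(c·b)` that corresponds to the flip `A(b) ⊗ A(c) → A(c) ⊗ A(b)`. -/
def UHF.swap (b c : ℕ → ℕ) [PosSeq b] [PosSeq c] : UHF (b * c) →⋆ₐ[ℂ] UHF (c * b) :=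
  UHF.reindex fun j => finSwap (b j) (c j)

theorem split_map_swap {b c : ℕ → ℕ} (n : ℕ) (J : UHFIndex (c * b) n) :
    split b c n ((UHFIndex.map (fun j => finSwap (b j) (c j)) n).symm J) =
      ((split c b n J).2, (split c b n J).1) := by
  refine Prod.ext (funext fun i => ?_) (funext fun i => ?_)
  · exact congrArg Prod.fst (finProdFinEquiv.symm_apply_apply
      (Equiv.prodComm _ _ (finProdFinEquiv.symm (J i : Fin (c i * b i)))))
  · exact congrArg Prod.snd (finProdFinEquiv.symm_apply_apply
      (Equiv.prodComm _ _ (finProdFinEquiv.symm (J i : Fin (c i * b i)))))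

theorem UHF.swap_kron (x : UHF b) (y : UHF c) :
    UHF.swap b c (UHF.kron x y) = UHF.kron y x := by
  induction x, y using UHF.induction_on₂' with
  | hc₁ y =>
    exact isClosed_eq ((UHF.continuous_reindex _).comp (UHF.continuous_kron_left y))
      (UHF.continuous_kron_right y)
  | hc₂ x =>
    exact isClosed_eq ((UHF.continuous_reindex _).comp (UHF.continuous_kron_right x))
      (UHF.continuous_kron_left x)
  | h n M N =>
    rw [UHF.kron_ofMatrix, UHF.kron_ofMatrix]
    refine (UHF.reindex_ofMatrix _ n _).trans (congrArg _ (UHFMatrix.ext fun J K => ?_))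
    rw [entry_reindex, entry_kron, entry_kron, split_map_swap, split_map_swap, mul_comm]

theorem split_symm_spec {b c : ℕ → ℕ} {n : ℕ} (p : UHFIndex b n × UHFIndex c n) (i : Fin n) :
    (((split b c n).symm p i : Fin ((b * c) i)) : ℕ) = c i * (p.1 i : ℕ) + (p.2 i : ℕ) := by
  rw [split_spec, Equiv.apply_symm_apply]

/-- Both groupings read off the same mixed-radix digits: (c d) j' + (d j'' + j''') = d (c j' + j'')
+ j'''. -/
theorem split_assoc {b c d : ℕ → ℕ} (n : ℕ) (J : UHFIndex (b * (c * d)) n) :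
    split (b * c) d n ((UHFIndex.map (a := b * c * d) (a' := b * (c * d))
      (fun j => finCongr (congrFun (mul_assoc b c d) j)) n).symm J) =
      ((split b c n).symm ((split b (c * d) n J).1, (split c d n (split b (c * d) n J).2).1),
        (split c d n (split b (c * d) n J).2).2) := by
  apply (split (b * c) d n).symm.injective
  rw [Equiv.symm_apply_apply]
  funext i
  apply Fin.ext
  have h1 := split_spec (b := b) (c := c * d) J i
  have h2 := split_spec (split b (c * d) n J).2 i
  rw [split_symm_spec, split_symm_spec]
  -- Renaming the range along (bc)d = b(cd) does not change the underlying integer.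
  change (J i : ℕ) = _
  rw [h1, h2, Pi.mul_apply]
  ring

/-- This is the coassociativity of the family φ_{b,c}, expressed by the inverse maps. On matrices it
is `split_assoc` together with the associativity of the product of entries. -/
theorem UHF.cast_kron_kron {d : ℕ → ℕ} [PosSeq d] (x : UHF b) (y : UHF c) (z : UHF d) :
    UHF.cast (mul_assoc b c d) (UHF.kron (UHF.kron x y) z) = UHF.kron x (UHF.kron y z) := by
  induction x, y, z using UHF.induction_on₃ with
  | hc₁ y z =>
    exact isClosed_eq ((UHF.continuous_reindex _).comp ((UHF.continuous_kron_left z).comp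
      (UHF.continuous_kron_left y))) (UHF.continuous_kron_left _)
  | hc₂ x z =>
    exact isClosed_eq ((UHF.continuous_reindex _).comp ((UHF.continuous_kron_left z).comp
      (UHF.continuous_kron_right x))) ((UHF.continuous_kron_right x).comp
        (UHF.continuous_kron_left z))
  | hc₃ x y =>
    exact isClosed_eq ((UHF.continuous_reindex _).comp (UHF.continuous_kron_right _))
      ((UHF.continuous_kron_right x).comp (UHF.continuous_kron_right y))
  | h n M N O =>
    simp only [UHF.kron_ofMatrix]
    refine (UHF.reindex_ofMatrix _ n _).trans (congrArg _ (UHFMatrix.ext fun J K => ?_))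
    rw [entry_reindex, entry_kron, entry_kron, entry_kron, entry_kron, split_assoc, split_assoc,
      Equiv.apply_symm_apply, Equiv.apply_symm_apply, mul_assoc]

theorem UHF.cast_one_kron (y : UHF c) : UHF.cast (one_mul c) (UHF.kron (1 : UHF 1) y) = y := by
  induction y using UHF.induction_on with
  | hc =>
    exact isClosed_eq ((UHF.continuous_reindex _).comp (UHF.continuous_kron_right _)) continuous_id
  | h n M =>
    rw [← map_one (UHF.ofMatrix 1 n), UHF.kron_ofMatrix]
    refine (UHF.reindex_ofMatrix _ n _).trans (congrArg _ (UHFMatrix.ext fun J K => ?_))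
    have h : ∀ J : UHFIndex c n, (split 1 c n ((UHFIndex.map (a := 1 * c) (a' := c)
        (fun j => finCongr (congrFun (one_mul c) j)) n).symm J)).2 = J := fun J => funext fun i => by
      apply Fin.ext
      have h1 := split_spec (b := 1) ((UHFIndex.map (a := 1 * c) (a' := c)
        (fun j => finCongr (congrFun (one_mul c) j)) n).symm J) i
      -- The digit j' ranges over a one-element set, so it is 0 and j = j''.
      rw [Nat.lt_one_iff.1 (Fin.isLt ((split 1 c n _).1 i)), mul_zero, zero_add] at h1
      exact h1.symm
    rw [entry_reindex, entry_kron, h, h, entry_one, if_pos (Subsingleton.elim _ _), one_mul]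

theorem UHF.cast_kron_one (x : UHF b) : UHF.cast (mul_one b) (UHF.kron x (1 : UHF 1)) = x := by
  induction x using UHF.induction_on with
  | hc =>
    exact isClosed_eq ((UHF.continuous_reindex _).comp (UHF.continuous_kron_left _)) continuous_id
  | h n M =>
    rw [← map_one (UHF.ofMatrix 1 n), UHF.kron_ofMatrix]
    refine (UHF.reindex_ofMatrix _ n _).trans (congrArg _ (UHFMatrix.ext fun J K => ?_))
    have h : ∀ J : UHFIndex b n, (split b 1 n ((UHFIndex.map (a := b * 1) (a' := b)
        (fun j => finCongr (congrFun (mul_one b) j)) n).symm J)).1 = J := fun J => funext fun i => by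
      apply Fin.ext
      have h1 := split_spec (c := 1) ((UHFIndex.map (a := b * 1) (a' := b)
        (fun j => finCongr (congrFun (mul_one b) j)) n).symm J) i
      -- The digit j'' is 0 and the radix is 1, so j = j'.
      rw [Nat.lt_one_iff.1 (Fin.isLt ((split b 1 n _).2 i)), Pi.one_apply, one_mul, add_zero] at h1
      exact h1.symm
    rw [entry_reindex, entry_kron, h, h, entry_one, if_pos (Subsingleton.elim _ _), mul_one]

end Kron

/-- A block decomposition of a C*-algebra with UHF algebras as blocks, such that the diagonal matrix
units are not annihilated by all positive functionals. -/
structure IsUHFDecomposition {ι : Type*} (b : ι → ℕ → ℕ) [∀ i, PosSeq (b i)]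
    {X : Type*} [NonUnitalCStarAlgebra X] (β : ∀ i, UHF (b i) →⋆ₙₐ[ℂ] X) : Prop where
  orthogonal : ∀ i j, i ≠ j → ∀ x y, β i x * β j y = 0
  supported : ∀ i n P, IsSupported (β i (UHF.ofMatrix (b i) n (unit P P)))
  dense : Dense (Submodule.span ℂ {t : X | ∃ i x, t = β i x} : Set X)

namespace IsUHFDecomposition

variable {ι : Type*} {b : ι → ℕ → ℕ} [∀ i, PosSeq (b i)] {X : Type*} [NonUnitalCStarAlgebra X]
  {β : ∀ i, UHF (b i) →⋆ₙₐ[ℂ] X}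

theorem isBlockDecomposition (hβ : IsUHFDecomposition b β) :
    IsBlockDecomposition (B := fun i => UHF (b i)) β where
  orthogonal := hβ.orthogonal
  injective i := UHF.injective_of_ne_zero _ fun n P => (hβ.supported i n P).ne_zero
  dense := hβ.dense

theorem single (b : ι → ℕ → ℕ) [∀ i, PosSeq (b i)] :
    IsUHFDecomposition b fun i => C0Sum.single (A := fun i => UHF (b i)) i where
  orthogonal := (C0Sum.isBlockDecomposition_single _).orthogonal
  supported i n P := .of_map (C0Sum.proj i) <| by
    rw [C0Sum.proj_apply, C0Sum.coord_single_same]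
    exact UHF.isSupported_unit n P
  dense := (C0Sum.isBlockDecomposition_single _).dense

/-- The blocks of X ⊗ Y are again UHF algebras, namely A(b_i · c_k), so the construction can be
repeated. Orthogonality and density are checked on elementary tensors: for different pairs (i, k) at
least one of the two factors is a product of elements of different blocks and vanishes. -/
theorem tensor (hβ : IsUHFDecomposition b β) {κ : Type*} {c : κ → ℕ → ℕ} [∀ k, PosSeq (c k)]
    {Y : Type*} [NonUnitalCStarAlgebra Y] {γ : ∀ k, UHF (c k) →⋆ₙₐ[ℂ] Y}
    (hγ : IsUHFDecomposition c γ) :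
    IsUHFDecomposition (fun p : ι × κ => b p.1 * c p.2) fun p => kroneckerHom (β p.1) (γ p.2) where
  orthogonal p q hpq x y := by
    refine kroneckerHom_induction (β p.1) (γ p.2)
      (P := fun t => t * kroneckerHom (β q.1) (γ q.2) y = 0)
      (isClosed_eq (continuous_mul_const _) continuous_const) (zero_mul _) (fun x x' => ?_)
      (fun s t hs ht => by rw [add_mul, hs, ht, add_zero]) x
    refine kroneckerHom_induction (β q.1) (γ q.2)
      (P := fun t => MinTensor.tmul (β p.1 x) (γ p.2 x') * t = 0)
      (isClosed_eq (continuous_const_mul _) continuous_const) (mul_zero _) (fun y y' => ?_)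
      (fun s t hs ht => by rw [mul_add, hs, ht, add_zero]) y
    rw [MinTensor.tmul_mul_tmul]
    by_cases h : p.1 = q.1
    · rw [hγ.orthogonal _ _ fun h' => hpq (Prod.ext h h')]
      exact map_zero (MinTensor.tmulₗ _)
    · rw [hβ.orthogonal _ _ h]
      exact LinearMap.map_zero₂ MinTensor.tmulₗ _
  supported p n P := isSupported_kroneckerHom _ _ (hβ.supported _) (hγ.supported _) n P
  dense t := by
    set V : Submodule ℂ (MinTensor X Y) := (Submodule.span ℂ
      {t : MinTensor X Y | ∃ (p : ι × κ) (x : UHF (b p.1 * c p.2)),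
        t = kroneckerHom (β p.1) (γ p.2) x}).topologicalClosure with hV
    have hVc : IsClosed (V : Set (MinTensor X Y)) := Submodule.isClosed_topologicalClosure _
    change t ∈ V
    induction t using MinTensor.induction_on with
    | hc => exact hVc
    | h0 => exact zero_mem _
    | ha s t hs ht => exact add_mem hs ht
    | ht x y =>
      induction x using hβ.isBlockDecomposition.induction_on with
      | hc => exact hVc.preimage (MinTensor.continuous_tmul_left y)
      | h0 =>
        rw [show MinTensor.tmul (0 : X) y = 0 from LinearMap.map_zero₂ MinTensor.tmulₗ _]
        exact zero_mem _
      | ha s t hs ht => rw [MinTensor.add_tmul]; exact add_mem hs ht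
      | hb i x =>
        induction y using hγ.isBlockDecomposition.induction_on with
        | hc => exact hVc.preimage (MinTensor.continuous_tmul_right _)
        | h0 =>
          rw [show MinTensor.tmul (β i x) (0 : Y) = 0 from map_zero (MinTensor.tmulₗ _)]
          exact zero_mem _
        | ha s t hs ht => rw [MinTensor.tmul_add]; exact add_mem hs ht
        | hb k y =>
          rw [← kroneckerHom_kron]
          exact subset_closure (Submodule.subset_span ⟨(i, k), _, rfl⟩)

end IsUHFDecomposition

end UHFDecompositions

/-! ### The multipliers 1 ⊗ b and a ⊗ 1 as *-homomorphisms, hence continuous in b and a. -/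

noncomputable section TensorMultipliers

open DoubleCentralizer

namespace MinTensor

variable {A B : Type*} [NonUnitalCStarAlgebra A] [NonUnitalCStarAlgebra B]

theorem multiplier_ext {m m' : 𝓜(ℂ, MinTensor A B)}
    (h : ∀ a b, m.fst (tmul a b) = m'.fst (tmul a b)) : m = m' := eq_of_fst fun t => by
  induction t using induction_on with
  | hc => exact isClosed_eq m.fst.continuous m'.fst.continuous
  | h0 => rw [map_zero, map_zero]
  | ht a b => exact h a b
  | ha s t hs ht => rw [map_add, map_add, hs, ht]

/-- The map `b ↦ 1 ⊗ b` as a `*`-homomorphism. -/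
def oneTmulHom : B →⋆ₙₐ[ℂ] 𝓜(ℂ, MinTensor A B) where
  toFun := oneTmul
  map_smul' c b := multiplier_ext fun x y => by
    rw [MonoidHom.id_apply, oneTmul_fst_tmul, smul_mul_assoc, tmul_smul, ← oneTmul_fst_tmul]; rfl
  map_zero' := multiplier_ext fun x y => by
    rw [oneTmul_fst_tmul, zero_mul]; exact map_zero (tmulₗ x)
  map_add' b b' := multiplier_ext fun x y => by
    rw [oneTmul_fst_tmul, add_mul, tmul_add, ← oneTmul_fst_tmul, ← oneTmul_fst_tmul]; rfl
  map_mul' b b' := multiplier_ext fun x y => by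
    rw [mul_fst_apply, oneTmul_fst_tmul, oneTmul_fst_tmul, oneTmul_fst_tmul, mul_assoc]
  map_star' b := multiplier_ext fun x y => by
    rw [star_fst, star_tmul, oneTmul_fst_tmul, oneTmul_snd_tmul, star_tmul, star_mul, star_star,
      star_star]

/-- The map `a ↦ a ⊗ 1` as a `*`-homomorphism. -/
def tmulOneHom : A →⋆ₙₐ[ℂ] 𝓜(ℂ, MinTensor A B) where
  toFun := tmulOne
  map_smul' c a := multiplier_ext fun x y => by
    rw [MonoidHom.id_apply, tmulOne_fst_tmul, smul_mul_assoc, smul_tmul, ← tmulOne_fst_tmul]; rfl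
  map_zero' := multiplier_ext fun x y => by
    rw [tmulOne_fst_tmul, zero_mul]; exact LinearMap.map_zero₂ tmulₗ y
  map_add' a a' := multiplier_ext fun x y => by
    rw [tmulOne_fst_tmul, add_mul, add_tmul, ← tmulOne_fst_tmul, ← tmulOne_fst_tmul]; rfl
  map_mul' a a' := multiplier_ext fun x y => by
    rw [mul_fst_apply, tmulOne_fst_tmul, tmulOne_fst_tmul, tmulOne_fst_tmul, mul_assoc]
  map_star' a := multiplier_ext fun x y => by
    rw [star_fst, star_tmul, tmulOne_fst_tmul, tmulOne_snd_tmul, star_tmul, star_mul, star_star,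
      star_star]

end MinTensor

end TensorMultipliers

/-! ### The block coordinates of A(*) ⊗ A(*), of the triple tensor products and of Δ_φ. -/

noncomputable section UHFBialgebra

open UHFIndex UHFMatrix DoubleCentralizer Filter Topology

theorem isUHFDecomposition_single : IsUHFDecomposition (fun a : UHFMonoid => (a : ℕ → ℕ))
    fun a => C0Sum.single (A := fun a : UHFMonoid => UHF (a : ℕ → ℕ)) a := .single _

theorem isUHFDecomposition_comulBlock : IsUHFDecomposition
    (fun p : UHFMonoid × UHFMonoid => ((p.1 * p.2 : UHFMonoid) : ℕ → ℕ)) comulBlock :=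
  isUHFDecomposition_single.tensor isUHFDecomposition_single

theorem isBlockDecomposition_comulBlock : IsBlockDecomposition
    (B := fun p : UHFMonoid × UHFMonoid => UHF ((p.1 * p.2 : UHFMonoid) : ℕ → ℕ)) comulBlock :=
  isUHFDecomposition_comulBlock.isBlockDecomposition

/-- The `(b, c, d)`-block of `(A(*) ⊗ A(*)) ⊗ A(*)`. -/
def leftBlock (i : (UHFMonoid × UHFMonoid) × UHFMonoid) :
    UHF ((i.1.1 * i.1.2 * i.2 : UHFMonoid) : ℕ → ℕ) →⋆ₙₐ[ℂ]
      MinTensor (MinTensor UHFSum UHFSum) UHFSum :=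
  kroneckerHom (b := ((i.1.1 * i.1.2 : UHFMonoid) : ℕ → ℕ)) (c := (i.2 : ℕ → ℕ)) (comulBlock i.1)
    (C0Sum.single (A := fun a : UHFMonoid => UHF (a : ℕ → ℕ)) i.2)

/-- The `(b, c, d)`-block of `A(*) ⊗ (A(*) ⊗ A(*))`. -/
def rightBlock (i : UHFMonoid × (UHFMonoid × UHFMonoid)) :
    UHF ((i.1 * (i.2.1 * i.2.2) : UHFMonoid) : ℕ → ℕ) →⋆ₙₐ[ℂ]
      MinTensor UHFSum (MinTensor UHFSum UHFSum) :=
  kroneckerHom (b := (i.1 : ℕ → ℕ)) (c := ((i.2.1 * i.2.2 : UHFMonoid) : ℕ → ℕ))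
    (C0Sum.single (A := fun a : UHFMonoid => UHF (a : ℕ → ℕ)) i.1) (comulBlock i.2)

theorem isBlockDecomposition_leftBlock : IsBlockDecomposition
    (B := fun i : (UHFMonoid × UHFMonoid) × UHFMonoid =>
      UHF ((i.1.1 * i.1.2 * i.2 : UHFMonoid) : ℕ → ℕ)) leftBlock :=
  (isUHFDecomposition_comulBlock.tensor isUHFDecomposition_single).isBlockDecomposition

theorem isBlockDecomposition_rightBlock : IsBlockDecomposition
    (B := fun i : UHFMonoid × (UHFMonoid × UHFMonoid) =>
      UHF ((i.1 * (i.2.1 * i.2.2) : UHFMonoid) : ℕ → ℕ)) rightBlock :=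
  (isUHFDecomposition_single.tensor isUHFDecomposition_comulBlock).isBlockDecomposition

theorem comulBlock_kron (p : UHFMonoid × UHFMonoid) (x : UHF (p.1 : ℕ → ℕ))
    (y : UHF (p.2 : ℕ → ℕ)) : comulBlock p (UHF.kron x y) =
      MinTensor.tmul (C0Sum.single p.1 x : UHFSum) (C0Sum.single p.2 y : UHFSum) :=
  kroneckerHom_kron (b := (p.1 : ℕ → ℕ)) (c := (p.2 : ℕ → ℕ)) _ _ x y

theorem leftBlock_kron (i : (UHFMonoid × UHFMonoid) × UHFMonoid)
    (x : UHF ((i.1.1 * i.1.2 : UHFMonoid) : ℕ → ℕ)) (y : UHF (i.2 : ℕ → ℕ)) :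
    leftBlock i (UHF.kron x y) =
      MinTensor.tmul (comulBlock i.1 x) (C0Sum.single i.2 y : UHFSum) :=
  kroneckerHom_kron (b := ((i.1.1 * i.1.2 : UHFMonoid) : ℕ → ℕ)) (c := (i.2 : ℕ → ℕ)) _ _ x y

theorem rightBlock_kron (i : UHFMonoid × (UHFMonoid × UHFMonoid)) (x : UHF (i.1 : ℕ → ℕ))
    (y : UHF ((i.2.1 * i.2.2 : UHFMonoid) : ℕ → ℕ)) : rightBlock i (UHF.kron x y) =
      MinTensor.tmul (C0Sum.single i.1 x : UHFSum) (comulBlock i.2 y) :=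
  kroneckerHom_kron (b := (i.1 : ℕ → ℕ)) (c := ((i.2.1 * i.2.2 : UHFMonoid) : ℕ → ℕ)) _ _ x y

theorem comulBlock_one (p : UHFMonoid × UHFMonoid) : comulBlock p 1 =
    MinTensor.tmul (C0Sum.single p.1 1 : UHFSum) (C0Sum.single p.2 1 : UHFSum) := by
  rw [← comulBlock_kron]
  exact congrArg (comulBlock p) UHF.kron_one_one.symm

/-- The component of a multiplier of `A(*) ⊗ A(*)` in `A(b·c) = A(b) ⊗ A(c)`. -/
abbrev uhfCoeff (p : UHFMonoid × UHFMonoid) :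
    𝓜(ℂ, MinTensor UHFSum UHFSum) →⋆ₐ[ℂ] UHF ((p.1 * p.2 : UHFMonoid) : ℕ → ℕ) :=
  isBlockDecomposition_comulBlock.coeff p

/-- In block coordinates the comultiplication is pullback along S × S → S. Applied to the unit of
block p, the series defining Δ(x) reduces to its p-th term by orthogonality. -/
theorem uhfCoeff_comul (p : UHFMonoid × UHFMonoid) (x : UHFSum) :
    uhfCoeff p (uhfComul x) = x.coord (p.1 * p.2) :=
  isBlockDecomposition_comulBlock.coeff_eq_of_fst_one <| by
    change ∑' q, comulTerm q x * comulBlock p 1 = _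
    rw [tsum_eq_single p]
    · exact (map_mul (comulBlock p) _ _).symm.trans (congrArg _ (mul_one _))
    · exact fun q hq => comulBlock_mul_comulBlock hq _ _

theorem uhfCoeff_oneTmul (p : UHFMonoid × UHFMonoid) (x : UHFSum) :
    uhfCoeff p (MinTensor.oneTmul x) = UHF.kron (1 : UHF (p.1 : ℕ → ℕ)) (x.coord p.2) :=
  isBlockDecomposition_comulBlock.coeff_eq_of_fst_one <| by
    rw [comulBlock_one, MinTensor.oneTmul_fst_tmul, C0Sum.mul_single, mul_one, comulBlock_kron]

theorem uhfCoeff_tmulOne (p : UHFMonoid × UHFMonoid) (x : UHFSum) :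
    uhfCoeff p (MinTensor.tmulOne x) = UHF.kron (x.coord p.1) (1 : UHF (p.2 : ℕ → ℕ)) :=
  isBlockDecomposition_comulBlock.coeff_eq_of_fst_one <| by
    rw [comulBlock_one, MinTensor.tmulOne_fst_tmul, C0Sum.mul_single, mul_one, comulBlock_kron]

theorem uhfCoeff_tmul (p : UHFMonoid × UHFMonoid) (x y : UHFSum) :
    uhfCoeff p (MinTensor.tmul x y : 𝓜(ℂ, MinTensor UHFSum UHFSum)) =
      UHF.kron (x.coord p.1) (y.coord p.2) :=
  isBlockDecomposition_comulBlock.coeff_eq_of_fst_one <| by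
    rw [coe_fst_apply, comulBlock_one, MinTensor.tmul_mul_tmul, C0Sum.mul_single, C0Sum.mul_single,
      mul_one, mul_one, comulBlock_kron]

theorem uhfCoeff_coe_comulBlock (p : UHFMonoid × UHFMonoid)
    (y : UHF ((p.1 * p.2 : UHFMonoid) : ℕ → ℕ)) :
    uhfCoeff p (comulBlock p y : 𝓜(ℂ, MinTensor UHFSum UHFSum)) = y := by
  rw [uhfCoeff, IsBlockDecomposition.coeff_coe, IsBlockDecomposition.component_same]

theorem uhfCoeff_coe_comulBlock_of_ne {p q : UHFMonoid × UHFMonoid} (h : q ≠ p)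
    (y : UHF ((p.1 * p.2 : UHFMonoid) : ℕ → ℕ)) :
    uhfCoeff q (comulBlock p y : 𝓜(ℂ, MinTensor UHFSum UHFSum)) = 0 := by
  rw [uhfCoeff, IsBlockDecomposition.coeff_coe, IsBlockDecomposition.component_of_ne _ h]

/-- The entries are positive integers and can be cancelled one by one. This is the arithmetic behind
properness and the cancellation law. -/
theorem UHFMonoid.mul_left_injective {a b c : UHFMonoid} (h : a * c = b * c) : a = b :=
  Subtype.ext <| funext fun j => Nat.eq_of_mul_eq_mul_right (PosSeq.pos (a := (c : ℕ → ℕ)) j)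
    (congrFun (congrArg Subtype.val h) j)

theorem UHFMonoid.mul_right_injective {a b c : UHFMonoid} (h : c * a = c * b) : a = b :=
  UHFMonoid.mul_left_injective (c := c) (by rwa [mul_comm a, mul_comm b])

/-! ### Properness and the cancellation law. -/

section Properness

/-- A(*) ⊗ A(*) is closed in its multiplier algebra and f, g are continuous, so x and y may be taken
in single summands. The product then has at most one nonzero component, and it coincides with the
element of A(*) ⊗ A(*) formed by that component. -/
theorem exists_coe_eq_mul (f g : UHFSum →⋆ₙₐ[ℂ] 𝓜(ℂ, MinTensor UHFSum UHFSum))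
    (h : ∀ (a c : UHFMonoid) (x : UHF (a : ℕ → ℕ)) (y : UHF (c : ℕ → ℕ)), ∃ p, ∀ q, q ≠ p →
      uhfCoeff q (f (C0Sum.single a x) * g (C0Sum.single c y)) = 0) (x y : UHFSum) :
    ∃ t : MinTensor UHFSum UHFSum, f x * g y = (t : 𝓜(ℂ, MinTensor UHFSum UHFSum)) := by
  have hf := continuous_starAlgHom f
  have hg := continuous_starAlgHom g
  have hadd : ∀ m m' : 𝓜(ℂ, MinTensor UHFSum UHFSum),
      (∃ t : MinTensor UHFSum UHFSum, m = (t : 𝓜(ℂ, MinTensor UHFSum UHFSum))) →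
      (∃ t : MinTensor UHFSum UHFSum, m' = (t : 𝓜(ℂ, MinTensor UHFSum UHFSum))) →
      ∃ t : MinTensor UHFSum UHFSum, m + m' = (t : 𝓜(ℂ, MinTensor UHFSum UHFSum)) := by
    rintro _ _ ⟨s, rfl⟩ ⟨t, rfl⟩
    exact ⟨s + t, (coe_add s t).symm⟩
  induction x using C0Sum.induction_on with
  | hc => exact isClosed_range_coe.preimage ((continuous_mul_const (g y)).comp hf)
  | h0 => exact ⟨0, by rw [map_zero, zero_mul, coe_zero]⟩
  | ha x x' hx hx' => rw [map_add, add_mul]; exact hadd _ _ hx hx'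
  | hs a x =>
    induction y using C0Sum.induction_on with
    | hc => exact isClosed_range_coe.preimage ((continuous_const_mul _).comp hg)
    | h0 => exact ⟨0, by rw [map_zero, mul_zero, coe_zero]⟩
    | ha y y' hy hy' => rw [map_add, mul_add]; exact hadd _ _ hy hy'
    | hs c y =>
      obtain ⟨p, hp⟩ := h a c x y
      refine ⟨comulBlock p (uhfCoeff p (f (C0Sum.single a x) * g (C0Sum.single c y))),
        isBlockDecomposition_comulBlock.multiplier_ext fun q => ?_⟩
      by_cases hq : q = p
      · subst hq
        exact (uhfCoeff_coe_comulBlock q _).symm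
      · exact (hp q hq).trans (uhfCoeff_coe_comulBlock_of_ne hq _).symm

/-- By cancellation at most one b satisfies b c = a. -/
theorem exists_unique_right (a c : UHFMonoid) : ∃ p : UHFMonoid × UHFMonoid, ∀ q, q ≠ p →
    q.2 = c → q.1 * q.2 ≠ a := by
  by_cases h : ∃ b, b * c = a
  · obtain ⟨b, rfl⟩ := h
    refine ⟨(b, c), fun q hq hc h => hq (Prod.ext ?_ hc)⟩
    rw [hc] at h
    exact UHFMonoid.mul_left_injective h
  -- If c does not divide a in S, no pair has to be excluded and (1, c) is a default value.
  · refine ⟨(1, c), fun q _ hc hq => h ⟨q.1, ?_⟩⟩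
    rwa [← hc]

theorem exists_unique_left (a b : UHFMonoid) : ∃ p : UHFMonoid × UHFMonoid, ∀ q, q ≠ p →
    q.1 = b → q.1 * q.2 ≠ a := by
  by_cases h : ∃ c, b * c = a
  · obtain ⟨c, rfl⟩ := h
    refine ⟨(b, c), fun q hq hb h => hq (Prod.ext hb ?_)⟩
    rw [hb] at h
    exact UHFMonoid.mul_right_injective h
  · refine ⟨(b, 1), fun q _ hb hq => h ⟨q.2, ?_⟩⟩
    rwa [← hb]

/-- The component at q is the product of a factor supported on q.1 · q.2 = a and a factor supported
on q.2 = c. -/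
theorem uhfCoeff_comul_mul_oneTmul_eq_zero {a c : UHFMonoid} {q : UHFMonoid × UHFMonoid}
    (h : q.2 = c → q.1 * q.2 ≠ a) (x : UHF (a : ℕ → ℕ)) (y : UHF (c : ℕ → ℕ)) :
    uhfCoeff q (uhfComul (C0Sum.single a x) * MinTensor.oneTmul (C0Sum.single c y)) = 0 := by
  rw [map_mul, uhfCoeff_comul, uhfCoeff_oneTmul]
  by_cases hc : q.2 = c
  · rw [C0Sum.coord_single_of_ne (h hc), zero_mul]
  · rw [C0Sum.coord_single_of_ne hc, UHF.kron_zero, mul_zero]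

theorem uhfCoeff_comul_mul_tmulOne_eq_zero {a b : UHFMonoid} {q : UHFMonoid × UHFMonoid}
    (h : q.1 = b → q.1 * q.2 ≠ a) (x : UHF (a : ℕ → ℕ)) (y : UHF (b : ℕ → ℕ)) :
    uhfCoeff q (uhfComul (C0Sum.single a x) * MinTensor.tmulOne (C0Sum.single b y)) = 0 := by
  rw [map_mul, uhfCoeff_comul, uhfCoeff_tmulOne]
  by_cases hb : q.1 = b
  · rw [C0Sum.coord_single_of_ne (h hb), zero_mul]
  · rw [C0Sum.coord_single_of_ne hb, UHF.zero_kron, mul_zero]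

theorem exists_comul_mul_oneTmul (x y : UHFSum) : ∃ t : MinTensor UHFSum UHFSum,
    uhfComul x * MinTensor.oneTmul y = (t : 𝓜(ℂ, MinTensor UHFSum UHFSum)) :=
  exists_coe_eq_mul uhfComul MinTensor.oneTmulHom (fun a c x y => by
    obtain ⟨p, hp⟩ := exists_unique_right a c
    exact ⟨p, fun q hq => uhfCoeff_comul_mul_oneTmul_eq_zero (hp q hq) x y⟩) x y

theorem exists_comul_mul_tmulOne (x y : UHFSum) : ∃ t : MinTensor UHFSum UHFSum,
    uhfComul x * MinTensor.tmulOne y = (t : 𝓜(ℂ, MinTensor UHFSum UHFSum)) :=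
  exists_coe_eq_mul uhfComul MinTensor.tmulOneHom (fun a b x y => by
    obtain ⟨p, hp⟩ := exists_unique_left a b
    exact ⟨p, fun q hq => uhfCoeff_comul_mul_tmulOne_eq_zero (hp q hq) x y⟩) x y

theorem isProperComul_uhfComul : IsProperComul uhfComul := fun x y =>
  ⟨exists_comul_mul_oneTmul x y, by
    -- The second condition follows by adjoints: (y ⊗ 1) Δ(x) = (Δ(x*)(y* ⊗ 1))*.
    obtain ⟨t, ht⟩ := exists_comul_mul_tmulOne (star x) (star y)
    refine ⟨star t, ?_⟩
    rw [coe_star, ← ht, star_mul, ← map_star uhfComul, star_star]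
    congr 1
    change MinTensor.tmulOneHom y = star (MinTensor.tmulOneHom (star y))
    rw [← map_star, star_star]⟩

/-- Multiplication by 1 ⊗ 1_c, with 1_c the unit of A(c), keeps only the components with second
index c; by cancellation just one of these has product b·c. Thus every block element is of the form
Δ(x)(1 ⊗ z), which gives the density in the cancellation law. -/
theorem coe_comulBlock_eq_mul_oneTmul (p : UHFMonoid × UHFMonoid)
    (y : UHF ((p.1 * p.2 : UHFMonoid) : ℕ → ℕ)) :
    (comulBlock p y : 𝓜(ℂ, MinTensor UHFSum UHFSum)) =
      uhfComul (C0Sum.single (p.1 * p.2) y) * MinTensor.oneTmul (C0Sum.single p.2 1) :=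
  isBlockDecomposition_comulBlock.multiplier_ext fun q => by
    by_cases hq : q = p
    · subst hq
      refine (uhfCoeff_coe_comulBlock q y).trans ?_
      rw [map_mul, uhfCoeff_comul, uhfCoeff_oneTmul, C0Sum.coord_single_same,
        C0Sum.coord_single_same]
      exact ((congrArg (y * ·) UHF.kron_one_one).trans (mul_one y)).symm
    · refine (uhfCoeff_coe_comulBlock_of_ne hq y).trans
        (uhfCoeff_comul_mul_oneTmul_eq_zero (fun h2 h => hq (Prod.ext ?_ h2)) y 1).symm
      rw [h2] at h
      exact UHFMonoid.mul_left_injective h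

theorem coe_comulBlock_eq_mul_tmulOne (p : UHFMonoid × UHFMonoid)
    (y : UHF ((p.1 * p.2 : UHFMonoid) : ℕ → ℕ)) :
    (comulBlock p y : 𝓜(ℂ, MinTensor UHFSum UHFSum)) =
      uhfComul (C0Sum.single (p.1 * p.2) y) * MinTensor.tmulOne (C0Sum.single p.1 1) :=
  isBlockDecomposition_comulBlock.multiplier_ext fun q => by
    by_cases hq : q = p
    · subst hq
      refine (uhfCoeff_coe_comulBlock q y).trans ?_
      rw [map_mul, uhfCoeff_comul, uhfCoeff_tmulOne, C0Sum.coord_single_same,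
        C0Sum.coord_single_same]
      exact ((congrArg (y * ·) UHF.kron_one_one).trans (mul_one y)).symm
    · refine (uhfCoeff_coe_comulBlock_of_ne hq y).trans
        (uhfCoeff_comul_mul_tmulOne_eq_zero (fun h1 h => hq (Prod.ext h1 ?_)) y 1).symm
      rw [h1] at h
      exact UHFMonoid.mul_right_injective h

theorem hasCancellation_uhfComul : HasCancellation uhfComul where
  mem_right := exists_comul_mul_oneTmul
  mem_left := exists_comul_mul_tmulOne
  dense_right := by
    refine isBlockDecomposition_comulBlock.dense.mono (Submodule.span_mono ?_)
    rintro _ ⟨p, y, rfl⟩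
    exact ⟨_, _, coe_comulBlock_eq_mul_oneTmul p y⟩
  dense_left := by
    refine isBlockDecomposition_comulBlock.dense.mono (Submodule.span_mono ?_)
    rintro _ ⟨p, y, rfl⟩
    exact ⟨_, _, coe_comulBlock_eq_mul_tmulOne p y⟩

end Properness

/-! ### Density of Δ(a)(b ⊗ c) and coassociativity. -/

section Coassociativity

theorem dense_span_uhfComul : Dense (Submodule.span ℂ {t : MinTensor UHFSum UHFSum |
    ∃ a b c, t = (uhfComul a).fst (MinTensor.tmul b c)} : Set (MinTensor UHFSum UHFSum)) := by
  refine isBlockDecomposition_comulBlock.dense.mono (Submodule.span_mono ?_)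
  rintro _ ⟨p, y, rfl⟩
  -- The tensor product of the units of the two summands is the unit of block p, so it cuts the
  -- component y out of Δ.
  refine ⟨C0Sum.single (p.1 * p.2) y, C0Sum.single p.1 1, C0Sum.single p.2 1, ?_⟩
  rw [← comulBlock_one, isBlockDecomposition_comulBlock.fst_apply, uhfCoeff_comul,
    C0Sum.coord_single_same, mul_one]

/-- The extension of `Δ_φ ⊗ id`. -/
def uhfComulTensorId :
    𝓜(ℂ, MinTensor UHFSum UHFSum) →⋆ₐ[ℂ] 𝓜(ℂ, MinTensor (MinTensor UHFSum UHFSum) UHFSum) :=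
  isBlockDecomposition_comulBlock.pullback isBlockDecomposition_leftBlock
    (fun i => (i.1.1 * i.1.2, i.2)) fun _ => StarAlgHom.id ℂ _

/-- The extension of `id ⊗ Δ_φ`. -/
def uhfIdTensorComul :
    𝓜(ℂ, MinTensor UHFSum UHFSum) →⋆ₐ[ℂ] 𝓜(ℂ, MinTensor UHFSum (MinTensor UHFSum UHFSum)) :=
  isBlockDecomposition_comulBlock.pullback isBlockDecomposition_rightBlock
    (fun i => (i.1, i.2.1 * i.2.2)) fun _ => StarAlgHom.id ℂ _

theorem uhfComulTensorId_fst (m : 𝓜(ℂ, MinTensor UHFSum UHFSum))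
    (i : (UHFMonoid × UHFMonoid) × UHFMonoid)
    (y : UHF ((i.1.1 * i.1.2 * i.2 : UHFMonoid) : ℕ → ℕ)) :
    (uhfComulTensorId m).fst (leftBlock i y) =
      leftBlock i (uhfCoeff (i.1.1 * i.1.2, i.2) m * y) :=
  isBlockDecomposition_comulBlock.pullback_fst isBlockDecomposition_leftBlock _ _ m i y

theorem uhfIdTensorComul_fst (m : 𝓜(ℂ, MinTensor UHFSum UHFSum))
    (i : UHFMonoid × (UHFMonoid × UHFMonoid))
    (y : UHF ((i.1 * (i.2.1 * i.2.2) : UHFMonoid) : ℕ → ℕ)) :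
    (uhfIdTensorComul m).fst (rightBlock i y) =
      rightBlock i (uhfCoeff (i.1, i.2.1 * i.2.2) m * y) :=
  isBlockDecomposition_comulBlock.pullback_fst isBlockDecomposition_rightBlock _ _ m i y

/-- By continuity and additivity, t is an element y of block p and c is an element z of A(d). Both
sides are then the element of block (p, d) given by the Kronecker product of a_{p.1·p.2} y and b_d
z. -/
theorem isComulTensorId_uhf : IsComulTensorId uhfComul uhfComulTensorId where
  nondegenerate := isBlockDecomposition_comulBlock.pullback_nondegenerate
    isBlockDecomposition_leftBlock _ _
  apply a b c t := by
    induction t using isBlockDecomposition_comulBlock.induction_on with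
    | hc =>
      exact isClosed_eq ((ContinuousLinearMap.continuous _).comp (MinTensor.continuous_tmul_left c))
        ((MinTensor.continuous_tmul_left _).comp (ContinuousLinearMap.continuous _))
    | h0 =>
      rw [map_zero, show MinTensor.tmul (0 : MinTensor UHFSum UHFSum) c = 0 from
        LinearMap.map_zero₂ MinTensor.tmulₗ _, map_zero]
      exact (LinearMap.map_zero₂ MinTensor.tmulₗ _).symm
    | ha s t hs ht => rw [MinTensor.add_tmul, map_add, map_add, MinTensor.add_tmul, hs, ht]
    | hb p y =>
      induction c using C0Sum.induction_on with
      | hc =>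
        exact isClosed_eq ((ContinuousLinearMap.continuous _).comp
          (MinTensor.continuous_tmul_right _))
          ((MinTensor.continuous_tmul_right _).comp (continuous_const_mul b))
      | h0 =>
        rw [mul_zero, show MinTensor.tmul (comulBlock p y) (0 : UHFSum) = 0 from
          map_zero (MinTensor.tmulₗ _), map_zero]
        exact (map_zero (MinTensor.tmulₗ _)).symm
      | ha c c' hc hc' => rw [MinTensor.tmul_add, map_add, mul_add, MinTensor.tmul_add, hc, hc']
      | hs d z =>
        rw [← leftBlock_kron (p, d), uhfComulTensorId_fst, uhfCoeff_tmul,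
          isBlockDecomposition_comulBlock.fst_apply, uhfCoeff_comul, C0Sum.mul_single,
          ← leftBlock_kron (p, d)]
        exact congrArg _ (UHF.kron_mul_kron _ _ _ _)

theorem isIdTensorComul_uhf : IsIdTensorComul uhfComul uhfIdTensorComul where
  nondegenerate := isBlockDecomposition_comulBlock.pullback_nondegenerate
    isBlockDecomposition_rightBlock _ _
  apply a b c t := by
    induction t using isBlockDecomposition_comulBlock.induction_on with
    | hc =>
      exact isClosed_eq ((ContinuousLinearMap.continuous _).comp
        (MinTensor.continuous_tmul_right c))
        ((MinTensor.continuous_tmul_right _).comp (ContinuousLinearMap.continuous _))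
    | h0 =>
      rw [map_zero, show MinTensor.tmul c (0 : MinTensor UHFSum UHFSum) = 0 from
        map_zero (MinTensor.tmulₗ _), map_zero]
      exact (map_zero (MinTensor.tmulₗ _)).symm
    | ha s t hs ht => rw [MinTensor.tmul_add, map_add, map_add, MinTensor.tmul_add, hs, ht]
    | hb p y =>
      induction c using C0Sum.induction_on with
      | hc =>
        exact isClosed_eq ((ContinuousLinearMap.continuous _).comp
          (MinTensor.continuous_tmul_left _))
          ((MinTensor.continuous_tmul_left _).comp (continuous_const_mul a))
      | h0 =>
        rw [mul_zero, show MinTensor.tmul (0 : UHFSum) (comulBlock p y) = 0 from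
          LinearMap.map_zero₂ MinTensor.tmulₗ _, map_zero]
        exact (LinearMap.map_zero₂ MinTensor.tmulₗ _).symm
      | ha c c' hc hc' => rw [MinTensor.add_tmul, map_add, mul_add, MinTensor.add_tmul, hc, hc']
      | hs d z =>
        rw [← rightBlock_kron (d, p), uhfIdTensorComul_fst, uhfCoeff_tmul,
          isBlockDecomposition_comulBlock.fst_apply, uhfCoeff_comul, C0Sum.mul_single,
          ← rightBlock_kron (d, p)]
        exact congrArg _ (UHF.kron_mul_kron _ _ _ _)

/-- The identification of the blocks of `A(*)` at equal sequences. -/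
def UHFMonoid.castHom {a a' : UHFMonoid} (h : a = a') :
    UHF (a : ℕ → ℕ) →⋆ₐ[ℂ] UHF (a' : ℕ → ℕ) := UHF.cast (congrArg Subtype.val h)

theorem UHFMonoid.castHom_coord {a a' : UHFMonoid} (h : a = a') (x : UHFSum) :
    UHFMonoid.castHom h (x.coord a) = x.coord a' := by
  subst h
  exact UHF.cast_rfl _

theorem UHFMonoid.castHom_bijective {a a' : UHFMonoid} (h : a = a') :
    Function.Bijective (UHFMonoid.castHom h) := UHF.reindex_bijective _

/-- Relabelled along the two associativity laws, the right-bracketed tensor product has the same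
blocks as the left-bracketed one. Both are thus identified with a single direct sum, and this yields
the associativity isomorphism. -/
theorem isBlockDecomposition_rightBlock_assoc : IsBlockDecomposition
    (B := fun i : (UHFMonoid × UHFMonoid) × UHFMonoid =>
      UHF ((i.1.1 * i.1.2 * i.2 : UHFMonoid) : ℕ → ℕ))
    fun i => (rightBlock (i.1.1, (i.1.2, i.2))).comp
      (UHFMonoid.castHom (mul_assoc i.1.1 i.1.2 i.2) :
        UHF ((i.1.1 * i.1.2 * i.2 : UHFMonoid) : ℕ → ℕ) →⋆ₙₐ[ℂ]
          UHF ((i.1.1 * (i.1.2 * i.2) : UHFMonoid) : ℕ → ℕ)) :=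
  isBlockDecomposition_rightBlock.reindex (Equiv.prodAssoc UHFMonoid UHFMonoid UHFMonoid) _
    fun i => UHFMonoid.castHom_bijective (mul_assoc i.1.1 i.1.2 i.2)

/-- The associativity isomorphism `(A(*) ⊗ A(*)) ⊗ A(*) = A(*) ⊗ (A(*) ⊗ A(*))`. -/
def uhfAssoc : MinTensor (MinTensor UHFSum UHFSum) UHFSum ≃⋆ₐ[ℂ]
    MinTensor UHFSum (MinTensor UHFSum UHFSum) :=
  isBlockDecomposition_leftBlock.equiv.symm.trans isBlockDecomposition_rightBlock_assoc.equiv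

theorem continuous_starAlgEquiv {A B : Type*} [NonUnitalCStarAlgebra A] [NonUnitalCStarAlgebra B]
    (e : A ≃⋆ₐ[ℂ] B) : Continuous e := continuous_starAlgHom e.toNonUnitalStarAlgHom

theorem uhfAssoc_leftBlock (i : (UHFMonoid × UHFMonoid) × UHFMonoid)
    (y : UHF ((i.1.1 * i.1.2 * i.2 : UHFMonoid) : ℕ → ℕ)) :
    uhfAssoc (leftBlock i y) =
      rightBlock (i.1.1, (i.1.2, i.2)) (UHFMonoid.castHom (mul_assoc i.1.1 i.1.2 i.2) y) :=
  (congrArg isBlockDecomposition_rightBlock_assoc.equiv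
    (isBlockDecomposition_leftBlock.equiv_symm_apply i y)).trans
    (isBlockDecomposition_rightBlock_assoc.equiv_single i y)

theorem uhfAssoc_tmul (x y z : UHFSum) : uhfAssoc (MinTensor.tmul (MinTensor.tmul x y) z) =
    MinTensor.tmul x (MinTensor.tmul y z) := by
  have hα := continuous_starAlgEquiv uhfAssoc
  have h0l : ∀ {A B : Type} [NonUnitalCStarAlgebra A] [NonUnitalCStarAlgebra B] (b : B),
      MinTensor.tmul (0 : A) b = 0 := fun b => LinearMap.map_zero₂ MinTensor.tmulₗ b
  have h0r : ∀ {A B : Type} [NonUnitalCStarAlgebra A] [NonUnitalCStarAlgebra B] (a : A),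
      MinTensor.tmul a (0 : B) = 0 := fun a => map_zero (MinTensor.tmulₗ a)
  induction x using C0Sum.induction_on with
  | hc =>
    exact isClosed_eq (hα.comp ((MinTensor.continuous_tmul_left z).comp
      (MinTensor.continuous_tmul_left y))) (MinTensor.continuous_tmul_left _)
  | h0 => rw [h0l, h0l, h0l, map_zero]
  | ha x x' hx hx' =>
    rw [MinTensor.add_tmul, MinTensor.add_tmul, map_add, hx, hx', MinTensor.add_tmul]
  | hs b x =>
    induction y using C0Sum.induction_on with
    | hc =>
      exact isClosed_eq (hα.comp ((MinTensor.continuous_tmul_left z).comp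
        (MinTensor.continuous_tmul_right _))) ((MinTensor.continuous_tmul_right _).comp
          (MinTensor.continuous_tmul_left z))
    | h0 => rw [h0r, h0l, h0l, h0r, map_zero]
    | ha y y' hy hy' =>
      rw [MinTensor.tmul_add, MinTensor.add_tmul, map_add, hy, hy', MinTensor.add_tmul,
        MinTensor.tmul_add]
    | hs c y =>
      induction z using C0Sum.induction_on with
      | hc =>
        exact isClosed_eq (hα.comp (MinTensor.continuous_tmul_right _))
          ((MinTensor.continuous_tmul_right _).comp (MinTensor.continuous_tmul_right _))
      | h0 => rw [h0r, h0r, h0r, map_zero]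
      | ha z z' hz hz' =>
        rw [MinTensor.tmul_add, map_add, hz, hz', MinTensor.tmul_add, MinTensor.tmul_add]
      | hs d z =>
        rw [← comulBlock_kron (b, c), ← leftBlock_kron ((b, c), d), uhfAssoc_leftBlock,
          ← comulBlock_kron (c, d), ← rightBlock_kron (b, (c, d))]
        exact congrArg _ (UHF.cast_kron_kron _ _ _)

/-- On block (b, c, d) the two sides are multiplication by x_{(bc)d} and by x_{b(cd)}, which
correspond under the relabelling of that block. -/
theorem isCoassociative_uhfComul : IsCoassociative uhfComul := by
  refine ⟨uhfAssoc, uhfComulTensorId, uhfIdTensorComul, uhfAssoc_tmul, isComulTensorId_uhf,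
    isIdTensorComul_uhf, fun x t => ?_⟩
  induction t using isBlockDecomposition_leftBlock.induction_on with
  | hc =>
    exact isClosed_eq ((continuous_starAlgEquiv uhfAssoc).comp (ContinuousLinearMap.continuous _))
      ((ContinuousLinearMap.continuous _).comp (continuous_starAlgEquiv uhfAssoc))
  | h0 => simp only [map_zero]
  | ha s t hs ht => simp only [map_add, hs, ht]
  | hb i y =>
    rw [uhfComulTensorId_fst, uhfAssoc_leftBlock, uhfAssoc_leftBlock, uhfIdTensorComul_fst,
      uhfCoeff_comul, uhfCoeff_comul, map_mul, UHFMonoid.castHom_coord]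

end Coassociativity

/-! ### The counit. -/

section Counit

/-- The extension of `ε ⊗ id`. -/
def uhfCounitTensorId : 𝓜(ℂ, MinTensor UHFSum UHFSum) →⋆ₐ[ℂ] 𝓜(ℂ, UHFSum) :=
  isBlockDecomposition_comulBlock.pullback (C0Sum.isBlockDecomposition_single _)
    (fun a => (1, a)) fun a => UHFMonoid.castHom (one_mul a)

/-- The extension of `id ⊗ ε`. -/
def uhfIdTensorCounit : 𝓜(ℂ, MinTensor UHFSum UHFSum) →⋆ₐ[ℂ] 𝓜(ℂ, UHFSum) :=
  isBlockDecomposition_comulBlock.pullback (C0Sum.isBlockDecomposition_single _)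
    (fun a => (a, 1)) fun a => UHFMonoid.castHom (mul_one a)

theorem coord_one_eq_smul (x : UHFSum) : x.coord 1 = uhfCounit x • (1 : UHF 1) := by
  rw [← Algebra.algebraMap_eq_smul_one]
  exact (algebraMap_uhfOneHom (x.coord 1)).symm

theorem multiplier_ext_single {m m' : 𝓜(ℂ, UHFSum)}
    (h : ∀ a, (C0Sum.isBlockDecomposition_single _).coeff a m =
      (C0Sum.isBlockDecomposition_single fun a : UHFMonoid => UHF (a : ℕ → ℕ)).coeff a m') :
    m = m' := (C0Sum.isBlockDecomposition_single _).multiplier_ext h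

theorem coeff_single_coe (a : UHFMonoid) (x : UHFSum) :
    (C0Sum.isBlockDecomposition_single fun a : UHFMonoid => UHF (a : ℕ → ℕ)).coeff a
      (x : 𝓜(ℂ, UHFSum)) = x.coord a :=
  (C0Sum.isBlockDecomposition_single _).coeff_eq fun y => C0Sum.mul_single x a y

/-- The extension of ε ⊗ id reads the components at the pairs (1, a). For x ⊗ y this component is
x_1 ⊗ y_a = ε(x) y_a, and for Δ(x) it is x_{1·a} = x_a; the other side is symmetric. -/
theorem isCounit_uhfCounit : IsCounit uhfComul uhfCounit := by
  refine ⟨uhfCounitTensorId, uhfIdTensorCounit,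
    isBlockDecomposition_comulBlock.pullback_nondegenerate _ _ _,
    isBlockDecomposition_comulBlock.pullback_nondegenerate _ _ _,
    fun x y => multiplier_ext_single fun a => ?_, fun x y => multiplier_ext_single fun a => ?_,
    fun x => ⟨multiplier_ext_single fun a => ?_, multiplier_ext_single fun a => ?_⟩⟩
  · refine (isBlockDecomposition_comulBlock.coeff_pullback _ _ _ _ a).trans ?_
    rw [uhfCoeff_tmul, coeff_single_coe, C0Sum.coord_smul]
    refine (congrArg (fun z => UHF.cast (one_mul _) (UHF.kron z _)) (coord_one_eq_smul x)).trans ?_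
    rw [UHF.smul_kron, map_smul, UHF.cast_one_kron]
  · refine (isBlockDecomposition_comulBlock.coeff_pullback _ _ _ _ a).trans ?_
    rw [uhfCoeff_tmul, coeff_single_coe, C0Sum.coord_smul]
    refine (congrArg (fun z => UHF.cast (mul_one _) (UHF.kron _ z)) (coord_one_eq_smul y)).trans ?_
    rw [UHF.kron_smul, map_smul, UHF.cast_kron_one]
  · refine (isBlockDecomposition_comulBlock.coeff_pullback _ _ _ _ a).trans ?_
    rw [uhfCoeff_comul, coeff_single_coe, UHFMonoid.castHom_coord]
  · refine (isBlockDecomposition_comulBlock.coeff_pullback _ _ _ _ a).trans ?_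
    rw [uhfCoeff_comul, coeff_single_coe, UHFMonoid.castHom_coord]

end Counit

/-! ### The flip and the failure of cocommutativity. -/

section Cocommutativity

/-- Two decompositions of A(*) ⊗ A(*) with the same blocks define an automorphism; comparing this
one with `comulBlock` gives the flip. -/
theorem isBlockDecomposition_comulBlock_swap : IsBlockDecomposition
    (B := fun p : UHFMonoid × UHFMonoid => UHF ((p.1 * p.2 : UHFMonoid) : ℕ → ℕ))
    fun p => (comulBlock p.swap).comp
      (UHF.swap (p.1 : ℕ → ℕ) (p.2 : ℕ → ℕ) : UHF ((p.1 : ℕ → ℕ) * (p.2 : ℕ → ℕ)) →⋆ₙₐ[ℂ]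
        UHF ((p.2 : ℕ → ℕ) * (p.1 : ℕ → ℕ))) :=
  isBlockDecomposition_comulBlock.reindex (Equiv.prodComm UHFMonoid UHFMonoid) _
    fun _ => UHF.reindex_bijective _

/-- The flip automorphism of `A(*) ⊗ A(*)`. -/
def uhfFlip : MinTensor UHFSum UHFSum ≃⋆ₐ[ℂ] MinTensor UHFSum UHFSum :=
  isBlockDecomposition_comulBlock.equiv.symm.trans isBlockDecomposition_comulBlock_swap.equiv

theorem uhfFlip_comulBlock (p : UHFMonoid × UHFMonoid)
    (y : UHF ((p.1 * p.2 : UHFMonoid) : ℕ → ℕ)) :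
    uhfFlip (comulBlock p y) = comulBlock p.swap (UHF.swap (p.1 : ℕ → ℕ) (p.2 : ℕ → ℕ) y) :=
  (congrArg isBlockDecomposition_comulBlock_swap.equiv
    (isBlockDecomposition_comulBlock.equiv_symm_apply p y)).trans
    (isBlockDecomposition_comulBlock_swap.equiv_single p y)

theorem uhfFlip_tmul (x y : UHFSum) : uhfFlip (MinTensor.tmul x y) = MinTensor.tmul y x := by
  have hσ := continuous_starAlgEquiv uhfFlip
  have h0l : ∀ z : UHFSum, MinTensor.tmul (0 : UHFSum) z = 0 :=
    fun z => LinearMap.map_zero₂ MinTensor.tmulₗ z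
  have h0r : ∀ z : UHFSum, MinTensor.tmul z (0 : UHFSum) = 0 :=
    fun z => map_zero (MinTensor.tmulₗ z)
  induction x using C0Sum.induction_on with
  | hc =>
    exact isClosed_eq (hσ.comp (MinTensor.continuous_tmul_left y))
      (MinTensor.continuous_tmul_right y)
  | h0 => rw [h0l, h0r, map_zero]
  | ha x x' hx hx' => rw [MinTensor.add_tmul, map_add, hx, hx', MinTensor.tmul_add]
  | hs b x =>
    induction y using C0Sum.induction_on with
    | hc =>
      exact isClosed_eq (hσ.comp (MinTensor.continuous_tmul_right _))
        (MinTensor.continuous_tmul_left _)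
    | h0 => rw [h0l, h0r, map_zero]
    | ha y y' hy hy' => rw [MinTensor.tmul_add, map_add, hy, hy', MinTensor.add_tmul]
    | hs c y =>
      rw [← comulBlock_kron (b, c), uhfFlip_comulBlock, ← comulBlock_kron (c, b)]
      exact congrArg _ (UHF.swap_kron _ _)

/-- The constant sequence `n + 2`. -/
def UHFMonoid.const (n : ℕ) : UHFMonoid := ⟨fun _ => n + 2, Or.inl fun _ => Nat.le_add_left 2 n⟩

/-- Cocommutativity is a condition on every automorphism that acts as the flip, so its failure
requires the flip to exist, which `uhfFlip` provides. Invariance would force the exchange of digits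
A(b·c) → A(c·b) to be the identity, but for b = 2, c = 3 it permutes the matrix units nontrivially.
-/
theorem not_isCocommutative_uhfComul : ¬ IsCocommutative uhfComul := fun hco => by
  let b := UHFMonoid.const 0
  let c := UHFMonoid.const 1
  have h1 : ∀ z : UHF ((b * c : UHFMonoid) : ℕ → ℕ),
      UHF.swap (b : ℕ → ℕ) (c : ℕ → ℕ) z = UHFMonoid.castHom (mul_comm b c) z := fun z => by
    -- On the unit of block (b, c), the side σ(Δ(x) t) has the component `UHF.swap` z in block (c,
    -- b), and the side Δ(x) σ(t) has the component x_{c·b}, which is z itself.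
    have h := hco uhfFlip uhfFlip_tmul (C0Sum.single (b * c) z) (comulBlock (b, c) 1)
    rw [isBlockDecomposition_comulBlock.fst_apply, uhfFlip_comulBlock, uhfFlip_comulBlock,
      isBlockDecomposition_comulBlock.fst_apply, uhfCoeff_comul, uhfCoeff_comul, mul_one] at h
    have h' := isBlockDecomposition_comulBlock.injective (c, b) h
    rw [map_one, mul_one, C0Sum.coord_single_same] at h'
    refine h'.trans ?_
    refine (UHFMonoid.castHom_coord (mul_comm b c) _).symm.trans ?_
    rw [C0Sum.coord_single_same]
  let P : UHFIndex ((b * c : UHFMonoid) : ℕ → ℕ) 1 := fun _ => (1 : Fin 6)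
  let Q : UHFIndex ((c * b : UHFMonoid) : ℕ → ℕ) 1 := fun _ => (1 : Fin 6)
  have h2 := h1 (UHF.ofMatrix _ 1 (unit P P))
  have h3 := ((UHF.reindex_ofMatrix _ 1 (unit P P)).symm.trans h2).trans
    (UHF.reindex_ofMatrix _ 1 (unit P P))
  have h4 : Function.Injective (UHF.ofMatrix ((c * b : UHFMonoid) : ℕ → ℕ) 1) :=
    (AddMonoidHomClass.isometry_of_norm _ (UHF.norm_ofMatrix _ 1)).injective
  have h5 := congrArg (fun M => UHFMatrix.entry M Q Q) (h4 h3)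
  simp only [entry_reindex, entry_unit] at h5
  -- Counting from zero, 1 = 2·0 + 1 has digits (0, 1) in the order 3 × 2; exchanged, they give 3·1
  -- + 0 = 3 in the order 2 × 3. The exchange therefore moves the matrix unit at index 1.
  have h6 : (UHFIndex.map (fun j => finSwap (b.1 j) (c.1 j)) 1).symm Q ≠ P := fun h =>
    absurd (congrFun h 0) (by decide : (finSwap 2 3).symm (1 : Fin 6) ≠ (1 : Fin 6))
  rw [if_neg fun h => h6 h.1, if_pos ⟨rfl, rfl⟩] at h5
  exact zero_ne_one h5

end Cocommutativity

end UHFBialgebra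

theorem mainTheorem1 :
    (IsCStarBialgebra uhfComul ∧ ¬ IsCocommutative uhfComul ∧ IsProperComul uhfComul ∧
      IsCounit uhfComul uhfCounit) ∧ HasCancellation uhfComul :=
  ⟨⟨⟨dense_span_uhfComul, isCoassociative_uhfComul⟩, not_isCocommutative_uhfComul,
    isProperComul_uhfComul, isCounit_uhfCounit⟩, hasCancellation_uhfComul⟩
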